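/- A \emph{labeled graph} $G$ is a finite simple undirected graph each of whose vertices $v$ carries a label $(\mathrm{fr}(v),\mathrm{sgn}(v))$ with framing $\mathrm{fr}(v)\in\{0,1\}$ and sign $\mathrm{sgn}(v)\in\{1,-1\}$. Let $v_1,\dots,v_n$ be its vertices and let $A=(a_{ij})$ be the adjacency matrix over $\mathbb Z_2$: for $i\ne j$, $a_{ij}=1$ iff $v_i,v_j$ are adjacent, and $a_{ii}=\mathrm{fr}(v_i)$. For a state $s\subset\{v_1,\dots,v_n\}$ let $V(s)$ be the $\mathbb Z_2$-vector space with generators $x_1,\dots,x_n$ and relations $r_1^s=\dots=r_n^s=0$, where $r_i^s=x_i+\sum_{v_j\in s}a_{ij}x_j$ if $v_i\notin s$ and $r_i^s=\sum_{v_j\in s}a_{ij}x_j$ if $v_i\in s$. Let $s\oplus i$ be $s\cup\{v_i\}$ if $v_i\notin s$ and $s\setminus\{v_i\}$ if $v_i\in s$. There is an arrow $s\to s\oplus i$ iff either $\mathrm{sgn}(v_i)=-1$ and $v_i\notin s$, or $\mathrm{sgn}(v_i)=1$ and $v_i\in s$. To this arrow is assigned the (well defined) linear map $\bigwedge^*V(s)\to\bigwedge^*V(s\oplus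 i)$ given by $u\mapsto x_i\wedge u$ if $x_i=0$ in $V(s)$ and by $u\mapsto u$ if $x_i\neq0$ in $V(s)$. Let $C(G)=\bigoplus_s\bigwedge^*V(s)$, with differential $\partial$ the sum of the maps assigned to all arrows (so $\partial^2=0$), and let $\mathrm{Kh}(G)=\ker\partial/\operatorname{im}\partial$, a $\mathbb Z_2$-vector space. Let $N(v)$ be the set of vertices adjacent to $v$. The Reidemeister moves are the following operations and their inverses. * $\Omega_1$: add an isolated vertex labeled $(0,1)$ or $(0,-1)$. * $\Omega_2$: add two vertices that are either adjacent and labeled $(1,-1)$ and $(1,1)$, or nonadjacent and labeled $(0,-1)$ and $(0,1)$, and that have the same neighbours among the other vertices. * $\Omega_3$: let $u,v,w$ be three distinct vertices labeled $(0,-1)$ with $N(u)=\{v,w\}$ ($v$ and $w$ may or may not be adjacent). Change the adjacency of $u$ so that its set of neighbours becomes $(N(v)\setminus N(w))\cup(N(w)\setminus N(v))$ ($N(v)$ and $N(w)$ taken before the move), and change the signs of $v$ and $w$ to $+1$. All other adjacencies and labels are unchanged. * $\Omega_4$: let $u,v$ be adjacent vertices labeled $(0,\alpha)$ and $(0,\beta)$.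 Change the label of $u$ to $(0,-\beta)$ and that of $v$ to $(0,-\alpha)$, and change the adjacency of each unordered pair of vertices $t,w\notin\{u,v\}$ such that, for one of the two orderings of the pair, $t\in N(u)$ and $w\in N(v)\setminus N(u)$, or $t\in N(v)$ and $w\in N(u)\setminus N(v)$. All other adjacencies and labels are unchanged. * $\Omega_4'$: let $v$ be a vertex labeled $(1,\alpha)$. Change the adjacency of each pair of distinct vertices $t,w\in N(v)$, the framing of each $w\in N(v)$, and the sign of $v$. All other adjacencies and labels are unchanged. A \emph{graph-link} is an equivalence class of labeled graphs under the equivalence relation generated by isomorphism of labeled graphs and the moves $\Omega_1,\Omega_2,\Omega_3,\Omega_4,\Omega_4'$. **Theorem.** If $\widetilde G$ is obtained from $G$ by one of the moves $\Omega_1,\Omega_2,\Omega_3,\Omega_4,\Omega_4'$, then $\mathrm{Kh}(G)$ and $\mathrm{Kh}(\widetilde G)$ are isomorphic as $\mathbb Z_2$-vector spaces. **Corollary.** If $G$ and $H$ represent the same graph-link, then $\mathrm{Kh}(G)\cong\mathrm{Kh}(H)$. That is, $\mathrm{Kh}$ is an invariant of graph-links. -/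

import Mathlib

set_option linter.unusedSectionVars false

universe u v

/-- A simple undirected graph in which every vertex carries a framing in `{0, 1} = ZMod 2`
and a sign in `{1, -1} = ℤˣ`. -/
structure LabeledGraph (V : Type u) where
  graph : SimpleGraph V
  framing : V → ZMod 2
  sign : V → ℤˣ

namespace LabeledGraph

section Flip

variable {V : Type u} [DecidableEq V]

/-- The state `s ⊕ i`: the vertex `i` is removed from `s` if it belongs to `s`, and added to `s`
if it does not. -/
def flip (s : Finset V) (i : V) : Finset V := symmDiff s {i}

lemma mem_flip {s : Finset V} {i k : V} : k ∈ flip s i ↔ (k ∈ s ∧ k ≠ i) ∨ (k = i ∧ k ∉ s) := by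
  simp [flip, Finset.mem_symmDiff]

lemma flip_comm (s : Finset V) (i j : V) : flip (flip s i) j = flip (flip s j) i := by
  exact symmDiff_right_comm s {i} {j}

lemma flip_flip (s : Finset V) (i : V) : flip (flip s i) i = s := by
  rw [flip, flip, symmDiff_symmDiff_cancel_right]

end Flip

section Complex

variable {V : Type u} [Fintype V] [DecidableEq V] (G : LabeledGraph V)

open Classical in
/-- The adjacency matrix over `ZMod 2`, with the framings on the diagonal. -/
noncomputable def adjMatrix : Matrix V V (ZMod 2) :=
  fun i j => if i = j then G.framing i else if G.graph.Adj i j then 1 else 0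

/-- The generator `x_i` of the free vector space on the vertices. -/
def X (i : V) : V → ZMod 2 := Pi.single i 1

/-- The relator `r_i^s`. -/
noncomputable def relator (s : Finset V) (i : V) : V → ZMod 2 :=
  if i ∈ s then ∑ j ∈ s, G.adjMatrix i j • X j
  else X i + ∑ j ∈ s, G.adjMatrix i j • X j

/-- The span of the relators of the state `s`. -/
def relations (s : Finset V) : Submodule (ZMod 2) (V → ZMod 2) :=
  Submodule.span (ZMod 2) (Set.range (G.relator s))

/-- The vector space `V(s)`, generated by all `x_i` subject to the relators of `s`. -/
abbrev StateSpace (s : Finset V) : Type u := (V → ZMod 2) ⧸ G.relations s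

/-- The class of `x_i` in `V(s)`. -/
def gen (s : Finset V) (i : V) : G.StateSpace s := (G.relations s).mkQ (X i)

/-- The exterior algebra of `V(s)`. -/
abbrev StateAlgebra (s : Finset V) : Type u := ExteriorAlgebra (ZMod 2) (G.StateSpace s)

/-- The algebra homomorphism `Λ⟨x_i⟩ → Λ V(s)` induced by the projection. -/
noncomputable def proj (s : Finset V) :
    ExteriorAlgebra (ZMod 2) (V → ZMod 2) →ₐ[ZMod 2] G.StateAlgebra s :=
  ExteriorAlgebra.map (G.relations s).mkQ

open Classical in
/-- The element by which the edge map `s → s ⊕ i` multiplies: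
`x_i` if `x_i = 0` in `V(s)`, and `1` if `x_i ≠ 0` in `V(s)`. -/
noncomputable def edgeFactor (s : Finset V) (i : V) : ExteriorAlgebra (ZMod 2) (V → ZMod 2) :=
  if G.gen s i = 0 then ExteriorAlgebra.ι (ZMod 2) (X i) else 1

/-! ### The edge maps are well defined -/

/-- Coordinates of the linear functionals on `V(s)`; the functional given by `p`
sends `x_i` to `p i + (A p) i`. -/
def dualCoords (s : Finset V) : Submodule (ZMod 2) (V → ZMod 2) where
  carrier := {p | (∀ i, i ∉ s → p i = 0) ∧ ∀ i ∈ s, G.adjMatrix.mulVec p i = 0}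
  add_mem' := by
    rintro p q ⟨h1, h2⟩ ⟨h3, h4⟩
    refine ⟨fun i hi => ?_, fun i hi => ?_⟩
    · simp [h1 i hi, h3 i hi]
    · simp [Matrix.mulVec_add, h2 i hi, h4 i hi]
  zero_mem' := by simp
  smul_mem' := by
    rintro c p ⟨h1, h2⟩
    refine ⟨fun i hi => ?_, fun i hi => ?_⟩
    · simp [h1 i hi]
    · simp [Matrix.mulVec_smul, h2 i hi]

/-- The value on `x_i` of the functional with coordinates `p`. -/
noncomputable def val (i : V) : (V → ZMod 2) →ₗ[ZMod 2] ZMod 2 :=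
  LinearMap.proj i + LinearMap.proj i ∘ₗ G.adjMatrix.mulVecLin

lemma val_apply (i : V) (p : V → ZMod 2) : G.val i p = p i + G.adjMatrix.mulVec p i := rfl

lemma adjMatrix_symm (i j : V) : G.adjMatrix i j = G.adjMatrix j i := by
  unfold adjMatrix
  by_cases h : i = j
  · subst h; rfl
  · rw [if_neg h, if_neg (Ne.symm h)]
    have hc := G.graph.adj_comm i j
    by_cases hA : G.graph.Adj i j
    · rw [if_pos hA, if_pos (hc.1 hA)]
    · rw [if_neg hA, if_neg (mt hc.2 hA)]

lemma dot_X (w : V → ZMod 2) (φ : Module.Dual (ZMod 2) (V → ZMod 2)) :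
    φ w = ∑ k, w k * φ (X k) := by
  conv_lhs => rw [LinearMap.pi_apply_eq_sum_univ φ w]
  refine Finset.sum_congr rfl fun k _ => ?_
  rw [smul_eq_mul]
  congr 2
  ext j
  simp [X, Pi.single_apply, eq_comm]

lemma mem_relations_iff (s : Finset V) (w : V → ZMod 2) :
    w ∈ G.relations s ↔ ∀ p ∈ G.dualCoords s, ∑ k, w k * G.val k p = 0 := by
  constructor
  · intro hw p hp
    let φ : (V → ZMod 2) →ₗ[ZMod 2] ZMod 2 := ∑ k, (G.val k p) • LinearMap.proj k
    have hφ : ∀ w, φ w = ∑ k, w k * G.val k p := fun w => by simp [φ, mul_comm]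
    have hX : ∀ i, φ (X i) = G.val i p := fun i => by simp [hφ, X, Pi.single_apply]
    have hsum : ∀ i, φ (∑ j ∈ s, G.adjMatrix i j • X j) = G.adjMatrix.mulVec p i := by
      intro i
      rw [map_sum, Matrix.mulVec, dotProduct, ← Finset.sum_subset (Finset.subset_univ s)]
      · refine Finset.sum_congr rfl fun j hj => ?_
        rw [map_smul, hX, val_apply, hp.2 j hj, add_zero, smul_eq_mul]
      · intro j _ hj
        rw [hp.1 j hj, mul_zero]
    rw [← hφ]
    suffices G.relations s ≤ LinearMap.ker φ from this hw
    refine Submodule.span_le.2 ?_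
    rintro _ ⟨i, rfl⟩
    rw [SetLike.mem_coe, LinearMap.mem_ker, relator]
    split_ifs with hi
    · rw [hsum, hp.2 i hi]
    · rw [map_add, hsum, hX, val_apply, hp.1 i hi, zero_add, CharTwo.add_self_eq_zero]
  · intro h
    by_contra hw
    obtain ⟨φ, hφw, hφ⟩ := Submodule.exists_dual_map_eq_bot_of_notMem hw inferInstance
    have hker : ∀ r ∈ G.relations s, φ r = 0 := fun r hr => by
      have : φ r ∈ (G.relations s).map φ := ⟨r, hr, rfl⟩
      rwa [hφ] at this
    let p : V → ZMod 2 := fun k => if k ∈ s then φ (X k) else 0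
    have hA : ∀ i, G.adjMatrix.mulVec p i = φ (∑ j ∈ s, G.adjMatrix i j • X j) := by
      intro i
      simp [Matrix.mulVec, dotProduct, p, map_sum]
    have hr : ∀ i, φ (G.relator s i) = 0 := fun i => hker _ (Submodule.subset_span ⟨i, rfl⟩)
    have hval : ∀ i, G.val i p = φ (X i) := by
      intro i
      have := hr i
      rw [val_apply, hA]
      unfold relator at this
      split_ifs at this with hi
      · simp only [this, p, hi, if_true, add_zero]
      · rw [map_add] at this
        simp only [p, hi, if_false, zero_add]
        exact (CharTwo.add_eq_zero.1 this).symm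
    refine hφw ?_
    rw [dot_X w φ, ← h p ⟨fun i hi => by simp [p, hi], fun i hi => ?_⟩]
    · exact Finset.sum_congr rfl fun k _ => by rw [hval]
    · rw [hA]
      have := hr i
      rwa [relator, if_pos hi] at this

lemma gen_eq_zero_iff (s : Finset V) (i : V) :
    G.gen s i = 0 ↔ ∀ p ∈ G.dualCoords s, G.val i p = 0 := by
  rw [gen, Submodule.mkQ_apply, Submodule.Quotient.mk_eq_zero, mem_relations_iff]
  simp [X, Pi.single_apply]

lemma gen_eq_iff (s : Finset V) (i j : V) :
    G.gen s i = G.gen s j ↔ ∀ p ∈ G.dualCoords s, G.val i p = G.val j p := by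
  rw [gen, gen, ← sub_eq_zero, ← map_sub, Submodule.mkQ_apply, Submodule.Quotient.mk_eq_zero,
    mem_relations_iff]
  simp [X, Pi.single_apply, sub_mul, Finset.sum_sub_distrib, sub_eq_zero]

/-- The pairing of functionals on `V(s)` and `V(t)`. -/
lemma sum_val_mul_val {s t : Finset V} {p q : V → ZMod 2} (hp : p ∈ G.dualCoords s)
    (hq : q ∈ G.dualCoords t) : ∑ k ∈ symmDiff s t, G.val k p * G.val k q = 0 := by
  have h : ∑ k, (p k * G.adjMatrix.mulVec q k + G.adjMatrix.mulVec p k * q k) = 0 := by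
    rw [Finset.sum_add_distrib]
    have : ∑ k, G.adjMatrix.mulVec p k * q k = ∑ k, p k * G.adjMatrix.mulVec q k := by
      simp only [Matrix.mulVec, dotProduct, Finset.sum_mul, Finset.mul_sum]
      rw [Finset.sum_comm]
      refine Finset.sum_congr rfl fun i _ => Finset.sum_congr rfl fun j _ => ?_
      rw [G.adjMatrix_symm]; ring
    rw [this, CharTwo.add_self_eq_zero]
  rw [← h, ← Finset.sum_subset (Finset.subset_univ (symmDiff s t))]
  · refine Finset.sum_congr rfl fun k hk => ?_
    rw [val_apply, val_apply]
    rcases Finset.mem_symmDiff.1 hk with ⟨h1, h2⟩ | ⟨h1, h2⟩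
    · rw [hp.2 k h1, hq.1 k h2]; ring
    · rw [hp.1 k h2, hq.2 k h1]; ring
  · intro k _ hk
    rw [Finset.mem_symmDiff] at hk
    by_cases h1 : k ∈ s
    · have h2 : k ∈ t := by tauto
      rw [hp.2 k h1, hq.2 k h2]; ring
    · have h2 : k ∉ t := by tauto
      rw [hp.1 k h1, hq.1 k h2]; ring

lemma val_mul_val {s : Finset V} {i : V} {p q : V → ZMod 2} (hp : p ∈ G.dualCoords s)
    (hq : q ∈ G.dualCoords (flip s i)) : G.val i p * G.val i q = 0 := by
  have := G.sum_val_mul_val hp hq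
  rwa [flip, symmDiff_symmDiff_cancel_left, Finset.sum_singleton] at this

lemma val_mul_val₂ {s : Finset V} {i j : V} (hij : i ≠ j) {p q : V → ZMod 2}
    (hp : p ∈ G.dualCoords s) (hq : q ∈ G.dualCoords (flip (flip s i) j)) :
    G.val i p * G.val i q + G.val j p * G.val j q = 0 := by
  have := G.sum_val_mul_val hp hq
  have h2 : symmDiff s (flip (flip s i) j) = {i, j} := by
    rw [flip, flip, symmDiff_assoc, symmDiff_symmDiff_cancel_left]
    ext k
    simp only [Finset.mem_symmDiff, Finset.mem_singleton, Finset.mem_insert]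
    grind
  rwa [h2, Finset.sum_pair hij] at this

lemma mem_dualCoords_flip {s : Finset V} {i : V} {p : V → ZMod 2} (hp : p ∈ G.dualCoords s)
    (h : G.val i p = 0) : p ∈ G.dualCoords (flip s i) := by
  have h0 : p i = 0 ∧ G.adjMatrix.mulVec p i = 0 := by
    rw [val_apply] at h
    by_cases hi : i ∈ s
    · have := hp.2 i hi
      simp_all
    · have := hp.1 i hi
      simp_all
  refine ⟨fun k hk => ?_, fun k hk => ?_⟩
  · by_cases hki : k = i
    · rw [hki]; exact h0.1
    · exact hp.1 k fun hks => hk (mem_flip.2 (Or.inl ⟨hks, hki⟩))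
  · by_cases hki : k = i
    · rw [hki]; exact h0.2
    · rcases mem_flip.1 hk with ⟨h1, _⟩ | ⟨h1, _⟩
      · exact hp.2 k h1
      · exact absurd h1 hki

lemma eq_zero_or_one (a : ZMod 2) : a = 0 ∨ a = 1 := by
  revert a; decide

lemma gen_flip_eq_zero {s : Finset V} {i : V} (h : G.gen s i ≠ 0) : G.gen (flip s i) i = 0 := by
  rw [Ne, gen_eq_zero_iff] at h
  push Not at h
  obtain ⟨p, hp, hp1⟩ := h
  rw [gen_eq_zero_iff]
  intro q hq
  exact (mul_eq_zero.1 (G.val_mul_val hp hq)).resolve_left hp1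

lemma proj_ι (s : Finset V) (x : V → ZMod 2) :
    G.proj s (ExteriorAlgebra.ι (ZMod 2) x) =
      ExteriorAlgebra.ι (ZMod 2) ((G.relations s).mkQ x) :=
  ExteriorAlgebra.map_apply_ι _ _

lemma proj_ι_X (s : Finset V) (i : V) :
    G.proj s (ExteriorAlgebra.ι (ZMod 2) (X i)) = ExteriorAlgebra.ι (ZMod 2) (G.gen s i) :=
  G.proj_ι s _

lemma proj_surjective (s : Finset V) : Function.Surjective (G.proj s) :=
  ExteriorAlgebra.map_surjective_iff.2 (Submodule.mkQ_surjective _)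

lemma exists_val_eq_one {s : Finset V} {i : V} (h : G.gen s i ≠ 0) :
    ∃ p ∈ G.dualCoords s, G.val i p = 1 := by
  rw [Ne, gen_eq_zero_iff] at h
  push Not at h
  obtain ⟨p, hp, hp1⟩ := h
  exact ⟨p, hp, (eq_zero_or_one _).resolve_left hp1⟩

lemma face_zero {s : Finset V} {i j : V} (ha : G.gen s i = 0) (ha' : G.gen (flip s j) i ≠ 0) :
    G.gen (flip (flip s j) i) i = 0 ∧ G.gen (flip (flip s j) i) j = 0 := by
  refine ⟨G.gen_flip_eq_zero ha', ?_⟩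
  rw [gen_eq_zero_iff] at ha ⊢
  obtain ⟨y, hy, hyi⟩ := G.exists_val_eq_one ha'
  have back : ∀ p ∈ G.dualCoords (flip s j), G.val j p = 0 → G.val i p = 0 := fun p hp h => by
    have := G.mem_dualCoords_flip hp h
    rw [flip_flip] at this
    exact ha p this
  have hyj : G.val j y = 1 :=
    (eq_zero_or_one _).resolve_left fun h => one_ne_zero (hyi.symm.trans (back y hy h))
  intro q hq
  have hqi : G.val i q = 0 := by
    have := G.val_mul_val hy hq
    rwa [hyi, one_mul] at this
  have hq' := G.mem_dualCoords_flip hq hqi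
  rw [flip_flip] at hq'
  refine (eq_zero_or_one _).resolve_right fun h => ?_
  have := back (q + y) (add_mem hq' hy) (by rw [map_add, h, hyj]; rfl)
  rw [map_add, hqi, hyi] at this
  exact absurd this (by decide)

lemma face_ne_zero {s : Finset V} {i j : V} (hb : G.gen s j ≠ 0)
    (ha' : G.gen (flip s j) i ≠ 0) : G.gen s i ≠ 0 ∧ G.gen (flip s i) j ≠ 0 := by
  obtain ⟨y, hy, hyj⟩ := G.exists_val_eq_one hb
  obtain ⟨z, hz, hzi⟩ := G.exists_val_eq_one ha'
  have hzj : G.val j z = 0 := by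
    have := G.val_mul_val hy hz
    rwa [hyj, one_mul] at this
  have hz' := G.mem_dualCoords_flip hz hzj
  rw [flip_flip] at hz'
  simp only [Ne, gen_eq_zero_iff]
  push Not
  refine ⟨⟨z, hz', by rw [hzi]; decide⟩, ?_⟩
  rcases eq_zero_or_one (G.val i y) with h | h
  · exact ⟨y, G.mem_dualCoords_flip hy h, by rw [hyj]; decide⟩
  · exact ⟨y + z, G.mem_dualCoords_flip (add_mem hy hz') (by rw [map_add, h, hzi]; rfl),
      by rw [map_add, hyj, hzj]; decide⟩

lemma gen_ne_zero_of_face {s : Finset V} {i j : V} (ha : G.gen s i = 0) (hb : G.gen s j ≠ 0) :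
    G.gen (flip s i) j ≠ 0 := by
  obtain ⟨y, hy, hyj⟩ := G.exists_val_eq_one hb
  rw [gen_eq_zero_iff] at ha
  rw [Ne, gen_eq_zero_iff]
  intro h
  exact one_ne_zero (hyj.symm.trans (h y (G.mem_dualCoords_flip hy (ha y hy))))

lemma face_eq {s : Finset V} {i j : V} (hij : i ≠ j) (ha : G.gen s i ≠ 0)
    (ha' : G.gen (flip s j) i = 0) :
    G.gen (flip (flip s i) j) i = G.gen (flip (flip s i) j) j := by
  obtain ⟨y, hy, hyi⟩ := G.exists_val_eq_one ha
  rw [gen_eq_zero_iff] at ha'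
  have hyj : G.val j y = 1 := (eq_zero_or_one _).resolve_left fun h =>
    one_ne_zero (hyi.symm.trans (ha' y (G.mem_dualCoords_flip hy h)))
  rw [gen_eq_iff]
  intro q hq
  have := G.val_mul_val₂ hij hy hq
  rw [hyi, hyj, one_mul, one_mul] at this
  exact CharTwo.add_eq_zero.1 this

/-- Multiplication by the edge factor kills the relations of `s`. -/
lemma edgeFactor_mul_ι (s : Finset V) (i : V) {r : V → ZMod 2} (hr : r ∈ G.relations s) :
    G.proj (flip s i) (G.edgeFactor s i * ExteriorAlgebra.ι (ZMod 2) r) = 0 := by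
  have key : ∃ c : ZMod 2, (G.relations (flip s i)).mkQ r = c • G.gen (flip s i) i := by
    by_cases hc : ∀ p ∈ G.dualCoords (flip s i), G.val i p = 0 → ∑ k, r k * G.val k p = 0
    · by_cases h0 : r ∈ G.relations (flip s i)
      · exact ⟨0, by rwa [zero_smul, Submodule.mkQ_apply, Submodule.Quotient.mk_eq_zero]⟩
      refine ⟨1, ?_⟩
      rw [one_smul, gen, ← sub_eq_zero, ← map_sub, Submodule.mkQ_apply,
        Submodule.Quotient.mk_eq_zero, mem_relations_iff]
      rw [mem_relations_iff] at h0
      push Not at h0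
      obtain ⟨q, hq, hq1⟩ := h0
      have hsub : ∀ p, ∑ k, (r - X i) k * G.val k p = ∑ k, r k * G.val k p - G.val i p := by
        intro p
        simp [X, Pi.single_apply, sub_mul, Finset.sum_sub_distrib]
      have hadd : ∀ p p', ∑ k, r k * G.val k (p + p') =
          ∑ k, r k * G.val k p + ∑ k, r k * G.val k p' := by
        intro p p'
        simp [mul_add, Finset.sum_add_distrib]
      have hqi : G.val i q = 1 := (eq_zero_or_one _).resolve_left fun h => hq1 (hc q hq h)
      have hq1' := (eq_zero_or_one _).resolve_left hq1
      intro p hp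
      rw [hsub]
      rcases eq_zero_or_one (G.val i p) with h | h
      · rw [h, hc p hp h, sub_zero]
      · have := hc (p + q) (add_mem hp hq) (by rw [map_add, h, hqi]; decide)
        rw [hadd, hq1', CharTwo.add_eq_zero] at this
        rw [this, h, sub_self]
    · exfalso
      refine hc fun p hp h => ?_
      have := G.mem_dualCoords_flip hp h
      rw [flip_flip] at this
      exact (G.mem_relations_iff s r).1 hr p this
  obtain ⟨c, hc⟩ := key
  rw [map_mul, proj_ι, hc, map_smul, mul_smul_comm, edgeFactor]
  split_ifs with h
  · rw [proj_ι, gen, ExteriorAlgebra.ι_sq_zero, smul_zero]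
  · rw [G.gen_flip_eq_zero h, map_zero, mul_zero, smul_zero]

lemma edgeFactor_mul_ι_comm (s : Finset V) (i : V) (m : V → ZMod 2) :
    ∃ ε : ZMod 2, G.edgeFactor s i * ExteriorAlgebra.ι (ZMod 2) m =
      ε • (ExteriorAlgebra.ι (ZMod 2) m * G.edgeFactor s i) := by
  unfold edgeFactor
  split_ifs with h
  · refine ⟨-1, ?_⟩
    rw [neg_one_smul]
    exact eq_neg_of_add_eq_zero_left (ExteriorAlgebra.ι_add_mul_swap _ _)
  · exact ⟨1, by rw [one_mul, mul_one, one_smul]⟩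

lemma proj_edgeFactor_mul_map (s : Finset V) (i : V)
    (f : (V → ZMod 2) →ₗ[ZMod 2] (V → ZMod 2)) (hf : ∀ y, y - f y ∈ G.relations s)
    (w : ExteriorAlgebra (ZMod 2) (V → ZMod 2)) :
    G.proj (flip s i) (G.edgeFactor s i * w) =
      G.proj (flip s i) (G.edgeFactor s i * ExteriorAlgebra.map f w) := by
  induction w using CliffordAlgebra.left_induction with
  | algebraMap r =>
    congr 2
    exact (AlgHom.commutes (ExteriorAlgebra.map f) r).symm
  | add x y hx hy => simp only [map_add, mul_add, hx, hy]
  | ι_mul x m hx =>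
    change G.proj _ (_ * (ExteriorAlgebra.ι (ZMod 2) m * x)) =
      G.proj _ (_ * ExteriorAlgebra.map f (ExteriorAlgebra.ι (ZMod 2) m * x))
    have h1 := G.edgeFactor_mul_ι s i (hf m)
    obtain ⟨ε, hε⟩ := G.edgeFactor_mul_ι_comm s i (f m)
    rw [map_sub, mul_sub, map_sub, sub_eq_zero] at h1
    rw [map_mul (ExteriorAlgebra.map f), ExteriorAlgebra.map_apply_ι, ← mul_assoc, ← mul_assoc,
      map_mul (G.proj _) _ x, h1, ← map_mul, hε, smul_mul_assoc, smul_mul_assoc, map_smul,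
      map_smul, mul_assoc, mul_assoc, map_mul, map_mul _ _ (_ * ExteriorAlgebra.map f x), hx]

/-- Multiplication by the edge factor maps relations of `Λ V(s)` to relations of
`Λ V(s ⊕ i)`. -/
lemma ker_proj_le (s : Finset V) (i : V) :
    LinearMap.ker (G.proj s).toLinearMap ≤ LinearMap.ker
      ((G.proj (flip s i)).toLinearMap ∘ₗ LinearMap.mulLeft (ZMod 2) (G.edgeFactor s i)) := by
  intro w hw
  obtain ⟨σ, hσ⟩ := (G.relations s).mkQ.exists_rightInverse_of_surjective
    (LinearMap.range_eq_top.2 (Submodule.mkQ_surjective _))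
  have hσ' : ∀ z, (G.relations s).mkQ (σ z) = z := fun z => LinearMap.congr_fun hσ z
  rw [LinearMap.mem_ker, AlgHom.toLinearMap_apply] at hw
  rw [LinearMap.mem_ker, LinearMap.comp_apply, LinearMap.mulLeft_apply, AlgHom.toLinearMap_apply,
    G.proj_edgeFactor_mul_map s i (σ ∘ₗ (G.relations s).mkQ), ← ExteriorAlgebra.map_comp_map,
    AlgHom.comp_apply]
  · rw [proj] at hw
    rw [hw, map_zero, mul_zero, map_zero]
  · intro y
    rw [← Submodule.Quotient.mk_eq_zero, ← Submodule.mkQ_apply, map_sub, LinearMap.comp_apply,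
      hσ', sub_self]

/-! ### The complex -/

/-- The edge map `Λ V(s) → Λ V(s ⊕ i)`, `u ↦ x_i ∧ u` if `x_i = 0` in `V(s)` and `u ↦ u`
if `x_i ≠ 0` in `V(s)`, where a polynomial `u` in the generators is read in both algebras;
see `edgeMap_proj`. -/
noncomputable def edgeMap (s : Finset V) (i : V) :
    G.StateAlgebra s →ₗ[ZMod 2] G.StateAlgebra (flip s i) :=
  (LinearMap.ker (G.proj s).toLinearMap).liftQ
      ((G.proj (flip s i)).toLinearMap ∘ₗ LinearMap.mulLeft (ZMod 2) (G.edgeFactor s i))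
      (G.ker_proj_le s i) ∘ₗ
    ((G.proj s).toLinearMap.quotKerEquivOfSurjective (G.proj_surjective s)).symm.toLinearMap

lemma edgeMap_proj (s : Finset V) (i : V) (w : ExteriorAlgebra (ZMod 2) (V → ZMod 2)) :
    G.edgeMap s i (G.proj s w) = G.proj (flip s i) (G.edgeFactor s i * w) := by
  have h : ((G.proj s).toLinearMap.quotKerEquivOfSurjective (G.proj_surjective s)).symm
      (G.proj s w) = Submodule.Quotient.mk w := by
    rw [LinearEquiv.symm_apply_eq]
    rfl
  rw [edgeMap, LinearMap.comp_apply, LinearEquiv.coe_coe, h]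
  rfl

/-- The edge between `s` and `s ⊕ i` of the hypercube is oriented from `s` to `s ⊕ i`. -/
def IsOutgoing (s : Finset V) (i : V) : Prop :=
  (G.sign i = -1 ∧ i ∉ s) ∨ (G.sign i = 1 ∧ i ∈ s)

instance (s : Finset V) : DecidablePred (G.IsOutgoing s) := fun _ =>
  inferInstanceAs (Decidable (_ ∨ _))

/-- The chain space, the direct sum of the exterior algebras `Λ V(s)` over all states `s`. -/
abbrev Chain : Type u := (s : Finset V) → G.StateAlgebra s

/-- The differential, the sum of the edge maps over all oriented edges of the hypercube. -/
noncomputable def differential : G.Chain →ₗ[ZMod 2] G.Chain :=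
  ∑ s : Finset V, ∑ i with G.IsOutgoing s i,
    LinearMap.single (ZMod 2) G.StateAlgebra (flip s i) ∘ₗ G.edgeMap s i ∘ₗ LinearMap.proj s

/-- The 2-faces of the hypercube commute. -/
lemma proj_edgeFactor_comm (s : Finset V) {i j : V} (hij : i ≠ j) :
    G.proj (flip (flip s i) j) (G.edgeFactor (flip s i) j * G.edgeFactor s i) =
      G.proj (flip (flip s i) j) (G.edgeFactor (flip s j) i * G.edgeFactor s j) := by
  have swap : ∀ a b : G.StateSpace (flip (flip s i) j),
      ExteriorAlgebra.ι (ZMod 2) a * ExteriorAlgebra.ι (ZMod 2) b =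
        ExteriorAlgebra.ι (ZMod 2) b * ExteriorAlgebra.ι (ZMod 2) a := by
    intro a b
    rw [eq_neg_of_add_eq_zero_left (ExteriorAlgebra.ι_add_mul_swap a b), ← neg_one_smul (ZMod 2),
      show (-1 : ZMod 2) = 1 from rfl, one_smul]
  have zero : ∀ a : G.StateSpace (flip (flip s i) j), a = 0 → ExteriorAlgebra.ι (ZMod 2) a = 0 :=
    fun a h => by rw [h, map_zero]
  have f1 (ha : G.gen s i = 0) (ha' : G.gen (flip s j) i ≠ 0) := G.face_zero ha ha'
  have f2 (hb : G.gen s j = 0) (hb' : G.gen (flip s i) j ≠ 0) := G.face_zero hb hb'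
  have f3 (hb : G.gen s j ≠ 0) (ha' : G.gen (flip s j) i ≠ 0) := G.face_ne_zero hb ha'
  have f4 (ha : G.gen s i ≠ 0) (hb' : G.gen (flip s i) j ≠ 0) := G.face_ne_zero ha hb'
  have f5 (ha : G.gen s i ≠ 0) (ha' : G.gen (flip s j) i = 0) := G.face_eq hij ha ha'
  rw [flip_comm s j i] at f1
  unfold edgeFactor
  by_cases ha : G.gen s i = 0 <;> by_cases hb : G.gen s j = 0 <;>
    by_cases ha' : G.gen (flip s j) i = 0 <;> by_cases hb' : G.gen (flip s i) j = 0
  all_goals simp only [ha, hb, ha', hb', if_true, if_false, map_mul, map_one, mul_one, one_mul,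
    proj_ι_X]
  · exact swap _ _
  · rw [zero _ (f2 hb hb').2, zero _ (f2 hb hb').1, mul_zero]
  · rw [zero _ (f1 ha ha').1, zero _ (f1 ha ha').2, mul_zero]
  · rw [zero _ (f1 ha ha').1, zero _ (f1 ha ha').2]
  · exact absurd hb' (G.gen_ne_zero_of_face ha hb)
  · exact absurd ha (f3 hb ha').1
  · exact absurd ha (f3 hb ha').1
  · exact absurd ha' (G.gen_ne_zero_of_face hb ha)
  · exact absurd hb (f4 ha hb').1
  · exact absurd hb (f4 ha hb').1
  · rw [f5 ha ha']
  · exact absurd ha' (f4 ha hb').2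
  · exact absurd hb' (f3 hb ha').2

lemma differential_single (s : Finset V) (w : ExteriorAlgebra (ZMod 2) (V → ZMod 2)) :
    G.differential (Pi.single s (G.proj s w)) = ∑ i with G.IsOutgoing s i,
      Pi.single (flip s i) (G.proj (flip s i) (G.edgeFactor s i * w)) := by
  rw [differential, LinearMap.sum_apply, Finset.sum_eq_single s]
  · rw [LinearMap.sum_apply]
    refine Finset.sum_congr rfl fun i _ => ?_
    rw [LinearMap.comp_apply, LinearMap.comp_apply, LinearMap.proj_apply, Pi.single_eq_same,
      edgeMap_proj]
    rfl
  · intro t _ hts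
    rw [LinearMap.sum_apply]
    refine Finset.sum_eq_zero fun i _ => ?_
    rw [LinearMap.comp_apply, LinearMap.comp_apply, LinearMap.proj_apply,
      Pi.single_eq_of_ne hts, map_zero, map_zero]
  · intro h
    exact absurd (Finset.mem_univ s) h

lemma single_proj_congr {s t : Finset V} (h : s = t)
    (w : ExteriorAlgebra (ZMod 2) (V → ZMod 2)) :
    (Pi.single s (G.proj s w) : G.Chain) = Pi.single t (G.proj t w) := by
  subst h; rfl

/-- The differential squares to zero. -/
theorem differential_comp_differential : G.differential ∘ₗ G.differential = 0 := by
  refine LinearMap.pi_ext fun s x => ?_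
  obtain ⟨w, rfl⟩ := G.proj_surjective s x
  rw [LinearMap.comp_apply, differential_single, map_sum, LinearMap.zero_apply]
  simp only [differential_single]
  rw [Finset.sum_sigma']
  have hne : ∀ a : (_ : V) × V, a ∈ ({i | G.IsOutgoing s i} : Finset V).sigma
      (fun i => ({j | G.IsOutgoing (flip s i) j} : Finset V)) → a.1 ≠ a.2 := by
    rintro ⟨i, j⟩ h hij
    obtain rfl : i = j := hij
    simp only [Finset.mem_sigma, Finset.mem_filter, Finset.mem_univ, true_and] at h
    obtain ⟨h1, h2⟩ := h
    have hu : (1 : ℤˣ) ≠ -1 := by decide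
    unfold IsOutgoing at h1 h2
    rw [mem_flip] at h2
    rcases h1 with ⟨h1, h3⟩ | ⟨h1, h3⟩ <;> simp_all
  refine Finset.sum_involution (fun a _ => ⟨a.2, a.1⟩) ?_ ?_ ?_ ?_
  · rintro ⟨i, j⟩ h
    have hij := hne _ h
    dsimp only at hij ⊢
    rw [G.single_proj_congr (flip_comm s j i), ← mul_assoc, ← mul_assoc, map_mul _ _ w,
      map_mul _ _ w, G.proj_edgeFactor_comm s hij]
    rw [← two_smul (ZMod 2), show (2 : ZMod 2) = 0 from rfl, zero_smul]
  · rintro ⟨i, j⟩ h _ heq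
    have hij := hne _ h
    simp only [Sigma.mk.injEq, heq_eq_eq] at heq
    exact hij heq.2
  · rintro ⟨i, j⟩ h
    have hij := hne _ h
    simp only [Finset.mem_sigma, Finset.mem_filter, Finset.mem_univ, true_and] at h ⊢
    unfold IsOutgoing at h ⊢
    simp only [mem_flip] at h ⊢
    grind
  · rintro ⟨i, j⟩ h
    rfl

/-- The reduced (odd) Khovanov homology of `G`: cycles modulo boundaries. -/
abbrev Kh : Type u :=
  LinearMap.ker G.differential ⧸
    (LinearMap.range G.differential).submoduleOf (LinearMap.ker G.differential)

end Complex

section Moves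

variable {V : Type u} {W : Type v}

/-- The labeled subgraph induced on a set of vertices. -/
def induce (G : LabeledGraph V) (S : Set V) : LabeledGraph S where
  graph := G.graph.induce S
  framing x := G.framing x
  sign x := G.sign x

/-- Isomorphism of labeled graphs. -/
def IsIsomorphic (G : LabeledGraph V) (H : LabeledGraph W) : Prop :=
  ∃ e : G.graph ≃g H.graph,
    (∀ x, H.framing (e x) = G.framing x) ∧ ∀ x, H.sign (e x) = G.sign x

/-- `Ω₁`: `H` is obtained from `G` by adding an isolated vertex `x` labeled `(0, ±1)`. -/
def Omega1 (G : LabeledGraph V) (H : LabeledGraph W) : Prop :=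
  ∃ x : W, (∀ y, ¬ H.graph.Adj x y) ∧ H.framing x = 0 ∧ G.IsIsomorphic (H.induce {x}ᶜ)

/-- `Ω₂`: `H` is obtained from `G` by adding two vertices `x`, `y`, either adjacent with labels
`(1, -1)`, `(1, 1)` or nonadjacent with labels `(0, -1)`, `(0, 1)`, which have the same
neighbours among the other vertices. -/
def Omega2 (G : LabeledGraph V) (H : LabeledGraph W) : Prop :=
  ∃ x y : W, x ≠ y ∧ H.sign x = -1 ∧ H.sign y = 1 ∧
    ((H.graph.Adj x y ∧ H.framing x = 1 ∧ H.framing y = 1) ∨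
      (¬ H.graph.Adj x y ∧ H.framing x = 0 ∧ H.framing y = 0)) ∧
    (∀ z, z ≠ x → z ≠ y → (H.graph.Adj x z ↔ H.graph.Adj y z)) ∧
    G.IsIsomorphic (H.induce {x, y}ᶜ)

/-- `Ω₃`: in `G` the vertices `u`, `v`, `w` are labeled `(0, -1)` and the neighbours of `u` are
exactly `v` and `w`; in `H` the neighbours of `u` are exactly the vertices of the symmetric
difference of `N(v)` and `N(w)` and the signs of `v` and `w` are `1`; everything else is
unchanged. -/
def Omega3 (G H : LabeledGraph V) : Prop :=
  ∃ u v w : V, v ≠ w ∧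
    (∀ x, x = u ∨ x = v ∨ x = w → G.framing x = 0 ∧ G.sign x = -1) ∧
    (∀ t, G.graph.Adj u t ↔ t = v ∨ t = w) ∧
    (∀ t, H.graph.Adj u t ↔ Xor (G.graph.Adj v t) (G.graph.Adj w t)) ∧
    (∀ t t', t ≠ u → t' ≠ u → (H.graph.Adj t t' ↔ G.graph.Adj t t')) ∧
    (∀ t, H.framing t = G.framing t) ∧
    H.sign v = 1 ∧ H.sign w = 1 ∧ ∀ t, t ≠ v → t ≠ w → H.sign t = G.sign t

/-- The (ordered) pairs `(t, w)` with `t ∈ N(u)` and `w ∈ N(v) \ N(u)`, or `t ∈ N(v)` and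
`w ∈ N(u) \ N(v)`. -/
def PivotPair (G : LabeledGraph V) (u v t w : V) : Prop :=
  (G.graph.Adj u t ∧ G.graph.Adj v w ∧ ¬ G.graph.Adj u w) ∨
    (G.graph.Adj v t ∧ G.graph.Adj u w ∧ ¬ G.graph.Adj v w)

/-- `Ω₄`: for adjacent vertices `u`, `v` of `G` labeled `(0, α)`, `(0, β)`, their labels become
`(0, -β)`, `(0, -α)`, and the adjacency of an unordered pair `{t, w}` of vertices different from
`u` and `v` is changed if and only if `(t, w)` or `(w, t)` is a pivot pair. -/
def Omega4 (G H : LabeledGraph V) : Prop :=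
  ∃ u v : V, G.graph.Adj u v ∧ G.framing u = 0 ∧ G.framing v = 0 ∧
    (∀ t w, t ≠ u → t ≠ v → w ≠ u → w ≠ v →
      (H.graph.Adj t w ↔ Xor (G.graph.Adj t w) (G.PivotPair u v t w ∨ G.PivotPair u v w t))) ∧
    (∀ t, (H.graph.Adj u t ↔ G.graph.Adj u t) ∧ (H.graph.Adj v t ↔ G.graph.Adj v t)) ∧
    (∀ t, H.framing t = G.framing t) ∧
    H.sign u = -G.sign v ∧ H.sign v = -G.sign u ∧
    ∀ t, t ≠ u → t ≠ v → H.sign t = G.sign t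

/-- `Ω'₄`: for a vertex `v` of `G` with framing `1`, the adjacency of every two distinct
neighbours of `v`, the framing of every neighbour of `v` and the sign of `v` are changed. -/
def Omega4' (G H : LabeledGraph V) : Prop :=
  ∃ v : V, G.framing v = 1 ∧
    (∀ t w, t ≠ w →
      (H.graph.Adj t w ↔ Xor (G.graph.Adj t w) (G.graph.Adj v t ∧ G.graph.Adj v w))) ∧
    (∀ t, G.graph.Adj v t → H.framing t = G.framing t + 1) ∧
    (∀ t, ¬ G.graph.Adj v t → H.framing t = G.framing t) ∧
    H.sign v = -G.sign v ∧ ∀ t, t ≠ v → H.sign t = G.sign t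

end Moves

end LabeledGraph

/-- A labeled graph together with its finite vertex set. -/
structure FinLabeledGraph : Type (u + 1) where
  V : Type u
  [fintype : Fintype V]
  [decidableEq : DecidableEq V]
  graph : LabeledGraph V

namespace FinLabeledGraph

attribute [instance] FinLabeledGraph.fintype FinLabeledGraph.decidableEq

/-- The reduced Khovanov homology. -/
abbrev Kh (G : FinLabeledGraph.{u}) : Type u := G.graph.Kh

/-- One Reidemeister move, or a renaming of the vertices. -/
inductive Move : FinLabeledGraph.{u} → FinLabeledGraph.{u} → Prop
  | iso (G H : FinLabeledGraph.{u}) : G.graph.IsIsomorphic H.graph → Move G H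
  | omega1 (G H : FinLabeledGraph.{u}) : G.graph.Omega1 H.graph → Move G H
  | omega2 (G H : FinLabeledGraph.{u}) : G.graph.Omega2 H.graph → Move G H
  | omega3 (V : Type u) [Fintype V] [DecidableEq V] (G H : LabeledGraph V) :
      G.Omega3 H → Move ⟨V, G⟩ ⟨V, H⟩
  | omega4 (V : Type u) [Fintype V] [DecidableEq V] (G H : LabeledGraph V) :
      G.Omega4 H → Move ⟨V, G⟩ ⟨V, H⟩
  | omega4' (V : Type u) [Fintype V] [DecidableEq V] (G H : LabeledGraph V) :
      G.Omega4' H → Move ⟨V, G⟩ ⟨V, H⟩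

/-- The equivalence relation generated by the moves. -/
def linkSetoid : Setoid FinLabeledGraph.{u} := Relation.EqvGen.setoid Move

end FinLabeledGraph

/-- Graph-links: labeled graphs modulo the Reidemeister moves. -/
def GraphLink : Type (u + 1) := Quotient FinLabeledGraph.linkSetoid.{u}

/-- The graph-link represented by a labeled graph. -/
def FinLabeledGraph.link (G : FinLabeledGraph.{u}) : GraphLink.{u} :=
  Quotient.mk FinLabeledGraph.linkSetoid G

/-! A functional on `V(s)` is a vector `p` supported on `s` with `A p` zero on `s`, and its value at
`x_k` is `p_k + (A p)_k` (`mem_relations_iff`, `dualEquiv`). So the dual of `V(s)` is the part of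
the graph `{(p, A p)}` on which, for every `k`, one prescribed member of the pair `(p_k, (A p)_k)`
vanishes: the second if `k ∈ s`, the first if `k ∉ s`. An edge map is either the quotient by `x_k`
(`edge_of_gen_ne_zero`) or multiplication of lifts by `x_k` (`edge_of_gen_eq_zero`). Hence a linear
map of coordinates that respects the vanishing conditions and the relevant values, and is onto the
functionals at the start of the edge, induces maps of exterior algebras that commute with the edge
map (`map_transfer_edge`).

Exchanging `p_k` and `(A p)_k`, membership of `k` in the state, and the sign of `k` changes nothing
in this description. The moves `Ω₄` and `Ω₄'` are principal pivots of `A`, which perform exactly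
such exchanges, so their complexes are isomorphic (`nonempty_Kh_equiv_of_pivot`).

The moves `Ω₁`, `Ω₂`, `Ω₃` need cancellation. Suppose a functional `p` on `V(t)` takes the value `1`
at `x_x` and at `x_y`. An edge entering `t` at `x` is then injective, and `Λ V(t)` is the direct sum
of its image and the kernel of the contraction by `p`. An edge leaving `t` at `y` maps that kernel
isomorphically onto `Λ V(t ⊕ y)`. For `Ω₁` one of these two facts suffices. For `Ω₂` both are used
along a path `s₀ → s₀ ⊕ x → s₀ ⊕ x ⊕ y`; the fourth corner `s₀ ⊕ y` survives and carries the complex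
of `G` (`Cancellation.isCore`).

For `Ω₃` such a path is cancelled in the 3-cube of `u`, `v`, `w` on each side, leaving five corners.
They are matched by two correspondences between faces of the cubes, obtained from each other by
exchanging `v` and `w`. Cancellation produces one zigzag differential on each side, and each zigzag
equals an ordinary edge map on the other side (`ThirdMove.map_edge_w`, `ThirdMove.map_edge_w_symm`).
-/

namespace ExteriorAlgebra

/-! ### Contractions of exterior algebras. -/

variable {R M N : Type*} [CommRing R] [AddCommGroup M] [Module R M] [AddCommGroup N] [Module R N]

/-- Contraction of the exterior algebra by a linear functional. -/
noncomputable def contract (φ : Module.Dual R M) : ExteriorAlgebra R M →ₗ[R] ExteriorAlgebra R M :=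
  CliffordAlgebra.contractLeft (Q := (0 : QuadraticForm R M)) φ

lemma contract_ι_mul (φ : Module.Dual R M) (m : M) (z : ExteriorAlgebra R M) :
    contract φ (ι R m * z) = φ m • z - ι R m * contract φ z :=
  CliffordAlgebra.contractLeft_ι_mul φ m z

lemma contract_contract (φ : Module.Dual R M) (z : ExteriorAlgebra R M) :
    contract φ (contract φ z) = 0 :=
  CliffordAlgebra.contractLeft_contractLeft φ z

lemma contract_zero (z : ExteriorAlgebra R M) : contract (0 : Module.Dual R M) z = 0 := by
  rw [contract, map_zero, LinearMap.zero_apply]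

/-- Induction on products of vectors. -/
lemma left_induction {P : ExteriorAlgebra R M → Prop}
    (algebraMap : ∀ r : R, P (algebraMap R _ r)) (add : ∀ x y, P x → P y → P (x + y))
    (ι_mul : ∀ x m, P x → P (ι R m * x)) (z : ExteriorAlgebra R M) : P z :=
  CliffordAlgebra.left_induction _ algebraMap add ι_mul z

lemma contract_algebraMap (φ : Module.Dual R M) (r : R) :
    contract φ (algebraMap R (ExteriorAlgebra R M) r) = 0 :=
  CliffordAlgebra.contractLeft_algebraMap _ φ r

lemma map_contract (f : M →ₗ[R] N) (φ : Module.Dual R N) (z : ExteriorAlgebra R M) :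
    contract φ (map f z) = map f (contract (φ ∘ₗ f) z) := by
  induction z using left_induction with
  | algebraMap r => rw [AlgHom.commutes, contract_algebraMap, contract_algebraMap, map_zero]
  | add x y hx hy => simp only [map_add, hx, hy]
  | ι_mul x m hx =>
    rw [map_mul, map_apply_ι, contract_ι_mul, contract_ι_mul, hx, map_sub, map_smul, map_mul,
      map_apply_ι, LinearMap.comp_apply]

lemma ι_mul_ι_comm_neg (a b : M) : ι R a * ι R b = -(ι R b * ι R a) :=
  eq_neg_of_add_eq_zero_left (ι_add_mul_swap a b)

/-- All further terms of the expansion contain `y` twice and vanish. For `φ y = 1` the map is the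
projection onto `ker φ` along `y`, so elements killed by the contraction are fixed by this
projection. -/
lemma map_id_sub_smulRight (φ : Module.Dual R M) (y : M) (z : ExteriorAlgebra R M) :
    map (LinearMap.id - φ.smulRight y) z = z - ι R y * contract φ z := by
  induction z using left_induction with
  | algebraMap r => rw [AlgHom.commutes, contract_algebraMap, mul_zero, sub_zero]
  | add x y hx hy => simp only [map_add, hx, hy, mul_add]; abel
  | ι_mul x m hx =>
    rw [map_mul, map_apply_ι, hx, contract_ι_mul]
    have h1 : ι R m * (ι R y * contract φ x) = -(ι R y * (ι R m * contract φ x)) := by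
      rw [← mul_assoc, ι_mul_ι_comm_neg, neg_mul, mul_assoc]
    have h2 : ι R y * (ι R y * contract φ x) = 0 := by
      rw [← mul_assoc, ι_sq_zero, zero_mul]
    simp only [LinearMap.sub_apply, LinearMap.id_apply, LinearMap.smulRight_apply, map_sub,
      map_smul, mul_sub, sub_mul, smul_mul_assoc, mul_smul_comm, h1, h2, smul_zero]
    abel

lemma map_map_apply {P : Type*} [AddCommGroup P] [Module R P] (f : M →ₗ[R] N) (g : N →ₗ[R] P)
    (z : ExteriorAlgebra R M) : map g (map f z) = map (g ∘ₗ f) z := by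
  rw [← map_comp_map, AlgHom.comp_apply]

lemma map_bijective {f : M →ₗ[R] N} (hf : Function.Bijective f) :
    Function.Bijective (map f) := by
  let e := LinearEquiv.ofBijective f hf
  have h1 : e.symm.toLinearMap ∘ₗ f = LinearMap.id := LinearMap.ext fun x => e.symm_apply_apply x
  exact ⟨map_injective ⟨_, h1⟩, map_surjective_iff.2 hf.2⟩

end ExteriorAlgebra

/-! ### Homology of subcomplexes with acyclic quotient. -/

section Homology

variable {R M N : Type*} [CommRing R] [AddCommGroup M] [Module R M] [AddCommGroup N] [Module R N]

/-- Cycles modulo boundaries. -/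
abbrev LinearMap.Homology (d : M →ₗ[R] M) : Type _ :=
  LinearMap.ker d ⧸ (LinearMap.range d).submoduleOf (LinearMap.ker d)

/-- A subcomplex with acyclic quotient. -/
structure Submodule.IsReduction (E : Submodule R M) (d : M →ₗ[R] M) : Prop where
  map_mem : ∀ c ∈ E, d c ∈ E
  exists_sub_mem : ∀ c, d c ∈ E → ∃ b, c - d b ∈ E

theorem Submodule.isReduction_top (d : M →ₗ[R] M) : (⊤ : Submodule R M).IsReduction d :=
  ⟨fun _ _ => trivial, fun _ _ => ⟨0, trivial⟩⟩

/-- An injective chain map onto a subcomplex with acyclic quotient is a quasi-isomorphism. -/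
theorem LinearMap.Homology.nonempty_equiv_of_injective {d : M →ₗ[R] M} {d' : N →ₗ[R] N}
    (hd : d ∘ₗ d = 0) (f : N →ₗ[R] M) (hf : Function.Injective f)
    (hcomm : ∀ c, d (f c) = f (d' c)) (hred : (LinearMap.range f).IsReduction d) :
    Nonempty (LinearMap.Homology d' ≃ₗ[R] LinearMap.Homology d) := by
  have hmem : ∀ c ∈ LinearMap.ker d', f c ∈ LinearMap.ker d := fun c hc => by
    rw [LinearMap.mem_ker] at hc ⊢
    rw [hcomm, hc, map_zero]
  let g : LinearMap.ker d' →ₗ[R] LinearMap.ker d := f.restrict hmem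
  let q := ((LinearMap.range d).submoduleOf (LinearMap.ker d)).mkQ ∘ₗ g
  have hker : LinearMap.ker q = (LinearMap.range d').submoduleOf (LinearMap.ker d') := by
    ext ⟨c, hc⟩
    rw [LinearMap.mem_ker, LinearMap.comp_apply, Submodule.mkQ_apply,
      Submodule.Quotient.mk_eq_zero]
    constructor
    · rintro ⟨b, hb⟩
      have hb : d b = f c := hb
      -- A chain whose boundary lies in the image of `f` can be moved into that image by subtracting
      -- a boundary, which does not alter its own boundary.
      obtain ⟨b', e, he⟩ := hred.exists_sub_mem b (hb ▸ ⟨c, rfl⟩)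
      refine ⟨e, hf ?_⟩
      have h0 : d (d b') = 0 := LinearMap.congr_fun hd b'
      rw [← hcomm, he, map_sub, h0, sub_zero, hb]
      rfl
    · rintro ⟨b, hb⟩
      refine ⟨f b, ?_⟩
      rw [hcomm, hb]
      rfl
  have hsurj : Function.Surjective q := by
    intro z
    obtain ⟨⟨c, hc⟩, rfl⟩ := Submodule.mkQ_surjective _ z
    obtain ⟨b, e, he⟩ := hred.exists_sub_mem c (by
      rw [LinearMap.mem_ker.1 hc]; exact zero_mem _)
    have h0 : d (d b) = 0 := LinearMap.congr_fun hd b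
    refine ⟨⟨e, ?_⟩, ?_⟩
    · rw [LinearMap.mem_ker]
      refine hf ?_
      rw [← hcomm, he, map_sub, h0, LinearMap.mem_ker.1 hc, sub_zero, map_zero]
    · rw [LinearMap.comp_apply, ← sub_eq_zero, ← map_sub, Submodule.mkQ_apply,
        Submodule.Quotient.mk_eq_zero]
      refine ⟨-b, ?_⟩
      change d (-b) = f e - c
      rw [he, map_neg]
      abel
  exact ⟨(Submodule.quotEquivOfEq _ _ hker.symm).trans (q.quotKerEquivOfSurjective hsurj)⟩

/-- A relation between two complexes which is a bijection between subcomplexes with acyclic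
quotients, and compatible with the differentials, induces an isomorphism in homology. -/
theorem LinearMap.Homology.nonempty_equiv_of_relation {d₁ : M →ₗ[R] M} {d₂ : N →ₗ[R] N}
    (hd₁ : d₁ ∘ₗ d₁ = 0) (hd₂ : d₂ ∘ₗ d₂ = 0) {E₁ : Submodule R M} {E₂ : Submodule R N}
    (h₁ : E₁.IsReduction d₁) (h₂ : E₂.IsReduction d₂) (Γ : Submodule R (M × N))
    (hΓ : ∀ x ∈ Γ, x.1 ∈ E₁ ∧ x.2 ∈ E₂) (hd : ∀ x ∈ Γ, (d₁ x.1, d₂ x.2) ∈ Γ)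
    (ex₁ : ∀ c ∈ E₁, ∃ c', (c, c') ∈ Γ) (ex₂ : ∀ c' ∈ E₂, ∃ c, (c, c') ∈ Γ)
    (inj₁ : ∀ c', (0, c') ∈ Γ → c' = 0) (inj₂ : ∀ c, (c, 0) ∈ Γ → c = 0) :
    Nonempty (LinearMap.Homology d₁ ≃ₗ[R] LinearMap.Homology d₂) := by
  -- The relation is itself a complex. Its projections are injective chain maps onto `E₁` and `E₂`,
  -- so the homology of `Γ` is compared with both sides and no map between `M` and `N` has to be
  -- constructed.
  let d : Γ →ₗ[R] Γ := (d₁.prodMap d₂).restrict hd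
  let f₁ : Γ →ₗ[R] M := LinearMap.fst R M N ∘ₗ Γ.subtype
  let f₂ : Γ →ₗ[R] N := LinearMap.snd R M N ∘ₗ Γ.subtype
  have r₁ : LinearMap.range f₁ = E₁ := by
    ext c
    constructor
    · rintro ⟨x, rfl⟩
      exact (hΓ _ x.2).1
    · intro hc
      obtain ⟨c', hc'⟩ := ex₁ c hc
      exact ⟨⟨_, hc'⟩, rfl⟩
  have r₂ : LinearMap.range f₂ = E₂ := by
    ext c
    constructor
    · rintro ⟨x, rfl⟩
      exact (hΓ _ x.2).2
    · intro hc
      obtain ⟨c', hc'⟩ := ex₂ c hc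
      exact ⟨⟨_, hc'⟩, rfl⟩
  have i₁ : Function.Injective f₁ := by
    rw [injective_iff_map_eq_zero]
    rintro ⟨⟨a, b⟩, hx⟩ h
    obtain rfl : a = 0 := h
    obtain rfl := inj₁ b hx
    rfl
  have i₂ : Function.Injective f₂ := by
    rw [injective_iff_map_eq_zero]
    rintro ⟨⟨a, b⟩, hx⟩ h
    obtain rfl : b = 0 := h
    obtain rfl := inj₂ a hx
    rfl
  obtain ⟨e₁⟩ := LinearMap.Homology.nonempty_equiv_of_injective (d' := d) hd₁ f₁ i₁
    (fun _ => rfl) (r₁ ▸ h₁)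
  obtain ⟨e₂⟩ := LinearMap.Homology.nonempty_equiv_of_injective (d' := d) hd₂ f₂ i₂
    (fun _ => rfl) (r₂ ▸ h₂)
  exact ⟨e₁.symm.trans e₂⟩

end Homology

namespace LabeledGraph

/-! ### Duality between state spaces and coordinate vectors. -/

section Transfer

variable {V : Type u} [Fintype V] [DecidableEq V] (G : LabeledGraph V)

/-- On `s` the coordinate `(A p)_k` vanishes, so there the value at `x_k` is `p k` itself. -/
lemma eq_zero_of_val_eq_zero {s : Finset V} {p : V → ZMod 2} (hp : p ∈ G.dualCoords s)
    (h : ∀ k, G.val k p = 0) : p = 0 := by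
  funext k
  by_cases hk : k ∈ s
  · have := h k
    rwa [val_apply, hp.2 k hk, add_zero] at this
  · exact hp.1 k hk

/-- The pairing of the free vector space on the vertices with the functionals on `V(s)`. -/
noncomputable def freePairing (s : Finset V) :
    (V → ZMod 2) →ₗ[ZMod 2] Module.Dual (ZMod 2) (G.dualCoords s) :=
  Fintype.linearCombination (ZMod 2) fun k => (G.val k).domRestrict (G.dualCoords s)

lemma freePairing_apply (s : Finset V) (m : V → ZMod 2) (p : G.dualCoords s) :
    G.freePairing s m p = ∑ k, m k * G.val k p := by
  simp [freePairing, Fintype.linearCombination_apply]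

lemma ker_freePairing (s : Finset V) : LinearMap.ker (G.freePairing s) = G.relations s := by
  ext m
  rw [mem_relations_iff, LinearMap.mem_ker]
  constructor
  · intro h p hp
    rw [← G.freePairing_apply s m ⟨p, hp⟩, h, LinearMap.zero_apply]
  · intro h
    refine LinearMap.ext fun p => ?_
    rw [freePairing_apply, h p.1 p.2, LinearMap.zero_apply]

/-- The values on the generators embed the functionals into `V → ZMod 2`. A left inverse of this
embedding extends every linear form on the functionals to the whole of `V → ZMod 2`. -/
lemma freePairing_surjective (s : Finset V) : Function.Surjective (G.freePairing s) := by
  intro φ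
  let ν : G.dualCoords s →ₗ[ZMod 2] (V → ZMod 2) :=
    LinearMap.pi fun k => (G.val k).domRestrict (G.dualCoords s)
  have hν : LinearMap.ker ν = ⊥ := by
    rw [LinearMap.ker_eq_bot']
    rintro ⟨p, hp⟩ h
    exact Subtype.ext (G.eq_zero_of_val_eq_zero hp fun k => congr_fun h k)
  obtain ⟨σ, hσ⟩ := LinearMap.exists_leftInverse_of_injective ν hν
  refine ⟨fun k => (φ ∘ₗ σ) (X k), LinearMap.ext fun p => ?_⟩
  rw [freePairing_apply]
  have h1 : φ p = (φ ∘ₗ σ) (ν p) := by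
    rw [LinearMap.comp_apply, show σ (ν p) = p from LinearMap.congr_fun hσ p]
  rw [h1, dot_X]
  exact Finset.sum_congr rfl fun k _ => mul_comm _ _

/-- `V(s)` is dual to the space of coordinates of its functionals. -/
noncomputable def dualEquiv (s : Finset V) :
    G.StateSpace s ≃ₗ[ZMod 2] Module.Dual (ZMod 2) (G.dualCoords s) :=
  (Submodule.quotEquivOfEq _ _ (G.ker_freePairing s).symm).trans
    ((G.freePairing s).quotKerEquivOfSurjective (G.freePairing_surjective s))

lemma dualEquiv_gen (s : Finset V) (k : V) (p : G.dualCoords s) :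
    G.dualEquiv s (G.gen s k) p = G.val k p := by
  change G.freePairing s (X k) p = _
  simp [freePairing_apply, X, Pi.single_apply]

open Classical in
/-- The functional on `V(s)` with coordinates `p`. -/
noncomputable def functional (s : Finset V) (p : V → ZMod 2) :
    Module.Dual (ZMod 2) (G.StateSpace s) :=
  -- The default `0` lets `p` be an arbitrary vector; membership is only asked for in the lemmas.
  if h : p ∈ G.dualCoords s then
    (Module.Dual.eval (ZMod 2) (G.dualCoords s) ⟨p, h⟩) ∘ₗ (G.dualEquiv s).toLinearMap
  else 0

variable {G}

lemma functional_apply {s : Finset V} {p : V → ZMod 2} (hp : p ∈ G.dualCoords s)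
    (z : G.StateSpace s) : G.functional s p z = G.dualEquiv s z ⟨p, hp⟩ := by
  rw [functional, dif_pos hp]
  rfl

lemma functional_gen {s : Finset V} {p : V → ZMod 2} (hp : p ∈ G.dualCoords s) (k : V) :
    G.functional s p (G.gen s k) = G.val k p := by
  rw [functional_apply hp, dualEquiv_gen]

lemma functional_add {s : Finset V} {p q : V → ZMod 2} (hp : p ∈ G.dualCoords s)
    (hq : q ∈ G.dualCoords s) (z : G.StateSpace s) :
    G.functional s (p + q) z = G.functional s p z + G.functional s q z := by
  rw [functional_apply hp, functional_apply hq, functional_apply (add_mem hp hq), ← map_add]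
  rfl

lemma functional_smul {s : Finset V} {p : V → ZMod 2} (hp : p ∈ G.dualCoords s) (c : ZMod 2)
    (z : G.StateSpace s) : G.functional s (c • p) z = c * G.functional s p z := by
  rw [functional_apply hp, functional_apply (Submodule.smul_mem _ c hp), ← smul_eq_mul,
    ← map_smul]
  rfl

lemma ext_functional {s : Finset V} {z z' : G.StateSpace s}
    (h : ∀ p ∈ G.dualCoords s, G.functional s p z = G.functional s p z') : z = z' := by
  refine (G.dualEquiv s).injective (LinearMap.ext fun ⟨p, hp⟩ => ?_)
  rw [← functional_apply hp, ← functional_apply hp, h p hp]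

variable {W : Type v} [Fintype W] [DecidableEq W] {H : LabeledGraph W}

/-- The map of state spaces dual to a map of functionals. -/
noncomputable def transfer (s : Finset V) (t : Finset W)
    (Φ : (W → ZMod 2) →ₗ[ZMod 2] (V → ZMod 2))
    (h : ∀ p ∈ H.dualCoords t, Φ p ∈ G.dualCoords s) :
    G.StateSpace s →ₗ[ZMod 2] H.StateSpace t :=
  (H.dualEquiv t).symm.toLinearMap ∘ₗ (Φ.restrict h).dualMap ∘ₗ (G.dualEquiv s).toLinearMap

variable {s : Finset V} {t : Finset W} {Φ : (W → ZMod 2) →ₗ[ZMod 2] (V → ZMod 2)}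
  {h : ∀ p ∈ H.dualCoords t, Φ p ∈ G.dualCoords s}

lemma functional_transfer {p : W → ZMod 2} (hp : p ∈ H.dualCoords t) (z : G.StateSpace s) :
    H.functional t p (transfer s t Φ h z) = G.functional s (Φ p) z := by
  rw [functional_apply hp, functional_apply (h p hp), transfer, LinearMap.comp_apply,
    LinearEquiv.coe_coe, LinearEquiv.apply_symm_apply]
  rfl

lemma functional_comp_transfer {p : W → ZMod 2} (hp : p ∈ H.dualCoords t) :
    H.functional t p ∘ₗ transfer s t Φ h = G.functional s (Φ p) :=
  LinearMap.ext fun z => functional_transfer hp z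

lemma transfer_gen {k : V} {k' : W} (hk : ∀ p ∈ H.dualCoords t, G.val k (Φ p) = H.val k' p) :
    transfer s t Φ h (G.gen s k) = H.gen t k' := by
  refine ext_functional fun p hp => ?_
  rw [functional_transfer hp, functional_gen (h p hp), functional_gen hp, hk p hp]

lemma transfer_injective (hΦ : ∀ q ∈ G.dualCoords s, ∃ p ∈ H.dualCoords t, Φ p = q) :
    Function.Injective (transfer s t Φ h) := by
  intro z z' hz
  refine ext_functional fun q hq => ?_
  obtain ⟨p, hp, rfl⟩ := hΦ q hq
  rw [← functional_transfer (h := h) hp, hz, functional_transfer hp]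

lemma transfer_surjective (hΦ : ∀ p ∈ H.dualCoords t, Φ p = 0 → p = 0) :
    Function.Surjective (transfer s t Φ h) := by
  have h1 : Function.Injective (Φ.restrict h) := by
    rw [injective_iff_map_eq_zero]
    rintro ⟨p, hp⟩ h0
    exact Subtype.ext (hΦ p hp (Subtype.ext_iff.1 h0))
  exact (H.dualEquiv t).symm.surjective.comp
    ((LinearMap.dualMap_surjective_of_injective h1).comp (G.dualEquiv s).surjective)

lemma transfer_bijective (hΦ : Set.BijOn Φ (H.dualCoords t) (G.dualCoords s)) :
    Function.Bijective (transfer s t Φ h) := by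
  refine ⟨transfer_injective fun q hq => ?_, transfer_surjective fun p hp h0 => ?_⟩
  · obtain ⟨p, hp, rfl⟩ := hΦ.surjOn hq
    exact ⟨p, hp, rfl⟩
  · exact hΦ.injOn hp (zero_mem _) (h0.trans (map_zero Φ).symm)

/-- A map of state spaces is determined by its effect on functionals. -/
lemma linearMap_ext_functional {f g : G.StateSpace s →ₗ[ZMod 2] H.StateSpace t}
    (hfg : ∀ p ∈ H.dualCoords t, H.functional t p ∘ₗ f = H.functional t p ∘ₗ g) : f = g :=
  LinearMap.ext fun z => ext_functional fun p hp => LinearMap.congr_fun (hfg p hp) z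

end Transfer

/-! ### Edge maps as quotients and multiplications. -/

section Edge

variable {V : Type u} [Fintype V] [DecidableEq V] (G : LabeledGraph V)

/-- The map `V(s) → V(t)` fixing the generators, where the functionals on `V(t)` are among those
on `V(s)`. -/
noncomputable def quot {s t : Finset V} (h : G.dualCoords t ≤ G.dualCoords s) :
    G.StateSpace s →ₗ[ZMod 2] G.StateSpace t :=
  transfer s t LinearMap.id h

variable {G} in
lemma functional_comp_quot {s t : Finset V} (h : G.dualCoords t ≤ G.dualCoords s)
    {p : V → ZMod 2} (hp : p ∈ G.dualCoords t) :
    G.functional t p ∘ₗ G.quot h = G.functional s p :=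
  functional_comp_transfer hp

variable {G} in
lemma quot_gen {s t : Finset V} (h : G.dualCoords t ≤ G.dualCoords s) (k : V) :
    G.quot h (G.gen s k) = G.gen t k :=
  transfer_gen fun _ _ => rfl

variable {G} in
lemma quot_surjective {s t : Finset V} (h : G.dualCoords t ≤ G.dualCoords s) :
    Function.Surjective (G.quot h) :=
  transfer_surjective fun _ _ h0 => h0

lemma quot_comp_mkQ {s t : Finset V} (h : G.dualCoords t ≤ G.dualCoords s) :
    G.quot h ∘ₗ (G.relations s).mkQ = (G.relations t).mkQ :=
  LinearMap.pi_ext' fun k => LinearMap.ext_ring (quot_gen h k)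

lemma map_quot_proj {s t : Finset V} (h : G.dualCoords t ≤ G.dualCoords s)
    (w : ExteriorAlgebra (ZMod 2) (V → ZMod 2)) :
    ExteriorAlgebra.map (G.quot h) (G.proj s w) = G.proj t w := by
  rw [proj, ExteriorAlgebra.map_map_apply, quot_comp_mkQ]
  rfl

variable {G} in
lemma dualCoords_le_of_gen_eq_zero {s : Finset V} {i : V} (h : G.gen s i = 0) :
    G.dualCoords s ≤ G.dualCoords (flip s i) := fun p hp =>
  G.mem_dualCoords_flip hp ((G.gen_eq_zero_iff s i).1 h p hp)

/-- A generator that is nonzero at one end of its edge vanishes at the other, so the two ends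
exchange their roles. Thus along every edge the functionals at one end are among those at the other.
-/
lemma dualCoords_flip_le_of_gen_ne_zero {s : Finset V} {i : V} (h : G.gen s i ≠ 0) :
    G.dualCoords (flip s i) ≤ G.dualCoords s := by
  have := dualCoords_le_of_gen_eq_zero (G.gen_flip_eq_zero h)
  rwa [flip_flip] at this

/-- The edge map `Λ V(s) → Λ V(t)` for `t = s ⊕ i`. -/
noncomputable def edge (s t : Finset V) (i : V) :
    G.StateAlgebra s →ₗ[ZMod 2] G.StateAlgebra t :=
  -- The target is a free variable `t`, so that identities such as `flip (flip t i) i = t` require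
  -- no transport of elements.
  if h : flip s i = t then h ▸ G.edgeMap s i else 0

variable {G}

lemma edge_flip (s : Finset V) (i : V) : G.edge s (flip s i) i = G.edgeMap s i := by
  rw [edge, dif_pos rfl]

/-- Here `quot` runs against the edge, from `V(t)` to `V(s)`: the edge map lifts an element along it
and multiplies the lift by `x_i`. -/
lemma edge_of_gen_eq_zero {s t : Finset V} {i : V} (ht : flip s i = t) (h : G.gen s i = 0)
    (hle : G.dualCoords s ≤ G.dualCoords t) (z : G.StateAlgebra t) :
    G.edge s t i (ExteriorAlgebra.map (G.quot hle) z) =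
      ExteriorAlgebra.ι (ZMod 2) (G.gen t i) * z := by
  subst ht
  obtain ⟨w, rfl⟩ := G.proj_surjective _ z
  rw [map_quot_proj, edge_flip, edgeMap_proj, edgeFactor, if_pos h, map_mul, proj_ι_X]

lemma edge_of_gen_ne_zero {s t : Finset V} {i : V} (ht : flip s i = t) (h : G.gen s i ≠ 0)
    (hle : G.dualCoords t ≤ G.dualCoords s) (z : G.StateAlgebra s) :
    G.edge s t i z = ExteriorAlgebra.map (G.quot hle) z := by
  subst ht
  obtain ⟨w, rfl⟩ := G.proj_surjective _ z
  rw [map_quot_proj, edge_flip, edgeMap_proj, edgeFactor, if_neg h, one_mul]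

lemma edge_congr {s s' t : Finset V} (i : V) (h : s = s') (c : G.Chain) :
    G.edge s t i (c s) = G.edge s' t i (c s') := by
  subst h; rfl

lemma isOutgoing_flip {s : Finset V} {i : V} :
    G.IsOutgoing (flip s i) i ↔ ¬ G.IsOutgoing s i := by
  unfold IsOutgoing
  rw [mem_flip]
  rcases Int.units_eq_one_or (G.sign i) with h | h <;> simp [h]

/-- Each component of the differential is a sum over incoming edges. -/
lemma differential_apply (c : G.Chain) (t : Finset V) :
    G.differential c t = ∑ i with ¬ G.IsOutgoing t i, G.edge (flip t i) t i (c (flip t i)) := by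
  have key : ∀ (s : Finset V) (i : V) (z : G.StateAlgebra s),
      (Pi.single (flip s i) (G.edgeMap s i z) : G.Chain) t =
        if flip s i = t then G.edge s t i z else 0 := by
    intro s i z
    split_ifs with h
    · subst h
      rw [Pi.single_eq_same, edge_flip]
    · rw [Pi.single_eq_of_ne (Ne.symm h)]
  rw [differential]
  simp only [LinearMap.sum_apply, Finset.sum_apply, Finset.sum_filter]
  rw [Finset.sum_comm]
  refine Finset.sum_congr rfl fun i _ => ?_
  rw [Finset.sum_eq_single (flip t i)]
  · by_cases h : G.IsOutgoing t i
    · rw [if_neg (by rwa [isOutgoing_flip, not_not]), if_neg (not_not.2 h)]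
      rfl
    · rw [if_pos (isOutgoing_flip.2 h), if_pos h]
      exact (key _ _ _).trans (if_pos (flip_flip t i))
  · intro s _ hs
    split_ifs with h
    · exact (key _ _ _).trans (if_neg fun h' => hs (by rw [← h', flip_flip]))
    · rfl
  · intro h
    exact absurd (Finset.mem_univ _) h

variable {W : Type v} [Fintype W] [DecidableEq W] {H : LabeledGraph W}

/-- Maps of state spaces dual to the same map of coordinates commute with edge maps. -/
theorem map_transfer_edge {s t : Finset V} {s' t' : Finset W} {i : V} {i' : W}
    (Φ : (W → ZMod 2) →ₗ[ZMod 2] (V → ZMod 2)) (hst : flip s i = t) (hst' : flip s' i' = t')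
    (hs : ∀ p ∈ H.dualCoords s', Φ p ∈ G.dualCoords s)
    (ht : ∀ p ∈ H.dualCoords t', Φ p ∈ G.dualCoords t)
    (hsurj : ∀ q ∈ G.dualCoords s, ∃ p ∈ H.dualCoords s', Φ p = q)
    (vs : ∀ p ∈ H.dualCoords s', G.val i (Φ p) = H.val i' p)
    (vt : ∀ p ∈ H.dualCoords t', G.val i (Φ p) = H.val i' p) (z : G.StateAlgebra s) :
    ExteriorAlgebra.map (transfer t t' Φ ht) (G.edge s t i z) =
      H.edge s' t' i' (ExteriorAlgebra.map (transfer s s' Φ hs) z) := by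
  subst hst hst'
  by_cases h : G.gen s i = 0
  · have h' : H.gen s' i' = 0 := by
      rw [← transfer_gen (h := hs) vs, h, map_zero]
    -- Both edges are multiplications of lifts, and lifting is compatible with the transfers because
    -- these commute with the quotient maps that run against the edges.
    obtain ⟨z, rfl⟩ := ExteriorAlgebra.map_surjective_iff.2
      (quot_surjective (dualCoords_le_of_gen_eq_zero h)) z
    have hcomp : transfer s s' Φ hs ∘ₗ G.quot (dualCoords_le_of_gen_eq_zero h) =
        H.quot (dualCoords_le_of_gen_eq_zero h') ∘ₗ transfer _ _ Φ ht := by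
      refine linearMap_ext_functional fun p hp => ?_
      rw [← LinearMap.comp_assoc, ← LinearMap.comp_assoc, functional_comp_transfer hp,
        functional_comp_quot _ (hs p hp), functional_comp_quot _ hp,
        functional_comp_transfer (dualCoords_le_of_gen_eq_zero h' hp)]
    rw [edge_of_gen_eq_zero rfl h, map_mul, ExteriorAlgebra.map_apply_ι, transfer_gen vt,
      ExteriorAlgebra.map_map_apply, hcomp, ← ExteriorAlgebra.map_map_apply,
      edge_of_gen_eq_zero rfl h']
  -- The transfer at `s` is injective by `hsurj` and keeps the generator nonzero, so both edges are
  -- quotient maps.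
  · have h' : H.gen s' i' ≠ 0 := by
      rwa [Ne, ← transfer_gen (h := hs) vs,
        map_eq_zero_iff _ (transfer_injective hsurj)]
    rw [edge_of_gen_ne_zero rfl h (G.dualCoords_flip_le_of_gen_ne_zero h),
      edge_of_gen_ne_zero rfl h' (H.dualCoords_flip_le_of_gen_ne_zero h'),
      ExteriorAlgebra.map_map_apply, ExteriorAlgebra.map_map_apply]
    congr 2
    refine linearMap_ext_functional fun p hp => ?_
    rw [← LinearMap.comp_assoc, ← LinearMap.comp_assoc, functional_comp_transfer hp,
      functional_comp_quot _ (ht p hp), functional_comp_quot _ hp,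
      functional_comp_transfer (H.dualCoords_flip_le_of_gen_ne_zero h' hp)]

/-- Contraction by a functional vanishing on the generator of an edge commutes with the
edge map. -/
lemma contract_edge {s t : Finset V} {i : V} {p : V → ZMod 2} (hst : flip s i = t)
    (hp : p ∈ G.dualCoords s) (hi : G.val i p = 0) (z : G.StateAlgebra s) :
    ExteriorAlgebra.contract (G.functional t p) (G.edge s t i z) =
      G.edge s t i (ExteriorAlgebra.contract (G.functional s p) z) := by
  have hp' : p ∈ G.dualCoords t := hst ▸ G.mem_dualCoords_flip hp hi
  subst hst
  by_cases h : G.gen s i = 0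
  · obtain ⟨z, rfl⟩ := ExteriorAlgebra.map_surjective_iff.2
      (quot_surjective (dualCoords_le_of_gen_eq_zero h)) z
    rw [ExteriorAlgebra.map_contract, functional_comp_quot _ hp, edge_of_gen_eq_zero rfl h,
      edge_of_gen_eq_zero rfl h, ExteriorAlgebra.contract_ι_mul, functional_gen hp', hi, zero_smul,
      zero_sub, ← neg_one_smul (ZMod 2), show (-1 : ZMod 2) = 1 from rfl, one_smul]
  · have hle := G.dualCoords_flip_le_of_gen_ne_zero h
    rw [edge_of_gen_ne_zero rfl h hle, edge_of_gen_ne_zero rfl h hle,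
      ExteriorAlgebra.map_contract, functional_comp_quot _ hp']

end Edge

end LabeledGraph

namespace LabeledGraph

/-! ### Comparison of two complexes along surviving states. -/

section Core

variable {V : Type u} [Fintype V] [DecidableEq V] (G : LabeledGraph V)

/-- A subcomplex with acyclic quotient, whose elements are given by arbitrary components at the
states in `S`. -/
structure IsCore (E : Submodule (ZMod 2) G.Chain) (S : Set (Finset V)) : Prop where
  reduction : E.IsReduction G.differential
  eq_zero : ∀ c ∈ E, (∀ s ∈ S, c s = 0) → c = 0
  exists_eq : ∀ c : G.Chain, ∃ c' ∈ E, ∀ s ∈ S, c' s = c s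

lemma isCore_top : G.IsCore ⊤ Set.univ :=
  ⟨Submodule.isReduction_top _, fun _ _ h => funext fun s => h s trivial,
    fun c => ⟨c, trivial, fun _ _ => rfl⟩⟩

variable {G}
variable {W : Type v} [Fintype W] [DecidableEq W] {H : LabeledGraph W}

/-- Cores whose states correspond to each other, with isomorphic state spaces, compute the same
homology. -/
theorem nonempty_Kh_equiv_of_isCore {E : Submodule (ZMod 2) G.Chain}
    {E' : Submodule (ZMod 2) H.Chain} {S : Set (Finset V)} {S' : Set (Finset W)}
    (hE : G.IsCore E S) (hE' : H.IsCore E' S') (P : Finset V → Finset W → Prop)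
    (Φ : Finset V → Finset W → (W → ZMod 2) →ₗ[ZMod 2] (V → ZMod 2))
    (hP : ∀ s t, P s t → s ∈ S ∧ t ∈ S') (ex : ∀ s ∈ S, ∃ t, P s t) (ex' : ∀ t ∈ S', ∃ s, P s t)
    (uniq : ∀ s t t', P s t → P s t' → t = t') (uniq' : ∀ s s' t, P s t → P s' t → s = s')
    (bij : ∀ s t, P s t → Set.BijOn (Φ s t) (H.dualCoords t) (G.dualCoords s))
    (hd : ∀ c ∈ E, ∀ c' ∈ E', (∀ s t (h : P s t),
        c' t = ExteriorAlgebra.map (transfer s t (Φ s t) (bij s t h).mapsTo) (c s)) →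
      ∀ s t (h : P s t), H.differential c' t =
        ExteriorAlgebra.map (transfer s t (Φ s t) (bij s t h).mapsTo) (G.differential c s)) :
    Nonempty (G.Kh ≃ₗ[ZMod 2] H.Kh) := by
  have hθ : ∀ s t (h : P s t), Function.Bijective
      (ExteriorAlgebra.map (transfer s t (Φ s t) (bij s t h).mapsTo)) := fun s t h =>
    ExteriorAlgebra.map_bijective (transfer_bijective (bij s t h))
  -- Components at cancelled states are not compared; they are controlled only by membership in `E`
  -- and `E'`.
  let Γ : Submodule (ZMod 2) (G.Chain × H.Chain) :=
    { carrier := {x | (x.1 ∈ E ∧ x.2 ∈ E') ∧ ∀ s t (h : P s t),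
        x.2 t = ExteriorAlgebra.map (transfer s t (Φ s t) (bij s t h).mapsTo) (x.1 s)}
      add_mem' := by
        rintro x y ⟨⟨h1, h2⟩, h3⟩ ⟨⟨h4, h5⟩, h6⟩
        refine ⟨⟨add_mem h1 h4, add_mem h2 h5⟩, fun s t h => ?_⟩
        rw [Prod.fst_add, Prod.snd_add, Pi.add_apply, Pi.add_apply, h3 s t h, h6 s t h, map_add]
      zero_mem' := ⟨⟨zero_mem _, zero_mem _⟩, fun s t h => (map_zero _).symm⟩
      smul_mem' := by
        rintro a x ⟨⟨h1, h2⟩, h3⟩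
        refine ⟨⟨E.smul_mem a h1, E'.smul_mem a h2⟩, fun s t h => ?_⟩
        rw [Prod.smul_fst, Prod.smul_snd, Pi.smul_apply, Pi.smul_apply, h3 s t h, map_smul] }
  refine LinearMap.Homology.nonempty_equiv_of_relation G.differential_comp_differential
    H.differential_comp_differential hE.reduction hE'.reduction Γ (fun x hx => hx.1) ?_ ?_ ?_ ?_ ?_
  · rintro ⟨c, c'⟩ ⟨⟨h1, h2⟩, h3⟩
    exact ⟨⟨hE.reduction.map_mem _ h1, hE'.reduction.map_mem _ h2⟩, hd c h1 c' h2 h3⟩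
  · intro c hc
    have : ∀ t, ∃ z : H.StateAlgebra t, ∀ s (h : P s t),
        z = ExteriorAlgebra.map (transfer s t (Φ s t) (bij s t h).mapsTo) (c s) := by
      intro t
      by_cases ht : ∃ s, P s t
      · obtain ⟨s, hs⟩ := ht
        refine ⟨ExteriorAlgebra.map (transfer s t (Φ s t) (bij s t hs).mapsTo) (c s),
          fun s' h => ?_⟩
        obtain rfl := uniq' _ _ _ hs h
        rfl
      · exact ⟨0, fun s h => (ht ⟨s, h⟩).elim⟩
    choose z hz using this
    obtain ⟨c', hc', h⟩ := hE'.exists_eq z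
    exact ⟨c', ⟨hc, hc'⟩, fun s t hst => (h t (hP s t hst).2).trans (hz t s hst)⟩
  · intro c' hc'
    have : ∀ s, ∃ z : G.StateAlgebra s, ∀ t (h : P s t),
        c' t = ExteriorAlgebra.map (transfer s t (Φ s t) (bij s t h).mapsTo) z := by
      intro s
      by_cases hs : ∃ t, P s t
      · obtain ⟨t, ht⟩ := hs
        obtain ⟨z, hz⟩ := (hθ s t ht).2 (c' t)
        refine ⟨z, fun t' h => ?_⟩
        obtain rfl := uniq _ _ _ ht h
        exact hz.symm
      · exact ⟨0, fun t h => (hs ⟨t, h⟩).elim⟩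
    choose z hz using this
    obtain ⟨c, hc, h⟩ := hE.exists_eq z
    exact ⟨c, ⟨hc, hc'⟩, fun s t hst =>
      (hz s t hst).trans (congr_arg _ (h s (hP s t hst).1).symm)⟩
  · rintro c' ⟨⟨h1, h2⟩, h3⟩
    refine hE'.eq_zero c' h2 fun t ht => ?_
    obtain ⟨s, hs⟩ := ex' t ht
    exact (h3 s t hs).trans (map_zero _)
  · rintro c ⟨⟨h1, h2⟩, h3⟩
    refine hE.eq_zero c h1 fun s hs => ?_
    obtain ⟨t, ht⟩ := ex s hs
    exact (hθ s t ht).1 ((h3 s t ht).symm.trans (map_zero _).symm)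

end Core

/-! ### Isomorphic complexes from an exchange of coordinates. -/

section CubeEquiv

variable {V : Type u} [Fintype V] [DecidableEq V] {G : LabeledGraph V}
variable {W : Type v} [Fintype W] [DecidableEq W] {H : LabeledGraph W}

/-- Identifications of the functionals of all states, up to exchanging `0` and `1` at the vertices
in `T`, give isomorphic homology. -/
theorem nonempty_Kh_equiv_of_pivot (e : V ≃ W) (T : Finset V)
    (Φ : (W → ZMod 2) →ₗ[ZMod 2] (V → ZMod 2)) (hΦ : Function.Surjective Φ)
    (h₁ : ∀ p, ∀ k ∉ T, Φ p k = p (e k) ∧ G.adjMatrix.mulVec (Φ p) k = H.adjMatrix.mulVec p (e k))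
    (h₂ : ∀ p, ∀ k ∈ T, Φ p k = H.adjMatrix.mulVec p (e k) ∧ G.adjMatrix.mulVec (Φ p) k = p (e k))
    (sign₁ : ∀ k ∉ T, H.sign (e k) = G.sign k) (sign₂ : ∀ k ∈ T, H.sign (e k) = -G.sign k) :
    Nonempty (G.Kh ≃ₗ[ZMod 2] H.Kh) := by
  -- Exchanging `p k` with `(A p) k` exchanges the vanishing conditions for `k ∈ s` and `k ∉ s`, so
  -- states are complemented on `T`.
  let m : Finset V → Finset W := fun s => (symmDiff s T).map e.toEmbedding
  have mem_m : ∀ s k, e k ∈ m s ↔ ((k ∈ s ∧ k ∉ T) ∨ (k ∈ T ∧ k ∉ s)) := fun s k => by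
    simp [m, Finset.mem_symmDiff]
  have m_inj : Function.Injective m := fun s s' h => by
    have := Finset.map_injective _ h
    exact symmDiff_left_injective T this
  have m_surj : Function.Surjective m := fun t => by
    refine ⟨symmDiff (t.map e.symm.toEmbedding) T, ?_⟩
    ext w
    obtain ⟨k, rfl⟩ := e.surjective w
    rw [mem_m, Finset.mem_symmDiff, Finset.mem_map_equiv, Equiv.symm_symm]
    tauto
  have m_flip : ∀ s k, flip (m s) (e k) = m (flip s k) := fun s k => by
    ext w
    obtain ⟨i, rfl⟩ := e.surjective w
    rw [mem_flip, mem_m, mem_m, mem_flip]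
    simp only [ne_eq, e.injective.eq_iff]
    tauto
  -- The value at `x_k` is the sum of the two coordinates and does not notice the exchange.
  have hval : ∀ p k, G.val k (Φ p) = H.val (e k) p := fun p k => by
    rw [val_apply, val_apply]
    by_cases hk : k ∈ T
    · rw [(h₂ p k hk).1, (h₂ p k hk).2, add_comm]
    · rw [(h₁ p k hk).1, (h₁ p k hk).2]
  have hmem : ∀ s p, p ∈ H.dualCoords (m s) ↔ Φ p ∈ G.dualCoords s := by
    intro s p
    have h : ∀ k, ((e k ∉ m s → p (e k) = 0) ∧ (e k ∈ m s → H.adjMatrix.mulVec p (e k) = 0)) ↔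
        ((k ∉ s → Φ p k = 0) ∧ (k ∈ s → G.adjMatrix.mulVec (Φ p) k = 0)) := by
      intro k
      by_cases hk : k ∈ T
      · rw [(h₂ p k hk).1, (h₂ p k hk).2, mem_m]
        tauto
      · rw [(h₁ p k hk).1, (h₁ p k hk).2, mem_m]
        tauto
    constructor
    · intro hp
      exact ⟨fun k => ((h k).1 ⟨hp.1 _, hp.2 _⟩).1, fun k => ((h k).1 ⟨hp.1 _, hp.2 _⟩).2⟩
    · intro hp
      refine ⟨fun w => ?_, fun w => ?_⟩ <;> obtain ⟨k, rfl⟩ := e.surjective w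
      · exact ((h k).2 ⟨hp.1 _, hp.2 _⟩).1
      · exact ((h k).2 ⟨hp.1 _, hp.2 _⟩).2
  have bij : ∀ s t, m s = t → Set.BijOn Φ (H.dualCoords t) (G.dualCoords s) := by
    rintro s _ rfl
    refine ⟨fun p hp => (hmem s p).1 hp, fun p hp p' hp' h => ?_, fun q hq => ?_⟩
    · rw [← sub_eq_zero] at h ⊢
      rw [← map_sub] at h
      refine H.eq_zero_of_val_eq_zero (sub_mem hp hp') fun w => ?_
      obtain ⟨k, rfl⟩ := e.surjective w
      rw [← hval, h, map_zero]
    · obtain ⟨p, rfl⟩ := hΦ q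
      exact ⟨p, (hmem s p).2 hq, rfl⟩
  -- On `T` both the sign and the membership change, so arrows keep their direction.
  have hout : ∀ s k, H.IsOutgoing (m s) (e k) ↔ G.IsOutgoing s k := by
    intro s k
    unfold IsOutgoing
    rw [mem_m]
    by_cases hk : k ∈ T
    · rw [sign₂ k hk, neg_inj, neg_eq_iff_eq_neg]
      tauto
    · rw [sign₁ k hk]
      tauto
  refine nonempty_Kh_equiv_of_isCore G.isCore_top H.isCore_top (fun s t => m s = t)
    (fun _ _ => Φ) (fun _ _ _ => ⟨trivial, trivial⟩) (fun s _ => ⟨_, rfl⟩)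
    (fun t _ => m_surj t) (fun s t t' h h' => h.symm.trans h')
    (fun s s' t h h' => m_inj (h.trans h'.symm)) bij ?_
  rintro c - c' - h s _ rfl
  rw [differential_apply, differential_apply, map_sum]
  symm
  refine Finset.sum_bij (fun k _ => e k) (fun k hk => ?_) (fun k _ k' _ h => e.injective h)
    (fun w hw => ?_) (fun k _ => ?_)
  · simpa [hout] using hk
  · obtain ⟨k, rfl⟩ := e.surjective w
    exact ⟨k, by simpa [hout] using hw, rfl⟩
  · rw [h (flip s k) (flip (m s) (e k)) (m_flip s k).symm,
      map_transfer_edge Φ (flip_flip s k) (flip_flip (m s) (e k))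
        (bij _ _ (m_flip s k).symm).mapsTo (bij s _ rfl).mapsTo
        (bij _ _ (m_flip s k).symm).surjOn (fun p _ => hval p k) (fun p _ => hval p k)]

end CubeEquiv

/-! ### Adjacency matrices and invariance under isomorphism. -/

section Matrix

variable {V : Type u} [Fintype V] [DecidableEq V] (G : LabeledGraph V)

lemma adjMatrix_self (i : V) : G.adjMatrix i i = G.framing i := if_pos rfl

open Classical in
lemma adjMatrix_of_ne {i j : V} (h : i ≠ j) :
    G.adjMatrix i j = if G.graph.Adj i j then 1 else 0 := if_neg h

lemma mulVec_eq_sum (p : V → ZMod 2) (k : V) :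
    G.adjMatrix.mulVec p k = ∑ j, G.adjMatrix k j * p j := rfl

end Matrix

section Isomorphism

variable {V : Type u} [Fintype V] [DecidableEq V] {G : LabeledGraph V}
variable {W : Type v} [Fintype W] [DecidableEq W] {H : LabeledGraph W}

theorem IsIsomorphic.nonempty_Kh_equiv (h : G.IsIsomorphic H) :
    Nonempty (G.Kh ≃ₗ[ZMod 2] H.Kh) := by
  obtain ⟨e, hf, hs⟩ := h
  have hA : ∀ i j, H.adjMatrix (e i) (e j) = G.adjMatrix i j := by
    intro i j
    by_cases hij : i = j
    · subst hij
      rw [adjMatrix_self, adjMatrix_self, hf]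
    · rw [adjMatrix_of_ne _ hij, adjMatrix_of_ne _ (e.injective.ne hij)]
      classical exact if_congr e.map_adj_iff rfl rfl
  have hmul : ∀ p k, G.adjMatrix.mulVec (LinearMap.funLeft (ZMod 2) (ZMod 2) e p) k =
      H.adjMatrix.mulVec p (e k) := by
    intro p k
    rw [mulVec_eq_sum, mulVec_eq_sum, ← e.toEquiv.sum_comp]
    exact Finset.sum_congr rfl fun j _ => by
      rw [LinearMap.funLeft_apply, ← hA]; rfl
  exact nonempty_Kh_equiv_of_pivot e.toEquiv ∅ (LinearMap.funLeft (ZMod 2) (ZMod 2) e)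
    (LinearMap.funLeft_surjective_of_injective _ _ _ e.injective)
    (fun p k _ => ⟨rfl, hmul p k⟩) (fun p k hk => absurd hk (Finset.notMem_empty k))
    (fun k _ => hs k) (fun k hk => absurd hk (Finset.notMem_empty k))

end Isomorphism
end LabeledGraph

namespace LabeledGraph

/-! ### The moves `Ω₄'` and `Ω₄` as principal pivots. -/

section Pivot

variable {V : Type u} [Fintype V] [DecidableEq V] {G H : LabeledGraph V}

lemma mulVec_X (G : LabeledGraph V) (j k : V) : G.adjMatrix.mulVec (X j) k = G.adjMatrix k j := by
  simp [mulVec_eq_sum, X, Pi.single_apply]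

lemma X_apply (j k : V) : (X j : V → ZMod 2) k = if k = j then 1 else 0 := by
  rw [X, Pi.single_apply]

lemma add_add_cancel_zmod_two (a b : ZMod 2) : a + b + b = a := by
  rw [add_assoc, CharTwo.add_self_eq_zero, add_zero]

lemma adjMatrix_congr {K : LabeledGraph V} {i j i' j' : V} (h : i ≠ j) (h' : i' ≠ j')
    (hadj : G.graph.Adj i j ↔ K.graph.Adj i' j') : G.adjMatrix i j = K.adjMatrix i' j' := by
  rw [adjMatrix_of_ne _ h, adjMatrix_of_ne _ h']
  classical exact if_congr hadj rfl rfl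

/-- The move is the principal pivot at the diagonal entry `a_vv = 1`. Adding `p_v + (A p)_v` to the
coordinate at `v` exchanges the two members of the pair at `v`, and the change of the matrix leaves
all other pairs fixed. -/
theorem Omega4'.nonempty_Kh_equiv (h : G.Omega4' H) : Nonempty (G.Kh ≃ₗ[ZMod 2] H.Kh) := by
  obtain ⟨v, hv, hadj, hf₁, hf₂, hsv, hs⟩ := h
  have hrow : ∀ j, H.adjMatrix v j = G.adjMatrix v j := by
    intro j
    by_cases hj : v = j
    · subst hj
      rw [adjMatrix_self, adjMatrix_self, hf₂ v (G.graph.loopless.irrefl v)]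
    · refine adjMatrix_congr hj hj ?_
      rw [hadj v j hj]
      simp [Xor]
  -- A rank-one update. Since `a_vv = 1`, the summand `X v j` cancels it in column `v`, which the
  -- move does not touch.
  have hA : ∀ k, k ≠ v → ∀ j, H.adjMatrix k j =
      G.adjMatrix k j + G.adjMatrix k v * (G.adjMatrix v j + X v j) := by
    intro k hk j
    by_cases hj : j = v
    · subst hj
      rw [H.adjMatrix_symm k j, hrow, adjMatrix_self, hv, X_apply, if_pos rfl,
        CharTwo.add_self_eq_zero, mul_zero, add_zero, G.adjMatrix_symm]
    · rw [X_apply, if_neg hj, add_zero, G.adjMatrix_symm k v]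
      by_cases hkj : k = j
      · subst hkj
        rw [adjMatrix_self, adjMatrix_self, adjMatrix_of_ne _ hk.symm]
        split_ifs with h
        · rw [hf₁ k h, one_mul]
        · rw [hf₂ k h, zero_mul, add_zero]
      · rw [adjMatrix_of_ne _ hkj, adjMatrix_of_ne _ hkj, adjMatrix_of_ne _ hk.symm,
          adjMatrix_of_ne _ (Ne.symm hj)]
        have := hadj k j hkj
        by_cases h1 : G.graph.Adj k j <;> by_cases h2 : G.graph.Adj v k <;>
          by_cases h3 : G.graph.Adj v j <;> simp [this, h1, h2, h3, Xor] <;> rfl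
  have hmulv : ∀ p, H.adjMatrix.mulVec p v = G.adjMatrix.mulVec p v := fun p => by
    simp only [mulVec_eq_sum, hrow]
  have hmul : ∀ p k, k ≠ v → H.adjMatrix.mulVec p k =
      G.adjMatrix.mulVec p k + H.val v p * G.adjMatrix k v := by
    intro p k hk
    rw [val_apply, hmulv]
    simp only [mulVec_eq_sum, hA k hk, add_mul, mul_add, Finset.sum_add_distrib, X_apply,
      mul_ite, mul_one, mul_zero, ite_mul, zero_mul, Finset.sum_ite_eq', Finset.mem_univ, if_true,
      Finset.sum_mul]
    have : ∀ j, G.adjMatrix k v * G.adjMatrix v j * p j = G.adjMatrix v j * p j * G.adjMatrix k v :=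
      fun j => by ring
    simp only [this]
    ring
  let Φ : (V → ZMod 2) →ₗ[ZMod 2] (V → ZMod 2) := LinearMap.id + (H.val v).smulRight (X v)
  have hΦ : ∀ p k, Φ p k = p k + H.val v p * X v k := fun p k => rfl
  have hAΦ : ∀ p k, G.adjMatrix.mulVec (Φ p) k =
      G.adjMatrix.mulVec p k + H.val v p * G.adjMatrix k v := fun p k => by
    change G.adjMatrix.mulVec (p + H.val v p • X v) k = _
    rw [Matrix.mulVec_add, Matrix.mulVec_smul, Pi.add_apply, Pi.smul_apply, mulVec_X, smul_eq_mul]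
  refine nonempty_Kh_equiv_of_pivot (Equiv.refl V) {v} Φ (fun p => ⟨Φ p, ?_⟩) ?_ ?_ ?_ ?_
  -- `Φ` is an involution, because the functional `H.val v` vanishes on the added vector `X v`.
  · have hX : H.val v (X v) = 0 := by
      rw [val_apply, mulVec_X, hrow, adjMatrix_self, hv, X_apply, if_pos rfl]; rfl
    have : H.val v (Φ p) = H.val v p := by
      change H.val v (p + H.val v p • X v) = _
      rw [map_add, map_smul, hX, smul_zero, add_zero]
    funext k
    rw [hΦ, this, hΦ, add_add_cancel_zmod_two]
  · intro p k hk
    rw [Finset.mem_singleton] at hk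
    rw [hAΦ, hΦ, X_apply, if_neg hk, mul_zero, add_zero]
    exact ⟨rfl, (hmul p k hk).symm⟩
  · intro p k hk
    obtain rfl := Finset.mem_singleton.1 hk
    rw [hAΦ, hΦ, X_apply, if_pos rfl, adjMatrix_self, hv, val_apply, hmulv]
    simp only [mul_one, Equiv.refl_apply, hmulv]
    constructor
    · rw [← add_assoc, CharTwo.add_self_eq_zero, zero_add]
    · rw [add_comm (p k), ← add_assoc, CharTwo.add_self_eq_zero, zero_add]
  · intro k hk
    exact hs k fun h => hk (Finset.mem_singleton.2 h)
  · intro k hk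
    obtain rfl := Finset.mem_singleton.1 hk
    exact hsv

/-- The move is the pivot on the block of `u` and `v`. As both framings are `0` and the vertices are
adjacent, this block is antidiagonal and interchanges the two indices; hence `Equiv.swap u v` below,
and the crossed signs in the move. -/
theorem Omega4.nonempty_Kh_equiv (h : G.Omega4 H) : Nonempty (G.Kh ≃ₗ[ZMod 2] H.Kh) := by
  obtain ⟨u, v, huv, hu, hv, hadj, hadj', hf, hsu, hsv, hs⟩ := h
  have hne : u ≠ v := huv.ne
  have hrow : ∀ x, x = u ∨ x = v → ∀ j, H.adjMatrix x j = G.adjMatrix x j := by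
    intro x hx j
    by_cases hj : x = j
    · subst hj
      rw [adjMatrix_self, adjMatrix_self, hf]
    · refine adjMatrix_congr hj hj ?_
      rcases hx with rfl | rfl
      · exact (hadj' j).1
      · exact (hadj' j).2
  have huu : G.adjMatrix u u = 0 := by rw [adjMatrix_self, hu]
  have hvv : G.adjMatrix v v = 0 := by rw [adjMatrix_self, hv]
  have huv1 : G.adjMatrix u v = 1 := by rw [adjMatrix_of_ne _ hne, if_pos huv]
  have hvu1 : G.adjMatrix v u = 1 := by rw [adjMatrix_symm, huv1]
  -- Off the diagonal `a_ku a_vj + a_kv a_uj` is `1` exactly when `(k, j)` or `(j, k)` is a pivot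
  -- pair. On the diagonal the two products coincide and cancel, so the framings stay.
  have hA : ∀ k, k ≠ u → k ≠ v → ∀ j, H.adjMatrix k j = G.adjMatrix k j +
      (G.adjMatrix k u * (G.adjMatrix v j + X u j) +
        G.adjMatrix k v * (G.adjMatrix u j + X v j)) := by
    intro k hku hkv j
    by_cases hju : j = u
    · subst hju
      rw [H.adjMatrix_symm k j, hrow j (Or.inl rfl), hvu1, huu, X_apply, X_apply, if_pos rfl,
        if_neg hne, G.adjMatrix_symm]
      simp only [CharTwo.add_self_eq_zero, mul_zero, add_zero]
    by_cases hjv : j = v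
    · subst hjv
      rw [H.adjMatrix_symm k j, hrow j (Or.inr rfl), huv1, hvv, X_apply, X_apply, if_pos rfl,
        if_neg hne.symm, G.adjMatrix_symm]
      simp only [CharTwo.add_self_eq_zero, mul_zero, add_zero]
    rw [X_apply, if_neg hju, X_apply, if_neg hjv, add_zero, add_zero, G.adjMatrix_symm k u,
      G.adjMatrix_symm k v]
    by_cases hkj : k = j
    · subst hkj
      rw [adjMatrix_self, adjMatrix_self, hf, mul_comm, CharTwo.add_self_eq_zero, add_zero]
    · rw [adjMatrix_of_ne _ hkj, adjMatrix_of_ne _ hkj, adjMatrix_of_ne _ (Ne.symm hku),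
        adjMatrix_of_ne _ (Ne.symm hkv), adjMatrix_of_ne _ (Ne.symm hju),
        adjMatrix_of_ne _ (Ne.symm hjv)]
      have := hadj k j hku hkv hju hjv
      unfold PivotPair at this
      by_cases h1 : G.graph.Adj k j <;> by_cases h2 : G.graph.Adj u k <;>
        by_cases h3 : G.graph.Adj u j <;> by_cases h4 : G.graph.Adj v k <;>
        by_cases h5 : G.graph.Adj v j <;> simp [this, h1, h2, h3, h4, h5, Xor] <;> rfl
  have hmulr : ∀ x, x = u ∨ x = v → ∀ p, H.adjMatrix.mulVec p x = G.adjMatrix.mulVec p x :=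
    fun x hx p => by simp only [mulVec_eq_sum, hrow x hx]
  -- `a p` and `b p` are the amounts that turn `p u` into `(A p) v` and `p v` into `(A p) u`.
  let a : (V → ZMod 2) →ₗ[ZMod 2] ZMod 2 := LinearMap.proj u + LinearMap.proj v ∘ₗ
    G.adjMatrix.mulVecLin
  let b : (V → ZMod 2) →ₗ[ZMod 2] ZMod 2 := LinearMap.proj v + LinearMap.proj u ∘ₗ
    G.adjMatrix.mulVecLin
  have ha : ∀ p, a p = p u + G.adjMatrix.mulVec p v := fun p => rfl
  have hb : ∀ p, b p = p v + G.adjMatrix.mulVec p u := fun p => rfl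
  have hmul : ∀ p k, k ≠ u → k ≠ v → H.adjMatrix.mulVec p k =
      G.adjMatrix.mulVec p k + a p * G.adjMatrix k u + b p * G.adjMatrix k v := by
    intro p k hku hkv
    rw [ha, hb]
    simp only [mulVec_eq_sum, hA k hku hkv, add_mul, mul_add, Finset.sum_add_distrib, X_apply,
      mul_ite, mul_one, mul_zero, ite_mul, zero_mul, Finset.sum_ite_eq', Finset.mem_univ, if_true,
      Finset.sum_mul]
    have : ∀ x y j, G.adjMatrix k x * G.adjMatrix y j * p j =
        G.adjMatrix y j * p j * G.adjMatrix k x := fun x y j => by ring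
    simp only [this]
    ring
  let Φ : (V → ZMod 2) →ₗ[ZMod 2] (V → ZMod 2) :=
    LinearMap.id + a.smulRight (X u) + b.smulRight (X v)
  have hΦ : ∀ p k, Φ p k = p k + a p * X u k + b p * X v k := fun p k => rfl
  have hAΦ : ∀ p k, G.adjMatrix.mulVec (Φ p) k =
      G.adjMatrix.mulVec p k + a p * G.adjMatrix k u + b p * G.adjMatrix k v := fun p k => by
    change G.adjMatrix.mulVec (p + a p • X u + b p • X v) k = _
    rw [Matrix.mulVec_add, Matrix.mulVec_add, Matrix.mulVec_smul, Matrix.mulVec_smul, Pi.add_apply,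
      Pi.add_apply, Pi.smul_apply, Pi.smul_apply, mulVec_X, mulVec_X, smul_eq_mul, smul_eq_mul]
  have hmem : ∀ k, k ∈ ({u, v} : Finset V) ↔ k = u ∨ k = v := fun k => by simp
  refine nonempty_Kh_equiv_of_pivot (Equiv.swap u v) {u, v} Φ (fun p => ⟨Φ p, ?_⟩) ?_ ?_ ?_ ?_
  · have h1 : a (X u) = 0 := by
      rw [ha, mulVec_X, hvu1, X_apply, if_pos rfl]; rfl
    have h2 : a (X v) = 0 := by
      rw [ha, mulVec_X, hvv, X_apply, if_neg hne]; rfl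
    have h3 : b (X u) = 0 := by
      rw [hb, mulVec_X, huu, X_apply, if_neg hne.symm]; rfl
    have h4 : b (X v) = 0 := by
      rw [hb, mulVec_X, huv1, X_apply, if_pos rfl]; rfl
    have h5 : a (Φ p) = a p := by
      change a (p + a p • X u + b p • X v) = _
      rw [map_add, map_add, map_smul, map_smul, h1, h2, smul_zero, smul_zero, add_zero, add_zero]
    have h6 : b (Φ p) = b p := by
      change b (p + a p • X u + b p • X v) = _
      rw [map_add, map_add, map_smul, map_smul, h3, h4, smul_zero, smul_zero, add_zero, add_zero]
    funext k
    rw [hΦ, h5, h6, hΦ, add_right_comm _ (b p * X v k), add_add_cancel_zmod_two,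
      add_add_cancel_zmod_two]
  · intro p k hk
    rw [hmem, not_or] at hk
    rw [hAΦ, hΦ, X_apply, X_apply, if_neg hk.1, if_neg hk.2, mul_zero, mul_zero, add_zero,
      add_zero, Equiv.swap_apply_of_ne_of_ne hk.1 hk.2]
    exact ⟨rfl, (hmul p k hk.1 hk.2).symm⟩
  · intro p k hk
    have cancel : ∀ x y : ZMod 2, x + (x + y) = y := by decide
    have cancel' : ∀ x y : ZMod 2, y + (x + y) = x := by decide
    rcases (hmem k).1 hk with rfl | rfl
    · rw [hAΦ, hΦ, X_apply, X_apply, if_pos rfl, if_neg hne, huu, huv1, Equiv.swap_apply_left,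
        hmulr v (Or.inr rfl), mul_one, mul_zero, mul_one, mul_zero, add_zero, add_zero, ha, hb]
      exact ⟨cancel _ _, cancel' _ _⟩
    · rw [hAΦ, hΦ, X_apply, X_apply, if_pos rfl, if_neg hne.symm, hvv, hvu1,
        Equiv.swap_apply_right, hmulr u (Or.inl rfl), mul_one, mul_zero, mul_one, mul_zero,
        add_zero, add_zero, ha, hb]
      exact ⟨cancel _ _, cancel' _ _⟩
  · intro k hk
    rw [hmem, not_or] at hk
    rw [Equiv.swap_apply_of_ne_of_ne hk.1 hk.2]
    exact hs k hk.1 hk.2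
  · intro k hk
    rcases (hmem k).1 hk with rfl | rfl
    · rw [Equiv.swap_apply_left]
      exact hsv
    · rw [Equiv.swap_apply_right]
      exact hsu

end Pivot
end LabeledGraph

namespace LabeledGraph

/-! ### Cancellation along two consecutive edges. -/

section Cancellation

variable {V : Type u} [Fintype V] [DecidableEq V] {G : LabeledGraph V}

open ExteriorAlgebra (contract)

lemma gen_ne_zero_of_val {s : Finset V} {p : V → ZMod 2} (hp : p ∈ G.dualCoords s) {i : V}
    (hi : G.val i p = 1) : G.gen s i ≠ 0 := fun h =>
  one_ne_zero (hi.symm.trans ((G.gen_eq_zero_iff s i).1 h p hp))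

/-- Adding the right multiple of `p` makes the value at `x_y` vanish, which projects the functionals
on `V(t)` into those on `V(t ⊕ y)`. -/
lemma mem_dualCoords_flip_add {t : Finset V} {p : V → ZMod 2} (hp : p ∈ G.dualCoords t) {y : V}
    (hy : G.val y p = 1) : ∀ q ∈ G.dualCoords t,
      (LinearMap.id + (G.val y).smulRight p : (V → ZMod 2) →ₗ[ZMod 2] (V → ZMod 2)) q ∈
        G.dualCoords (flip t y) := by
  intro q hq
  refine G.mem_dualCoords_flip (add_mem hq (Submodule.smul_mem _ _ hp)) ?_
  rw [LinearMap.add_apply, map_add, LinearMap.id_apply, LinearMap.smulRight_apply, map_smul, hy, smul_eq_mul, mul_one,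
    CharTwo.add_self_eq_zero]

/-- An element killed by the contraction dual to `x_y` is recovered from its image under the
edge map `x_y = 0`. -/
lemma eq_map_transfer_edge {t : Finset V} {p : V → ZMod 2} (hp : p ∈ G.dualCoords t) {y : V}
    (hy : G.val y p = 1) {z : G.StateAlgebra t} (hz : contract (G.functional t p) z = 0) :
    z = ExteriorAlgebra.map (transfer (flip t y) t _ (mem_dualCoords_flip_add hp hy))
      (G.edge t (flip t y) y z) := by
  have hle := G.dualCoords_flip_le_of_gen_ne_zero (gen_ne_zero_of_val hp hy)
  -- The composite `V(t) → V(t ⊕ y) → V(t)` is `m ↦ m - p(m) x_y`, and this projection fixes every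
  -- element killed by the contraction.
  have h1 := ExteriorAlgebra.map_id_sub_smulRight (G.functional t p) (G.gen t y) z
  rw [hz, mul_zero, sub_zero] at h1
  rw [edge_of_gen_ne_zero rfl (gen_ne_zero_of_val hp hy) hle, ExteriorAlgebra.map_map_apply]
  conv_lhs => rw [← h1]
  congr 2
  refine linearMap_ext_functional fun q hq => LinearMap.ext fun m => ?_
  have hq' := mem_dualCoords_flip_add hp hy q hq
  have h2 := LinearMap.congr_fun (functional_comp_quot hle hq') m
  rw [LinearMap.comp_apply] at h2
  rw [LinearMap.comp_apply, LinearMap.comp_apply, LinearMap.comp_apply, functional_transfer hq,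
    h2, LinearMap.sub_apply,
    map_sub, LinearMap.id_apply, LinearMap.smulRight_apply, map_smul, functional_gen hq,
    LinearMap.add_apply, LinearMap.id_apply, LinearMap.smulRight_apply,
    functional_add hq (Submodule.smul_mem _ _ hp), functional_smul hp, smul_eq_mul,
    CharTwo.sub_eq_add, mul_comm]

lemma eq_zero_of_edge_eq_zero {t : Finset V} {p : V → ZMod 2} (hp : p ∈ G.dualCoords t) {y : V}
    (hy : G.val y p = 1) {z : G.StateAlgebra t} (hz : contract (G.functional t p) z = 0)
    (h : G.edge t (flip t y) y z = 0) : z = 0 := by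
  rw [eq_map_transfer_edge hp hy hz, h, map_zero]

lemma exists_edge_eq {t : Finset V} {p : V → ZMod 2} (hp : p ∈ G.dualCoords t) {y : V}
    (hy : G.val y p = 1) (w : G.StateAlgebra (flip t y)) :
    ∃ z, contract (G.functional t p) z = 0 ∧ G.edge t (flip t y) y z = w := by
  have hg := gen_ne_zero_of_val hp hy
  have hle := G.dualCoords_flip_le_of_gen_ne_zero hg
  obtain ⟨z, rfl⟩ := ExteriorAlgebra.map_surjective_iff.2 (quot_surjective hle) w
  -- The correction is a multiple of `x_y`: it vanishes at `t ⊕ y` and is chosen to make the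
  -- contraction zero.
  refine ⟨z - ExteriorAlgebra.ι (ZMod 2) (G.gen t y) * contract (G.functional t p) z, ?_, ?_⟩
  · rw [map_sub, ExteriorAlgebra.contract_ι_mul, ExteriorAlgebra.contract_contract, mul_zero,
      sub_zero, functional_gen hp, hy, one_smul, sub_self]
  · rw [edge_of_gen_ne_zero rfl hg hle, map_sub, map_mul, ExteriorAlgebra.map_apply_ι, quot_gen,
      G.gen_flip_eq_zero hg, map_zero, zero_mul, sub_zero]

/-- The functional `p` shows that `x_x` is nonzero at the target, so it vanishes at the source. The
map `f` is the quotient `Λ V(t) → Λ V(s)`, against the direction of the edge. -/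
lemma edge_eq_mul {s t : Finset V} {p : V → ZMod 2} (hp : p ∈ G.dualCoords t) {x : V}
    (hst : flip s x = t) (hx : G.val x p = 1) :
    ∃ f : G.StateAlgebra t →ₐ[ZMod 2] G.StateAlgebra s,
      Function.Surjective f ∧ f (ExteriorAlgebra.ι (ZMod 2) (G.gen t x)) = 0 ∧
      ∀ z, G.edge s t x (f z) = ExteriorAlgebra.ι (ZMod 2) (G.gen t x) * z := by
  obtain rfl : flip t x = s := by rw [← hst, flip_flip]
  have hg := gen_ne_zero_of_val hp hx
  have hle := G.dualCoords_flip_le_of_gen_ne_zero hg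
  refine ⟨ExteriorAlgebra.map (G.quot hle),
    ExteriorAlgebra.map_surjective_iff.2 (quot_surjective hle), ?_, fun z => ?_⟩
  · rw [ExteriorAlgebra.map_apply_ι, quot_gen, G.gen_flip_eq_zero hg, map_zero]
  · exact edge_of_gen_eq_zero hst (G.gen_flip_eq_zero hg) _ z

/-- The contraction of `x_x ∧ z` is `z - x_x ∧ (p ⌟ z)`. If it vanishes, `z` is a multiple of `x_x`
and hence zero at `s`. So the edge map is injective and its image meets the kernel of the
contraction trivially. -/
lemma eq_zero_of_contract_edge_eq_zero {s t : Finset V} {p : V → ZMod 2}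
    (hp : p ∈ G.dualCoords t) {x : V} (hst : flip s x = t) (hx : G.val x p = 1)
    {z : G.StateAlgebra s} (h : contract (G.functional t p) (G.edge s t x z) = 0) : z = 0 := by
  obtain ⟨f, hf, hf0, hfe⟩ := edge_eq_mul hp hst hx
  obtain ⟨z, rfl⟩ := hf z
  rw [hfe, ExteriorAlgebra.contract_ι_mul, functional_gen hp, hx, one_smul, sub_eq_zero] at h
  rw [h, map_mul, hf0, zero_mul]

/-- The complement to `eq_zero_of_contract_edge_eq_zero`: the image of the edge and the kernel of
the contraction together span `Λ V(t)`. The component in the image is `x_x ∧ (p ⌟ z)`. -/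
lemma exists_contract_sub_edge_eq_zero {s t : Finset V} {p : V → ZMod 2}
    (hp : p ∈ G.dualCoords t) {x : V} (hst : flip s x = t) (hx : G.val x p = 1)
    (z : G.StateAlgebra t) :
    ∃ b, contract (G.functional t p) (z - G.edge s t x b) = 0 := by
  obtain ⟨f, -, -, hfe⟩ := edge_eq_mul hp hst hx
  refine ⟨f (contract (G.functional t p) z), ?_⟩
  rw [hfe, map_sub, ExteriorAlgebra.contract_ι_mul, ExteriorAlgebra.contract_contract, mul_zero,
      sub_zero, functional_gen hp, hx, one_smul, sub_self]

/-- The states `s` and `a` contain the same elements of `T`. -/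
def AgreeOn (T s a : Finset V) : Prop := ∀ i ∈ T, (i ∈ s ↔ i ∈ a)

lemma AgreeOn.flip {T s a : Finset V} (h : AgreeOn T s a) (i : V) :
    AgreeOn T (flip s i) (LabeledGraph.flip a i) := fun k hk => by
  rw [mem_flip, mem_flip, h k hk]

lemma agreeOn_flip_iff {T s a : Finset V} {i : V} (hi : i ∉ T) :
    AgreeOn T (flip s i) a ↔ AgreeOn T s a := by
  refine forall₂_congr fun k hk => ?_
  have : k ≠ i := fun h => hi (h ▸ hk)
  rw [mem_flip]
  tauto

lemma AgreeOn.flip_left {T s a : Finset V} {i : V} (h : AgreeOn T s (LabeledGraph.flip a i)) :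
    AgreeOn T (LabeledGraph.flip s i) a := by
  have := h.flip i
  rwa [flip_flip] at this

lemma AgreeOn.isOutgoing_iff {T s a : Finset V} (h : AgreeOn T s a) {i : V} (hi : i ∈ T) :
    G.IsOutgoing s i ↔ G.IsOutgoing a i := by
  unfold IsOutgoing
  rw [h i hi]

lemma isOutgoing_flip_of_ne {s : Finset V} {i j : V} (h : i ≠ j) :
    G.IsOutgoing (flip s j) i ↔ G.IsOutgoing s i := by
  unfold IsOutgoing
  rw [mem_flip]
  tauto

variable (G) in
/-- In the cube of the vertices in `T`, the states at the source `s₀`, at `s₀ ⊕ x` and at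
`s₀ ⊕ x ⊕ y` can be cancelled, by means of a functional with coordinates `p` which is common to
all states at `s₀ ⊕ x`. -/
structure Cancellation (T s₀ : Finset V) (x y : V) (p : V → ZMod 2) : Prop where
  x_mem : x ∈ T
  y_mem : y ∈ T
  ne : x ≠ y
  outgoing : ∀ i ∈ T, G.IsOutgoing s₀ i
  mem_dualCoords : ∀ s, AgreeOn T s (flip s₀ x) → p ∈ G.dualCoords s
  val_x : G.val x p = 1
  val_y : G.val y p = 1
  val_eq_zero : ∀ i ∉ T, G.val i p = 0

variable (G) in
/-- The subcomplex left by a cancellation. -/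
noncomputable def cancelCore (T s₀ : Finset V) (x y : V) (p : V → ZMod 2) :
    Submodule (ZMod 2) G.Chain where
  -- The vanishing of the differential at the sink makes this a subcomplex and ties the middle
  -- components to those at `s₀ ⊕ y`, see `edge_middle`.
  carrier := {c | (∀ s, AgreeOn T s s₀ → c s = 0) ∧
    (∀ s, AgreeOn T s (flip s₀ x) → contract (G.functional s p) (c s) = 0) ∧
    ∀ s, AgreeOn T s (flip (flip s₀ x) y) → c s = 0 ∧ G.differential c s = 0}
  add_mem' := by
    rintro c c' ⟨h1, h2, h3⟩ ⟨h4, h5, h6⟩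
    refine ⟨fun s hs => ?_, fun s hs => ?_, fun s hs => ⟨?_, ?_⟩⟩
    · rw [Pi.add_apply, h1 s hs, h4 s hs, add_zero]
    · rw [Pi.add_apply, map_add, h2 s hs, h5 s hs, add_zero]
    · rw [Pi.add_apply, (h3 s hs).1, (h6 s hs).1, add_zero]
    · rw [map_add, Pi.add_apply, (h3 s hs).2, (h6 s hs).2, add_zero]
  zero_mem' := by
    refine ⟨fun s hs => rfl, fun s hs => map_zero _, fun s hs => ⟨rfl, ?_⟩⟩
    rw [map_zero]
    rfl
  smul_mem' := by
    rintro a c ⟨h1, h2, h3⟩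
    refine ⟨fun s hs => ?_, fun s hs => ?_, fun s hs => ⟨?_, ?_⟩⟩
    · rw [Pi.smul_apply, h1 s hs, smul_zero]
    · rw [Pi.smul_apply, map_smul, h2 s hs, smul_zero]
    · rw [Pi.smul_apply, (h3 s hs).1, smul_zero]
    · rw [map_smul, Pi.smul_apply, (h3 s hs).2, smul_zero]

namespace Cancellation

variable {T s₀ : Finset V} {x y : V} {p : V → ZMod 2} (C : G.Cancellation T s₀ x y p)

include C

lemma notMem_of_source {t : Finset V} (ht : AgreeOn T t s₀) {i : V} (hi : ¬ G.IsOutgoing t i) :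
    i ∉ T := fun h => hi ((ht.isOutgoing_iff h).2 (C.outgoing i h))

lemma eq_or_notMem_of_middle {t : Finset V} (ht : AgreeOn T t (flip s₀ x)) {i : V}
    (hi : ¬ G.IsOutgoing t i) : i = x ∨ i ∉ T := by
  by_contra! h
  refine hi ((ht.isOutgoing_iff h.2).2 ?_)
  rw [isOutgoing_flip_of_ne h.1]
  exact C.outgoing i h.2

lemma eq_or_notMem_of_sink {t : Finset V} (ht : AgreeOn T t (flip (flip s₀ x) y)) {i : V}
    (hi : ¬ G.IsOutgoing t i) : i = x ∨ i = y ∨ i ∉ T := by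
  by_contra! h
  refine hi ((ht.isOutgoing_iff h.2.2).2 ?_)
  rw [isOutgoing_flip_of_ne h.2.1, isOutgoing_flip_of_ne h.1]
  exact C.outgoing i h.2.2

lemma not_isOutgoing_x_of_middle {t : Finset V} (ht : AgreeOn T t (flip s₀ x)) :
    ¬ G.IsOutgoing t x := by
  rw [ht.isOutgoing_iff C.x_mem, isOutgoing_flip, not_not]
  exact C.outgoing x C.x_mem

lemma not_isOutgoing_x_of_sink {t : Finset V} (ht : AgreeOn T t (flip (flip s₀ x) y)) :
    ¬ G.IsOutgoing t x := by
  rw [ht.isOutgoing_iff C.x_mem, isOutgoing_flip_of_ne C.ne, isOutgoing_flip, not_not]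
  exact C.outgoing x C.x_mem

lemma not_isOutgoing_y_of_sink {t : Finset V} (ht : AgreeOn T t (flip (flip s₀ x) y)) :
    ¬ G.IsOutgoing t y := by
  rw [ht.isOutgoing_iff C.y_mem, isOutgoing_flip, not_not, isOutgoing_flip_of_ne C.ne.symm]
  exact C.outgoing y C.y_mem

lemma differential_source {c : G.Chain} (hc : ∀ s, AgreeOn T s s₀ → c s = 0) {t : Finset V}
    (ht : AgreeOn T t s₀) : G.differential c t = 0 := by
  rw [differential_apply]
  refine Finset.sum_eq_zero fun i hi => ?_
  have hiT := C.notMem_of_source ht (Finset.mem_filter.1 hi).2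
  rw [hc _ ((agreeOn_flip_iff hiT).2 ht), map_zero]

/-- Edges at vertices outside `T` commute with the contraction, since `p` vanishes on their
generators. The only incoming edge at a vertex of `T` comes from the source. -/
lemma contract_differential_middle {c : G.Chain}
    (hc : ∀ s, AgreeOn T s (flip s₀ x) → contract (G.functional s p) (c s) = 0) {t : Finset V}
    (ht : AgreeOn T t (flip s₀ x)) :
    contract (G.functional t p) (G.differential c t) =
      contract (G.functional t p) (G.edge (flip t x) t x (c (flip t x))) := by
  rw [differential_apply, map_sum]
  refine Finset.sum_eq_single_of_mem x
    (Finset.mem_filter.2 ⟨Finset.mem_univ _, C.not_isOutgoing_x_of_middle ht⟩) fun i hi hix => ?_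
  have hiT := (C.eq_or_notMem_of_middle ht (Finset.mem_filter.1 hi).2).resolve_left hix
  have ht' := (agreeOn_flip_iff hiT).2 ht
  rw [contract_edge (flip_flip t i) (C.mem_dualCoords _ ht') (C.val_eq_zero i hiT), hc _ ht',
    map_zero]

/-- The incoming edges at vertices of `T` come from the corner `s₀ ⊕ y` and from the middle. -/
lemma differential_sink {c : G.Chain}
    (hc : ∀ s, AgreeOn T s (flip (flip s₀ x) y) → c s = 0) {t : Finset V}
    (ht : AgreeOn T t (flip (flip s₀ x) y)) :
    G.differential c t = G.edge (flip t x) t x (c (flip t x)) +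
      G.edge (flip t y) t y (c (flip t y)) := by
  rw [differential_apply, ← Finset.sum_pair C.ne
    (f := fun i => G.edge (flip t i) t i (c (flip t i)))]
  symm
  refine Finset.sum_subset (fun i hi => ?_) fun i hi hi' => ?_
  · rw [Finset.mem_filter]
    rcases Finset.mem_insert.1 hi with rfl | hi
    · exact ⟨Finset.mem_univ _, C.not_isOutgoing_x_of_sink ht⟩
    · obtain rfl := Finset.mem_singleton.1 hi
      exact ⟨Finset.mem_univ _, C.not_isOutgoing_y_of_sink ht⟩
  · have := C.eq_or_notMem_of_sink ht (Finset.mem_filter.1 hi).2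
    rw [Finset.mem_insert, Finset.mem_singleton] at hi'
    have hiT : i ∉ T := by tauto
    rw [hc _ ((agreeOn_flip_iff hiT).2 ht), map_zero]

lemma not_source_of_middle {s : Finset V} (h : AgreeOn T s (flip s₀ x)) : ¬ AgreeOn T s s₀ := by
  intro h'
  have h1 := h x C.x_mem
  rw [mem_flip, h' x C.x_mem] at h1
  tauto

lemma not_middle_of_sink {s : Finset V} (h : AgreeOn T s (flip (flip s₀ x) y)) :
    ¬ AgreeOn T s (flip s₀ x) := by
  intro h'
  have h1 := h y C.y_mem
  rw [mem_flip, h' y C.y_mem] at h1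
  tauto

lemma flip_x_not_middle_of_sink {s : Finset V} (h : AgreeOn T s (flip (flip s₀ x) y)) :
    ¬ AgreeOn T (flip s x) (flip s₀ x) := by
  intro h'
  have h1 := h.flip x x C.x_mem
  have h2 := h' x C.x_mem
  have h3 := C.ne
  simp only [mem_flip] at h1 h2
  tauto

/-- Any values at the sink are attained by chains at the middle killed by the contraction. -/
lemma exists_middle (c : G.Chain) : ∃ b : G.Chain,
    (∀ s, ¬ AgreeOn T s (flip s₀ x) → b s = 0) ∧
    (∀ s, AgreeOn T s (flip s₀ x) → contract (G.functional s p) (b s) = 0) ∧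
    ∀ s, AgreeOn T s (flip (flip s₀ x) y) → G.differential b s = c s := by
  have : ∀ s, ∃ z : G.StateAlgebra s, (¬ AgreeOn T s (flip s₀ x) → z = 0) ∧
      (AgreeOn T s (flip s₀ x) → contract (G.functional s p) z = 0 ∧
        G.edge s (flip s y) y z = c (flip s y)) := by
    intro s
    by_cases hs : AgreeOn T s (flip s₀ x)
    · obtain ⟨z, hz⟩ := exists_edge_eq (C.mem_dualCoords s hs) C.val_y (c (flip s y))
      exact ⟨z, fun h => absurd hs h, fun _ => hz⟩
    · exact ⟨0, fun _ => rfl, fun h => absurd h hs⟩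
  choose b hb hb' using this
  refine ⟨b, hb, fun s hs => (hb' s hs).1, fun t ht => ?_⟩
  obtain ⟨s, rfl⟩ : ∃ s, t = flip s y := ⟨flip t y, (flip_flip t y).symm⟩
  have hs : AgreeOn T s (flip s₀ x) := by simpa only [flip_flip] using ht.flip y
  rw [C.differential_sink (fun s hs => hb s (C.not_middle_of_sink hs)) ht,
    hb _ (C.flip_x_not_middle_of_sink ht), map_zero, zero_add, edge_congr y (flip_flip s y),
    (hb' s hs).2]

/-- After subtracting a boundary, the middle components are killed by the contraction. -/
lemma exists_source (c : G.Chain) : ∃ b : G.Chain,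
    ∀ s, AgreeOn T s (flip s₀ x) →
      contract (G.functional s p) (c s - G.differential b s) = 0 := by
  have : ∀ s, ∃ z : G.StateAlgebra s, (¬ AgreeOn T s s₀ → z = 0) ∧
      (AgreeOn T s s₀ → contract (G.functional (flip s x) p)
        (c (flip s x) - G.edge s (flip s x) x z) = 0) := by
    intro s
    by_cases hs : AgreeOn T s s₀
    · obtain ⟨z, hz⟩ := exists_contract_sub_edge_eq_zero
        (C.mem_dualCoords _ (hs.flip x)) (s := s) rfl C.val_x (c (flip s x))
      exact ⟨z, fun h => absurd hs h, fun _ => hz⟩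
    · exact ⟨0, fun _ => rfl, fun h => absurd h hs⟩
  choose b hb hb' using this
  refine ⟨b, fun t ht => ?_⟩
  rw [map_sub, C.contract_differential_middle (fun s hs => ?_) ht]
  · obtain ⟨s, rfl⟩ : ∃ s, t = flip s x := ⟨flip t x, (flip_flip t x).symm⟩
    have hs : AgreeOn T s s₀ := by simpa only [flip_flip] using ht.flip x
    rw [edge_congr x (flip_flip s x), ← map_sub, hb' s hs]
  · rw [hb s (C.not_source_of_middle hs), map_zero]

/-- A chain `b₁` at the source removes the part of the middle components not killed by the
contraction, and then `b₂`, at the middle and killed by the contraction, removes the sink. The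
source components disappear by themselves: the differential of the chain is zero at the middle up to
the contraction, and there the edge from the source is injective. -/
lemma isReduction : (G.cancelCore T s₀ x y p).IsReduction G.differential := by
  have hdd : ∀ c, G.differential (G.differential c) = 0 :=
    fun c => LinearMap.congr_fun G.differential_comp_differential c
  constructor
  · rintro c ⟨h1, h2, h3⟩
    refine ⟨fun s hs => C.differential_source h1 hs, fun s hs => ?_, fun s hs => ⟨(h3 s hs).2, ?_⟩⟩
    · rw [C.contract_differential_middle h2 hs, h1 _ hs.flip_left, map_zero, map_zero]
    · rw [hdd]
      rfl
  · rintro c ⟨h1, h2, h3⟩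
    obtain ⟨b₁, hb₁⟩ := C.exists_source c
    obtain ⟨b₂, hb₂, hb₂', hb₂''⟩ := C.exists_middle (c - G.differential b₁)
    refine ⟨b₁ + b₂, ?_⟩
    set c' := c - G.differential (b₁ + b₂) with hc'
    have hdc : G.differential c' = G.differential c := by
      rw [hc', map_sub, hdd, sub_zero]
    have hs : ∀ s, c' s = (c - G.differential b₁) s - G.differential b₂ s := fun s => by
      rw [hc', map_add, ← sub_sub]
      rfl
    have hm : ∀ s, AgreeOn T s (flip s₀ x) → contract (G.functional s p) (c' s) = 0 := by
      intro s h
      rw [hs, map_sub, Pi.sub_apply, hb₁ s h, C.contract_differential_middle hb₂' h,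
        hb₂ _ fun h' => C.not_source_of_middle h' h.flip_left, map_zero, map_zero, sub_zero]
    refine ⟨fun s h => ?_, hm, fun s h => ⟨?_, ?_⟩⟩
    · have ht := h.flip x
      have h0 := C.contract_differential_middle hm ht
      rw [hdc, h2 _ ht, edge_congr x (flip_flip s x)] at h0
      exact eq_zero_of_contract_edge_eq_zero (C.mem_dualCoords _ ht) rfl C.val_x h0.symm
    · rw [hs, hb₂'' s h, sub_self]
    · rw [hdc, (h3 s h).1]

/-- The values of a cancelled chain at the middle and at the corner `s₀ ⊕ y`. -/
lemma edge_middle {c : G.Chain} (hc : c ∈ G.cancelCore T s₀ x y p) {t : Finset V}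
    (ht : AgreeOn T t (flip (flip s₀ x) y)) :
    G.edge (flip t y) t y (c (flip t y)) = G.edge (flip t x) t x (c (flip t x)) := by
  have h := (hc.2.2 t ht).2
  rw [C.differential_sink (fun s hs => (hc.2.2 s hs).1) ht] at h
  rw [eq_neg_of_add_eq_zero_left h, ← neg_one_smul (ZMod 2), show (-1 : ZMod 2) = 1 from rfl,
    one_smul]

/-- The middle component is determined by the corner `s₀ ⊕ y`, since the edge from the middle to the
sink is an isomorphism on the kernel of the contraction. Conversely, prescribed surviving components
are extended by zero and then corrected at the middle so that the differential vanishes at the sink.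
-/
theorem isCore : G.IsCore (G.cancelCore T s₀ x y p)
    {s | ¬ AgreeOn T s s₀ ∧ ¬ AgreeOn T s (flip s₀ x) ∧
      ¬ AgreeOn T s (flip (flip s₀ x) y)} := by
  refine ⟨C.isReduction, fun c hc h => ?_, fun c => ?_⟩
  · have hrest : ∀ s, ¬ AgreeOn T s (flip s₀ x) → c s = 0 := by
      intro s hs
      by_cases h1 : AgreeOn T s s₀
      · exact hc.1 s h1
      by_cases h2 : AgreeOn T s (flip (flip s₀ x) y)
      · exact (hc.2.2 s h2).1
      · exact h s ⟨h1, hs, h2⟩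
    funext s
    by_cases hs : AgreeOn T s (flip s₀ x)
    · have ht := hs.flip y
      have h1 := C.edge_middle hc ht
      rw [hrest _ (C.flip_x_not_middle_of_sink ht), map_zero, edge_congr y (flip_flip s y)] at h1
      exact eq_zero_of_edge_eq_zero (C.mem_dualCoords s hs) C.val_y (hc.2.1 s hs) h1
    · exact hrest s hs
  · classical
    let c₀ : G.Chain := fun s => if AgreeOn T s s₀ ∨ AgreeOn T s (flip s₀ x) ∨
      AgreeOn T s (flip (flip s₀ x) y) then 0 else c s
    obtain ⟨b, hb, hb', hb''⟩ := C.exists_middle (G.differential c₀)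
    refine ⟨c₀ - b, ⟨fun s hs => ?_, fun s hs => ?_, fun s hs => ⟨?_, ?_⟩⟩, fun s hs => ?_⟩
    · rw [Pi.sub_apply, hb s fun h => C.not_source_of_middle h hs, sub_zero]
      exact if_pos (Or.inl hs)
    · rw [Pi.sub_apply, map_sub, hb' s hs, sub_zero,
        show c₀ s = 0 from if_pos (Or.inr (Or.inl hs)), map_zero]
    · rw [Pi.sub_apply, hb s (C.not_middle_of_sink hs), sub_zero]
      exact if_pos (Or.inr (Or.inr hs))
    · rw [map_sub, Pi.sub_apply, hb'' s hs, sub_self]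
    · rw [Pi.sub_apply, hb s hs.2.1, sub_zero]
      refine if_neg ?_
      have := hs.1
      have := hs.2.1
      have := hs.2.2
      tauto

end Cancellation

end Cancellation
end LabeledGraph

namespace LabeledGraph

/-! ### Deletion of vertices. -/

section Embedding

variable {V : Type u} [Fintype V] [DecidableEq V] {G : LabeledGraph V}
variable {W : Type v} [Fintype W] [DecidableEq W] {H : LabeledGraph W}

open ExteriorAlgebra (contract)

variable (G H) in
/-- An isomorphism of `G` with the labeled graph obtained from `H` by deleting the vertices
in `T`. -/
structure DeletionEmbedding (T : Finset W) where
  toFun : V ↪ W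
  notMem_iff : ∀ w, w ∉ T ↔ ∃ k, toFun k = w
  adjMatrix_eq : ∀ i k, H.adjMatrix (toFun i) (toFun k) = G.adjMatrix i k
  sign_eq : ∀ k, H.sign (toFun k) = G.sign k

lemma IsIsomorphic.nonempty_deletionEmbedding {T : Finset W} {S : Set W} (hS : S = (T : Set W)ᶜ)
    (h : G.IsIsomorphic (H.induce S)) : Nonempty (DeletionEmbedding G H T) := by
  subst hS
  obtain ⟨e, hf, hs⟩ := h
  refine ⟨⟨⟨fun k => (e k).1, fun k k' h => e.injective (Subtype.ext h)⟩, fun w => ?_,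
    fun i k => ?_, fun k => hs k⟩⟩
  · constructor
    · intro hw
      exact ⟨e.symm ⟨w, hw⟩, congr_arg Subtype.val (e.apply_symm_apply ⟨w, hw⟩)⟩
    · rintro ⟨k, rfl⟩
      exact (e k).2
  · change H.adjMatrix (e i).1 (e k).1 = _
    by_cases hik : i = k
    · subst hik
      rw [adjMatrix_self, adjMatrix_self, ← hf]
      rfl
    · have hne : (e i).1 ≠ (e k).1 := fun h => hik (e.injective (Subtype.ext h))
      rw [adjMatrix_of_ne _ hik, adjMatrix_of_ne _ hne]
      classical exact if_congr (e.map_adj_iff (v := i) (w := k)) rfl rfl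

namespace DeletionEmbedding

variable {T : Finset W} (j : DeletionEmbedding G H T)

lemma apply_notMem (k : V) : j.toFun k ∉ T := (j.notMem_iff _).2 ⟨k, rfl⟩

/-- The part of a state of `H` in `G`. -/
def preimage (t : Finset W) : Finset V := {k | j.toFun k ∈ t}

lemma mem_preimage {t : Finset W} {k : V} : k ∈ j.preimage t ↔ j.toFun k ∈ t := by
  simp [preimage]

lemma preimage_flip (t : Finset W) (k : V) :
    j.preimage (flip t (j.toFun k)) = flip (j.preimage t) k := by
  ext i
  simp only [mem_flip, mem_preimage, ne_eq, j.toFun.injective.eq_iff]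

/-- Restriction of coordinates. -/
def restrict : (W → ZMod 2) →ₗ[ZMod 2] (V → ZMod 2) := LinearMap.funLeft (ZMod 2) (ZMod 2) j.toFun

lemma restrict_apply (p : W → ZMod 2) (k : V) : j.restrict p k = p (j.toFun k) := rfl

/-- Extension of coordinates by zero. -/
noncomputable def extend : (V → ZMod 2) →ₗ[ZMod 2] (W → ZMod 2) :=
  Function.ExtendByZero.linearMap (ZMod 2) j.toFun

lemma extend_apply (q : V → ZMod 2) (k : V) : j.extend q (j.toFun k) = q k :=
  j.toFun.injective.extend_apply _ _ _

lemma extend_of_mem (q : V → ZMod 2) {w : W} (hw : w ∈ T) : j.extend q w = 0 :=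
  Function.extend_apply' _ _ _ fun ⟨k, hk⟩ => j.apply_notMem k (hk ▸ hw)

lemma restrict_extend (q : V → ZMod 2) : j.restrict (j.extend q) = q :=
  funext fun k => j.extend_apply q k

lemma sum_eq {A : Type*} [AddCommMonoid A] (f : W → A) (hf : ∀ w ∈ T, f w = 0) :
    ∑ w, f w = ∑ k, f (j.toFun k) := by
  rw [← Finset.sum_map Finset.univ j.toFun f]
  symm
  refine Finset.sum_subset (Finset.subset_univ _) fun w _ hw => ?_
  by_contra h
  obtain ⟨k, rfl⟩ := (j.notMem_iff w).1 fun hT => h (hf w hT)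
  exact hw (Finset.mem_map_of_mem _ (Finset.mem_univ k))

/-- The deleted vertices must not contribute to the product: in the second move because `p` vanishes
on them, in the first because their columns do. -/
lemma mulVec_restrict {p : W → ZMod 2} {k : V}
    (hp : ∀ w ∈ T, H.adjMatrix (j.toFun k) w * p w = 0) :
    G.adjMatrix.mulVec (j.restrict p) k = H.adjMatrix.mulVec p (j.toFun k) := by
  rw [mulVec_eq_sum, mulVec_eq_sum, j.sum_eq _ hp]
  exact Finset.sum_congr rfl fun i _ => by rw [j.adjMatrix_eq, restrict_apply]

lemma val_restrict {p : W → ZMod 2} {k : V}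
    (hp : ∀ w ∈ T, H.adjMatrix (j.toFun k) w * p w = 0) :
    G.val k (j.restrict p) = H.val (j.toFun k) p := by
  rw [val_apply, val_apply, j.mulVec_restrict hp, restrict_apply]

lemma restrict_mem {t : Finset W} {p : W → ZMod 2} (h : p ∈ H.dualCoords t)
    (hp : ∀ k, ∀ w ∈ T, H.adjMatrix (j.toFun k) w * p w = 0) :
    j.restrict p ∈ G.dualCoords (j.preimage t) := by
  refine ⟨fun k hk => h.1 _ fun h => hk (j.mem_preimage.2 h), fun k hk => ?_⟩
  rw [j.mulVec_restrict (hp k)]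
  exact h.2 _ (j.mem_preimage.1 hk)

lemma extend_mem {t : Finset W} {q : V → ZMod 2} (h : q ∈ G.dualCoords (j.preimage t))
    (ht : ∀ w ∈ T, w ∈ t → H.adjMatrix.mulVec (j.extend q) w = 0) :
    j.extend q ∈ H.dualCoords t := by
  refine ⟨fun w hw => ?_, fun w hw => ?_⟩ <;> by_cases hwT : w ∈ T
  · exact j.extend_of_mem q hwT
  · obtain ⟨k, rfl⟩ := (j.notMem_iff w).1 hwT
    rw [extend_apply]
    exact h.1 k fun h => hw (j.mem_preimage.1 h)
  · exact ht w hwT hw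
  · obtain ⟨k, rfl⟩ := (j.notMem_iff w).1 hwT
    rw [← j.mulVec_restrict fun w hw => by rw [j.extend_of_mem q hw, mul_zero], restrict_extend]
    exact h.2 k (j.mem_preimage.2 hw)

lemma isOutgoing_iff (t : Finset W) (k : V) :
    H.IsOutgoing t (j.toFun k) ↔ G.IsOutgoing (j.preimage t) k := by
  unfold IsOutgoing
  rw [j.sign_eq, j.mem_preimage]

/-- The incoming edges of a state at the vertices of `G`. -/
lemma sum_incoming {A : Type*} [AddCommMonoid A] (t : Finset W) (f : W → A)
    (hf : ∀ w ∈ T, ¬ H.IsOutgoing t w → f w = 0) :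
    ∑ w with ¬ H.IsOutgoing t w, f w =
      ∑ k with ¬ G.IsOutgoing (j.preimage t) k, f (j.toFun k) := by
  rw [Finset.sum_filter, Finset.sum_filter, j.sum_eq]
  · exact Finset.sum_congr rfl fun k _ => if_congr (not_congr (j.isOutgoing_iff t k)) rfl rfl
  · intro w hw
    split_ifs with h
    · rfl
    · exact hf w hw h

end DeletionEmbedding

/-! ### The move `Ω₂`. -/

section SecondMove

/-- Equal rows put `X x + X y` into the kernel of `A`, so it is a functional at every state
containing `x` and `y`, with value `1` at these two vertices only. By the signs, arrows insert `x`
and remove `y`; hence the source `{y}`, the middle `{x, y}` and the sink `{x}`. -/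
lemma cancellation_of_row_eq {x y : W} (hxy : x ≠ y) (hsx : H.sign x = -1) (hsy : H.sign y = 1)
    (hrow : ∀ k, H.adjMatrix x k = H.adjMatrix y k) :
    H.Cancellation {x, y} {y} x y (X x + X y) := by
  have hmul : ∀ k, H.adjMatrix.mulVec (X x + X y) k = 0 := fun k => by
    rw [Matrix.mulVec_add, Pi.add_apply, mulVec_X, mulVec_X, H.adjMatrix_symm k x,
      H.adjMatrix_symm k y, hrow, CharTwo.add_self_eq_zero]
  have hval : ∀ k, H.val k (X x + X y) = (if k = x then 1 else 0) + if k = y then 1 else 0 :=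
    fun k => by rw [val_apply, hmul, add_zero, Pi.add_apply, X_apply, X_apply]
  refine ⟨by simp, by simp, hxy, fun i hi => ?_, fun s hs => ⟨fun k hk => ?_, fun k _ => hmul k⟩,
    ?_, ?_, fun i hi => ?_⟩
  · rcases Finset.mem_insert.1 hi with rfl | hi
    · exact Or.inl ⟨hsx, by simpa using hxy⟩
    · obtain rfl := Finset.mem_singleton.1 hi
      exact Or.inr ⟨hsy, hi⟩
  · have h1 := hs x (by simp)
    have h2 := hs y (by simp)
    rw [mem_flip, Finset.mem_singleton] at h1 h2
    have hkx : k ≠ x := by rintro rfl; tauto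
    have hky : k ≠ y := by rintro rfl; tauto
    rw [Pi.add_apply, X_apply, X_apply, if_neg hkx, if_neg hky, add_zero]
  · rw [hval, if_pos rfl, if_neg hxy, add_zero]
  · rw [hval, if_pos rfl, if_neg hxy.symm, zero_add]
  · rw [Finset.mem_insert, Finset.mem_singleton, not_or] at hi
    rw [hval, if_neg hi.1, if_neg hi.2, add_zero]

lemma rest_iff {x y : W} (hxy : x ≠ y) (t : Finset W) :
    t ∈ {s | ¬ AgreeOn {x, y} s {y} ∧ ¬ AgreeOn {x, y} s (flip {y} x) ∧
      ¬ AgreeOn {x, y} s (flip (flip {y} x) y)} ↔ x ∉ t ∧ y ∉ t := by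
  simp only [AgreeOn, Set.mem_ofPred_eq, Finset.mem_insert, Finset.mem_singleton,
    forall_eq_or_imp, forall_eq, mem_flip]
  by_cases hx : x ∈ t <;> by_cases hy : y ∈ t <;> simp [hx, hy, hxy, hxy.symm]

theorem Omega2.nonempty_Kh_equiv (h : G.Omega2 H) : Nonempty (G.Kh ≃ₗ[ZMod 2] H.Kh) := by
  obtain ⟨x, y, hxy, hsx, hsy, hlab, hadj, hiso⟩ := h
  obtain ⟨j⟩ := hiso.nonempty_deletionEmbedding (T := {x, y}) (by simp)
  have hrow : ∀ k, H.adjMatrix x k = H.adjMatrix y k := by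
    -- Both admissible labelings make the block of `x` and `y` constant, so the rows agree at these
    -- two columns as well.
    have hdiag : H.adjMatrix x x = H.adjMatrix x y ∧ H.adjMatrix x y = H.adjMatrix y y := by
      rw [adjMatrix_self, adjMatrix_self, adjMatrix_of_ne _ hxy]
      rcases hlab with ⟨h1, h2, h3⟩ | ⟨h1, h2, h3⟩
      · rw [if_pos h1, h2, h3]; exact ⟨rfl, rfl⟩
      · rw [if_neg h1, h2, h3]; exact ⟨rfl, rfl⟩
    intro k
    by_cases hkx : k = x
    · subst hkx
      rw [hdiag.1, adjMatrix_symm]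
    by_cases hky : k = y
    · subst hky
      exact hdiag.2
    · exact adjMatrix_congr (Ne.symm hkx) (Ne.symm hky) (hadj k hkx hky)
  have C := cancellation_of_row_eq hxy hsx hsy hrow
  have hS := rest_iff hxy
  have hvan : ∀ t, x ∉ t ∧ y ∉ t → ∀ p ∈ H.dualCoords t, ∀ k : V, ∀ w ∈ ({x, y} : Finset W),
      H.adjMatrix (j.toFun k) w * p w = 0 := by
    intro t ht p hp k w hw
    rw [hp.1 w, mul_zero]
    rcases Finset.mem_insert.1 hw with rfl | hw
    · exact ht.1
    · exact Finset.mem_singleton.1 hw ▸ ht.2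
  refine nonempty_Kh_equiv_of_isCore G.isCore_top C.isCore
    (fun s t => (x ∉ t ∧ y ∉ t) ∧ j.preimage t = s) (fun _ _ => j.restrict) ?_ ?_ ?_ ?_ ?_ ?_ ?_
  · exact fun s t h => ⟨trivial, (hS t).2 h.1⟩
  · intro s _
    refine ⟨s.map j.toFun, ⟨?_, ?_⟩, ?_⟩
    · intro h
      obtain ⟨k, _, hk⟩ := Finset.mem_map.1 h
      exact j.apply_notMem k (by simp [hk])
    · intro h
      obtain ⟨k, _, hk⟩ := Finset.mem_map.1 h
      exact j.apply_notMem k (by simp [hk])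
    · ext k
      rw [j.mem_preimage, Finset.mem_map' j.toFun]
  · exact fun t ht => ⟨_, (hS t).1 ht, rfl⟩
  · rintro s t t' ⟨ht, rfl⟩ ⟨ht', h⟩
    ext w
    by_cases hw : w ∈ ({x, y} : Finset W)
    · rcases Finset.mem_insert.1 hw with rfl | hw
      · tauto
      · obtain rfl := Finset.mem_singleton.1 hw
        tauto
    · obtain ⟨k, rfl⟩ := (j.notMem_iff w).1 hw
      rw [← j.mem_preimage, ← j.mem_preimage, h]
  · exact fun s s' t h h' => h.2.symm.trans h'.2
  · rintro s t ⟨ht, rfl⟩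
    refine ⟨fun p hp => j.restrict_mem hp (hvan t ht p hp), fun p hp p' hp' h => ?_,
      fun q hq => ⟨j.extend q, j.extend_mem hq fun w hw hwt => ?_, j.restrict_extend q⟩⟩
    · funext w
      by_cases hw : w ∈ t
      · obtain ⟨k, rfl⟩ := (j.notMem_iff w).1 (by
          rw [Finset.mem_insert, Finset.mem_singleton]
          rintro (rfl | rfl)
          · exact ht.1 hw
          · exact ht.2 hw)
        exact congr_fun h k
      · rw [hp.1 w hw, hp'.1 w hw]
    · exfalso
      rcases Finset.mem_insert.1 hw with rfl | hw
      · exact ht.1 hwt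
      · exact ht.2 (Finset.mem_singleton.1 hw ▸ hwt)
  · rintro c - c' hc' h s t ⟨ht, rfl⟩
    rw [differential_apply, differential_apply, map_sum, j.sum_incoming]
    · refine Finset.sum_congr rfl fun k _ => ?_
      have hk : ∀ w ∈ ({x, y} : Finset W), w ≠ j.toFun k := fun w hw h =>
        j.apply_notMem k (h ▸ hw)
      have hx := hk x (by simp)
      have hy := hk y (by simp)
      have ht' : x ∉ flip t (j.toFun k) ∧ y ∉ flip t (j.toFun k) := by
        simp only [mem_flip]
        tauto
      have hpre := j.preimage_flip t k
      rw [h _ _ ⟨ht', hpre⟩]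
      exact (map_transfer_edge j.restrict (flip_flip _ k) (flip_flip t _)
        (hpre ▸ fun p hp => j.restrict_mem hp (hvan _ ht' p hp))
        (fun p hp => j.restrict_mem hp (hvan t ht p hp))
        (fun q hq => ⟨j.extend q, j.extend_mem (hpre ▸ hq) fun w hw hwt => by
          exfalso
          rcases Finset.mem_insert.1 hw with rfl | hw
          · exact ht'.1 hwt
          · exact ht'.2 (Finset.mem_singleton.1 hw ▸ hwt), j.restrict_extend q⟩)
        (fun p hp => j.val_restrict (hvan _ ht' p hp k))
        (fun p hp => j.val_restrict (hvan t ht p hp k)) _).symm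
    -- The only incoming edge at an added vertex is the one at `y`, and it starts at the cancelled
    -- source.
    · intro w hw hout
      rcases Finset.mem_insert.1 hw with rfl | hw
      · exact absurd (Or.inl ⟨hsx, ht.1⟩) hout
      · obtain rfl := Finset.mem_singleton.1 hw
        have hsrc : AgreeOn {x, w} (flip t w) {w} := by
          simp only [AgreeOn, Finset.mem_insert, Finset.mem_singleton,
            forall_eq_or_imp, forall_eq, mem_flip]
          tauto
        rw [hc'.1 _ hsrc, map_zero]

end SecondMove

end Embedding
end LabeledGraph

namespace LabeledGraph

/-! ### The move `Ω₁`. -/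

section FirstMove

variable {V : Type u} [Fintype V] [DecidableEq V] {G : LabeledGraph V}
variable {W : Type v} [Fintype W] [DecidableEq W] {H : LabeledGraph W}

open ExteriorAlgebra (contract)

lemma edge_ι_mul {s t : Finset V} {i : V} (hst : flip s i = t) (a : V) (z : G.StateAlgebra s) :
    G.edge s t i (ExteriorAlgebra.ι (ZMod 2) (G.gen s a) * z) =
      ExteriorAlgebra.ι (ZMod 2) (G.gen t a) * G.edge s t i z := by
  subst hst
  obtain ⟨w, rfl⟩ := G.proj_surjective _ z
  rw [← proj_ι_X, ← map_mul, edge_flip, edgeMap_proj, edgeMap_proj, ← proj_ι_X, ← map_mul,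
    ← mul_assoc, ← mul_assoc]
  congr 2
  unfold edgeFactor
  split_ifs
  · rw [ExteriorAlgebra.ι_mul_ι_comm_neg, ← neg_one_smul (ZMod 2), show (-1 : ZMod 2) = 1 from rfl,
      one_smul]
  · rw [one_mul, mul_one]

namespace DeletionEmbedding

variable {x : W} (j : DeletionEmbedding G H {x}) (hx : ∀ w, H.adjMatrix x w = 0)

include hx

lemma adjMatrix_mul_eq_zero (p : W → ZMod 2) (k : V) :
    ∀ w ∈ ({x} : Finset W), H.adjMatrix (j.toFun k) w * p w = 0 := by
  intro w hw
  rw [Finset.mem_singleton.1 hw, H.adjMatrix_symm, hx, zero_mul]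

lemma mulVec_isolated (p : W → ZMod 2) : H.adjMatrix.mulVec p x = 0 := by
  rw [mulVec_eq_sum]
  exact Finset.sum_eq_zero fun w _ => by rw [hx, zero_mul]

lemma restrict_mem_of_isolated (t : Finset W) :
    ∀ p ∈ H.dualCoords t, j.restrict p ∈ G.dualCoords (j.preimage t) := fun p hp =>
  j.restrict_mem hp (j.adjMatrix_mul_eq_zero hx p)

lemma extend_mem_of_isolated (t : Finset W) :
    ∀ q ∈ G.dualCoords (j.preimage t), j.extend q ∈ H.dualCoords t := fun q hq =>
  j.extend_mem hq fun w hw _ => by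
    rw [Finset.mem_singleton.1 hw]
    exact mulVec_isolated hx _

/-- The map of state spaces which adds the isolated vertex. -/
noncomputable def addIsolated (t : Finset W) :
    G.StateSpace (j.preimage t) →ₗ[ZMod 2] H.StateSpace t :=
  transfer (j.preimage t) t j.restrict (j.restrict_mem_of_isolated hx t)

lemma map_addIsolated_injective (t : Finset W) :
    Function.Injective (ExteriorAlgebra.map (j.addIsolated hx t)) := by
  refine ExteriorAlgebra.map_injective_field (LinearMap.ker_eq_bot.2 ?_)
  exact transfer_injective fun q hq =>
    ⟨j.extend q, j.extend_mem_of_isolated hx t q hq, j.restrict_extend q⟩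

lemma map_addIsolated_edge (c : G.Chain) (t : Finset W) (k : V) :
    ExteriorAlgebra.map (j.addIsolated hx t)
        (G.edge (flip (j.preimage t) k) (j.preimage t) k (c (flip (j.preimage t) k))) =
      H.edge (flip t (j.toFun k)) t (j.toFun k)
        (ExteriorAlgebra.map (j.addIsolated hx (flip t (j.toFun k)))
          (c (j.preimage (flip t (j.toFun k))))) := by
  rw [← edge_congr k (j.preimage_flip t k)]
  exact map_transfer_edge j.restrict (by rw [j.preimage_flip, flip_flip]) (flip_flip t _)
    (j.restrict_mem_of_isolated hx _) (j.restrict_mem_of_isolated hx _)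
    (fun q hq => ⟨j.extend q, j.extend_mem_of_isolated hx _ q hq, j.restrict_extend q⟩)
    (fun p _ => j.val_restrict (j.adjMatrix_mul_eq_zero hx p k))
    (fun p _ => j.val_restrict (j.adjMatrix_mul_eq_zero hx p k)) _

lemma single_mem {t : Finset W} (ht : x ∈ t) : X x ∈ H.dualCoords t := by
  refine ⟨fun k hk => ?_, fun k _ => ?_⟩
  · rw [X_apply, if_neg]
    rintro rfl
    exact hk ht
  · rw [mulVec_X, H.adjMatrix_symm, hx]

lemma val_single (k : W) : H.val k (X x) = if k = x then 1 else 0 := by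
  rw [val_apply, mulVec_X, H.adjMatrix_symm, hx, add_zero, X_apply]

lemma val_single_self : H.val x (X x) = 1 := by rw [val_single hx, if_pos rfl]

lemma contract_map_addIsolated {t : Finset W} (ht : x ∈ t)
    (z : G.StateAlgebra (j.preimage t)) :
    contract (H.functional t (X x)) (ExteriorAlgebra.map (j.addIsolated hx t) z) = 0 := by
  have h0 : j.restrict (X x) = 0 := funext fun k => by
    rw [restrict_apply, X_apply, if_neg]
    · rfl
    · intro h
      exact j.apply_notMem k (Finset.mem_singleton.2 h)
  have h1 : H.functional t (X x) ∘ₗ j.addIsolated hx t = 0 := by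
    rw [addIsolated, functional_comp_transfer (single_mem hx ht), h0]
    refine LinearMap.ext fun z => ?_
    rw [functional_apply (zero_mem _)]
    exact map_zero _
  rw [ExteriorAlgebra.map_contract, h1, ExteriorAlgebra.contract_zero, map_zero]

/-- For `x ∈ t` the space `V(t)` is the space of `G` plus a line spanned by `x_x`, and `X x` is the
functional dual to this line. So the kernel of the contraction is the exterior algebra of the space
of `G`, reached by the projection along `x_x`. -/
lemma exists_map_addIsolated {t : Finset W} (ht : x ∈ t) {z : H.StateAlgebra t}
    (hz : contract (H.functional t (X x)) z = 0) :
    ∃ w, ExteriorAlgebra.map (j.addIsolated hx t) w = z := by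
  have hX := single_mem hx ht
  refine ⟨ExteriorAlgebra.map (transfer t (j.preimage t) j.extend
    (j.extend_mem_of_isolated hx t)) z, ?_⟩
  have h1 := ExteriorAlgebra.map_id_sub_smulRight (H.functional t (X x)) (H.gen t x) z
  rw [hz, mul_zero, sub_zero] at h1
  conv_rhs => rw [← h1]
  rw [ExteriorAlgebra.map_map_apply]
  congr 2
  refine linearMap_ext_functional fun p hp => LinearMap.ext fun m => ?_
  have hp' := j.restrict_mem_of_isolated hx t p hp
  have hext : j.extend (j.restrict p) = p + p x • X x := by
    funext w
    rw [Pi.add_apply, Pi.smul_apply, X_apply]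
    by_cases hw : w = x
    · subst hw
      rw [j.extend_of_mem _ (Finset.mem_singleton_self w), if_pos rfl, smul_eq_mul, mul_one,
        CharTwo.add_self_eq_zero]
    · obtain ⟨k, rfl⟩ := (j.notMem_iff w).1 fun h => hw (Finset.mem_singleton.1 h)
      rw [extend_apply, restrict_apply, if_neg hw, smul_zero, add_zero]
  have hvx : H.val x p = p x := by rw [val_apply, mulVec_isolated hx, add_zero]
  rw [LinearMap.comp_apply, LinearMap.comp_apply, LinearMap.comp_apply, addIsolated,
    functional_transfer hp, functional_transfer hp', hext,
    functional_add hp (Submodule.smul_mem _ _ hX), functional_smul hX, LinearMap.sub_apply,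
    map_sub, LinearMap.id_apply, LinearMap.smulRight_apply, map_smul, functional_gen hp, hvx,
    smul_eq_mul, CharTwo.sub_eq_add, mul_comm]

omit hx in
lemma exists_preimage_eq (s : Finset V) : ∃ t, x ∈ t ∧ j.preimage t = s := by
  refine ⟨insert x (s.map j.toFun), Finset.mem_insert_self _ _, ?_⟩
  ext k
  have : j.toFun k ≠ x := fun h => j.apply_notMem k (Finset.mem_singleton.2 h)
  rw [j.mem_preimage, Finset.mem_insert, Finset.mem_map' j.toFun]
  tauto

omit hx in
lemma mem_flip_iff (t : Finset W) (k : V) : x ∈ flip t (j.toFun k) ↔ x ∈ t := by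
  have : x ≠ j.toFun k := fun h => j.apply_notMem k (Finset.mem_singleton.2 h.symm)
  rw [mem_flip]
  tauto

omit hx in
lemma sum_incoming_singleton {A : Type*} [AddCommMonoid A] (t : Finset W) (f : W → A)
    (hf : ¬ H.IsOutgoing t x → f x = 0) :
    ∑ w with ¬ H.IsOutgoing t w, f w =
      ∑ k with ¬ G.IsOutgoing (j.preimage t) k, f (j.toFun k) :=
  j.sum_incoming t f fun w hw => by rwa [Finset.mem_singleton.1 hw]

omit hx in
lemma differential_eq_edge (j : DeletionEmbedding G H {x}) {b : H.Chain} {t : Finset W} (ht : ¬ H.IsOutgoing t x)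
    (hb : ∀ s, (x ∈ s ↔ x ∈ t) → b s = 0) :
    H.differential b t = H.edge (flip t x) t x (b (flip t x)) := by
  rw [differential_apply]
  refine Finset.sum_eq_single_of_mem x (Finset.mem_filter.2 ⟨Finset.mem_univ _, ht⟩)
    fun w _ hwx => ?_
  obtain ⟨k, rfl⟩ := (j.notMem_iff w).1 fun h => hwx (Finset.mem_singleton.1 h)
  rw [hb _ (j.mem_flip_iff t k), map_zero]

/-- Edges at `x` enter the states containing `x` and multiply by `x_x`. They are injective, and
their cokernel is represented by the kernel of the contraction, where `f` places the complex of `G`.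
-/
theorem nonempty_Kh_equiv_of_neg (j : DeletionEmbedding G H {x}) (hs : H.sign x = -1) :
    Nonempty (G.Kh ≃ₗ[ZMod 2] H.Kh) := by
  have hout : ∀ t, ¬ H.IsOutgoing t x ↔ x ∈ t := fun t => by
    unfold IsOutgoing
    rw [hs]
    simp
  let f : G.Chain →ₗ[ZMod 2] H.Chain := LinearMap.pi fun t =>
    if x ∈ t then (ExteriorAlgebra.map (j.addIsolated hx t)).toLinearMap ∘ₗ
      LinearMap.proj (j.preimage t) else 0
  have f_mem : ∀ c t, x ∈ t →
      f c t = ExteriorAlgebra.map (j.addIsolated hx t) (c (j.preimage t)) := fun c t ht => by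
    change (if x ∈ t then _ else _ : G.Chain →ₗ[ZMod 2] H.StateAlgebra t) c = _
    rw [if_pos ht]
    rfl
  have f_notMem : ∀ c t, x ∉ t → f c t = 0 := fun c t ht => by
    change (if x ∈ t then _ else _ : G.Chain →ₗ[ZMod 2] H.StateAlgebra t) c = _
    rw [if_neg ht]
    rfl
  have hcomm : ∀ c, H.differential (f c) = f (G.differential c) := by
    intro c
    funext t
    rw [differential_apply, j.sum_incoming_singleton]
    · by_cases ht : x ∈ t
      · rw [f_mem _ _ ht, differential_apply, map_sum]
        refine Finset.sum_congr rfl fun k _ => ?_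
        rw [f_mem _ _ ((j.mem_flip_iff t k).2 ht), j.map_addIsolated_edge hx]
      · rw [f_notMem _ _ ht]
        refine Finset.sum_eq_zero fun k _ => ?_
        rw [f_notMem _ _ (mt (j.mem_flip_iff t k).1 ht), map_zero]
    · intro h
      rw [hout] at h
      rw [f_notMem _ _ (by rw [mem_flip]; tauto), map_zero]
  have hinj : Function.Injective f := by
    rw [injective_iff_map_eq_zero]
    intro c hc
    funext s
    obtain ⟨t, ht, rfl⟩ := j.exists_preimage_eq s
    refine j.map_addIsolated_injective hx t ?_
    rw [← f_mem c t ht, hc]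
    exact (map_zero _).symm
  have hrange : ∀ c, c ∈ LinearMap.range f ↔ (∀ t, x ∉ t → c t = 0) ∧
      ∀ t, x ∈ t → contract (H.functional t (X x)) (c t) = 0 := by
    intro c
    constructor
    · rintro ⟨c, rfl⟩
      exact ⟨f_notMem c, fun t ht => by rw [f_mem c t ht, j.contract_map_addIsolated hx ht]⟩
    · rintro ⟨h1, h2⟩
      -- Every state of `G` comes from exactly one state containing `x`, so one choice for each
      -- state of `G` is enough.
      have : ∀ s, ∃ w, ∀ t, x ∈ t → (h : j.preimage t = s) →
          ExteriorAlgebra.map (j.addIsolated hx t) (h ▸ w) = c t := by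
        intro s
        obtain ⟨t, ht, rfl⟩ := j.exists_preimage_eq s
        obtain ⟨w, hw⟩ := j.exists_map_addIsolated hx ht (h2 t ht)
        refine ⟨w, fun t' ht' h => ?_⟩
        obtain rfl : t = t' := by
          ext k
          by_cases hk : k = x
          · subst hk; tauto
          · obtain ⟨i, rfl⟩ := (j.notMem_iff k).1 fun h => hk (Finset.mem_singleton.1 h)
            rw [← j.mem_preimage, ← j.mem_preimage, h]
        exact hw
      choose w hw using this
      refine ⟨w, funext fun t => ?_⟩
      by_cases ht : x ∈ t
      · rw [f_mem _ _ ht]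
        exact hw _ t ht rfl
      · rw [f_notMem _ _ ht, h1 t ht]
  refine LinearMap.Homology.nonempty_equiv_of_injective H.differential_comp_differential f hinj
    hcomm ⟨?_, fun c hc => ?_⟩
  · rintro _ ⟨c, rfl⟩
    exact ⟨_, (hcomm c).symm⟩
  · have : ∀ s, ∃ z : H.StateAlgebra s, (x ∈ s → z = 0) ∧ (x ∉ s →
        contract (H.functional (flip s x) (X x))
          (c (flip s x) - H.edge s (flip s x) x z) = 0) := by
      intro s
      by_cases hs : x ∈ s
      · exact ⟨0, fun _ => rfl, fun h => absurd hs h⟩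
      · obtain ⟨z, hz⟩ := exists_contract_sub_edge_eq_zero (s := s) (t := flip s x)
          (single_mem hx (mem_flip.2 (Or.inr ⟨rfl, hs⟩))) rfl (val_single_self hx)
          (c (flip s x))
        exact ⟨z, fun h => absurd h hs, fun _ => hz⟩
    choose b hb hb' using this
    have hm : ∀ t, x ∈ t →
        contract (H.functional t (X x)) ((c - H.differential b) t) = 0 := by
      intro t ht
      rw [Pi.sub_apply, j.differential_eq_edge ((hout t).2 ht) fun s hs => hb s (hs.2 ht)]
      obtain ⟨s, rfl⟩ : ∃ s, t = flip s x := ⟨flip t x, (flip_flip t x).symm⟩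
      rw [edge_congr x (flip_flip s x)]
      exact hb' s fun h => by rw [mem_flip] at ht; tauto
    refine ⟨b, (hrange _).2 ⟨fun s hs => ?_, hm⟩⟩
    have hdd : H.differential (c - H.differential b) = H.differential c := by
      rw [map_sub, show H.differential (H.differential b) = 0 from
        LinearMap.congr_fun H.differential_comp_differential b, sub_zero]
    have ht : x ∈ flip s x := mem_flip.2 (Or.inr ⟨rfl, hs⟩)
    have hX := single_mem hx ht
    refine eq_zero_of_contract_edge_eq_zero hX rfl (val_single_self hx) ?_
    have h0 := ((hrange _).1 hc).2 _ ht
    rw [← hdd, differential_apply, map_sum, Finset.sum_eq_single_of_mem x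
      (Finset.mem_filter.2 ⟨Finset.mem_univ _, (hout _).2 ht⟩), edge_congr x (flip_flip s x)] at h0
    · exact h0
    · intro w _ hwx
      obtain ⟨k, rfl⟩ := (j.notMem_iff w).1 fun h => hwx (Finset.mem_singleton.1 h)
      have hk := (j.mem_flip_iff (flip s x) k).2 ht
      rw [contract_edge (flip_flip _ _) (single_mem hx hk) (by rw [val_single hx, if_neg hwx]),
        hm _ hk, map_zero]

/-- Edges at `x` now leave the states containing `x` and are quotients by `x_x`. They are surjective
with kernel the multiples of `x_x`, so `f` multiplies by `x_x`; this factor is zero at states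
without `x`. -/
theorem nonempty_Kh_equiv_of_pos (j : DeletionEmbedding G H {x}) (hs : H.sign x = 1) :
    Nonempty (G.Kh ≃ₗ[ZMod 2] H.Kh) := by
  have hout : ∀ t, ¬ H.IsOutgoing t x ↔ x ∉ t := fun t => by
    unfold IsOutgoing
    rw [hs]
    simp
  have hgen : ∀ t, x ∉ t → H.gen t x = 0 := fun t ht => by
    have := H.gen_flip_eq_zero (gen_ne_zero_of_val
      (single_mem hx (mem_flip.2 (Or.inr ⟨rfl, ht⟩))) (val_single_self hx))
    rwa [flip_flip] at this
  let f : G.Chain →ₗ[ZMod 2] H.Chain := LinearMap.pi fun t =>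
    LinearMap.mulLeft (ZMod 2) (ExteriorAlgebra.ι (ZMod 2) (H.gen t x)) ∘ₗ
      (ExteriorAlgebra.map (j.addIsolated hx t)).toLinearMap ∘ₗ LinearMap.proj (j.preimage t)
  have f_apply : ∀ c t, f c t = ExteriorAlgebra.ι (ZMod 2) (H.gen t x) *
      ExteriorAlgebra.map (j.addIsolated hx t) (c (j.preimage t)) := fun c t => rfl
  have f_notMem : ∀ c t, x ∉ t → f c t = 0 := fun c t ht => by
    rw [f_apply, hgen t ht, map_zero, zero_mul]
  have hcontract : ∀ t, x ∈ t → ∀ z, contract (H.functional t (X x))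
      (ExteriorAlgebra.ι (ZMod 2) (H.gen t x) * ExteriorAlgebra.map (j.addIsolated hx t) z) =
        ExteriorAlgebra.map (j.addIsolated hx t) z := fun t ht z => by
    rw [ExteriorAlgebra.contract_ι_mul, functional_gen (single_mem hx ht), val_single_self hx,
      one_smul, j.contract_map_addIsolated hx ht, mul_zero, sub_zero]
  have hcomm : ∀ c, H.differential (f c) = f (G.differential c) := by
    intro c
    funext t
    rw [differential_apply, j.sum_incoming_singleton]
    · rw [f_apply, differential_apply, map_sum, Finset.mul_sum]
      refine Finset.sum_congr rfl fun k _ => ?_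
      rw [f_apply, edge_ι_mul (flip_flip _ _), j.map_addIsolated_edge hx]
    · intro h
      rw [f_apply, edge_ι_mul (flip_flip _ _), hgen t ((hout t).1 h), map_zero, zero_mul]
  have hinj : Function.Injective f := by
    rw [injective_iff_map_eq_zero]
    intro c hc
    funext s
    obtain ⟨t, ht, rfl⟩ := j.exists_preimage_eq s
    refine j.map_addIsolated_injective hx t ?_
    rw [← hcontract t ht, ← f_apply c t, hc]
    exact (map_zero _).trans (map_zero _).symm
  have hrange : ∀ c, c ∈ LinearMap.range f ↔ (∀ t, x ∉ t → c t = 0) ∧ ∀ t, x ∈ t →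
      c t = ExteriorAlgebra.ι (ZMod 2) (H.gen t x) * contract (H.functional t (X x)) (c t) := by
    intro c
    constructor
    · rintro ⟨c, rfl⟩
      exact ⟨f_notMem c, fun t ht => by rw [f_apply c t, hcontract t ht]⟩
    · rintro ⟨h1, h2⟩
      have : ∀ s, ∃ w, ∀ t, x ∈ t → (h : j.preimage t = s) →
          ExteriorAlgebra.map (j.addIsolated hx t) (h ▸ w) =
            contract (H.functional t (X x)) (c t) := by
        intro s
        obtain ⟨t, ht, rfl⟩ := j.exists_preimage_eq s
        obtain ⟨w, hw⟩ := j.exists_map_addIsolated hx ht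
          (ExteriorAlgebra.contract_contract (H.functional t (X x)) (c t))
        refine ⟨w, fun t' ht' h => ?_⟩
        obtain rfl : t = t' := by
          ext k
          by_cases hk : k = x
          · subst hk; tauto
          · obtain ⟨i, rfl⟩ := (j.notMem_iff k).1 fun h => hk (Finset.mem_singleton.1 h)
            rw [← j.mem_preimage, ← j.mem_preimage, h]
        exact hw
      choose w hw using this
      refine ⟨w, funext fun t => ?_⟩
      by_cases ht : x ∈ t
      · rw [f_apply, h2 t ht]
        exact congr_arg _ (hw _ t ht rfl)
      · rw [f_notMem _ _ ht, h1 t ht]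
  refine LinearMap.Homology.nonempty_equiv_of_injective H.differential_comp_differential f hinj
    hcomm ⟨?_, fun c hc => ?_⟩
  · rintro _ ⟨c, rfl⟩
    exact ⟨_, (hcomm c).symm⟩
  · have : ∀ s, ∃ z : H.StateAlgebra s, (x ∉ s → z = 0) ∧ (x ∈ s →
        H.edge s (flip s x) x z = c (flip s x)) := by
      intro s
      by_cases hs : x ∈ s
      · obtain ⟨z, -, hz⟩ := exists_edge_eq (single_mem hx hs) (val_single_self hx)
          (c (flip s x))
        exact ⟨z, fun h => absurd hs h, fun _ => hz⟩
      · exact ⟨0, fun _ => rfl, fun h => absurd h hs⟩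
    choose b hb hb' using this
    have hm : ∀ t, x ∉ t → (c - H.differential b) t = 0 := by
      intro t ht
      rw [Pi.sub_apply, j.differential_eq_edge ((hout t).2 ht) fun s hs => hb s (mt hs.1 ht)]
      obtain ⟨s, rfl⟩ : ∃ s, t = flip s x := ⟨flip t x, (flip_flip t x).symm⟩
      rw [edge_congr x (flip_flip s x), hb' s (by rw [mem_flip] at ht; tauto), sub_self]
    refine ⟨b, (hrange _).2 ⟨hm, fun s hs => ?_⟩⟩
    have hdd : H.differential (c - H.differential b) = H.differential c := by
      rw [map_sub, show H.differential (H.differential b) = 0 from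
        LinearMap.congr_fun H.differential_comp_differential b, sub_zero]
    have ht : x ∉ flip s x := by rw [mem_flip]; tauto
    have hX := single_mem hx hs
    have h0 := ((hrange _).1 hc).1 _ ht
    rw [← hdd, j.differential_eq_edge ((hout _).2 ht) fun s hs => hm s (mt hs.1 ht),
      edge_congr x (flip_flip s x)] at h0
    rw [← sub_eq_zero]
    refine eq_zero_of_edge_eq_zero hX (val_single_self hx) ?_ ?_
    · rw [map_sub, ExteriorAlgebra.contract_ι_mul, ExteriorAlgebra.contract_contract, mul_zero,
        sub_zero, functional_gen hX, val_single_self hx, one_smul, sub_self]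
    · rw [map_sub, h0, edge_ι_mul rfl, hgen _ ht, map_zero, zero_mul, sub_zero]

end DeletionEmbedding

theorem Omega1.nonempty_Kh_equiv (h : G.Omega1 H) : Nonempty (G.Kh ≃ₗ[ZMod 2] H.Kh) := by
  obtain ⟨x, hadj, hf, hiso⟩ := h
  obtain ⟨j⟩ := hiso.nonempty_deletionEmbedding (T := {x}) (by simp)
  have hx : ∀ w, H.adjMatrix x w = 0 := by
    intro w
    by_cases hw : x = w
    · subst hw
      rw [adjMatrix_self, hf]
    · rw [adjMatrix_of_ne _ hw, if_neg (hadj w)]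
  rcases Int.units_eq_one_or (H.sign x) with hs | hs
  · exact j.nonempty_Kh_equiv_of_pos hx hs
  · exact j.nonempty_Kh_equiv_of_neg hx hs

end FirstMove
end LabeledGraph

namespace LabeledGraph

/-! ### The move `Ω₃`: matrices and correspondences of half cubes. -/

section ThirdMove

variable {V : Type u} [Fintype V] [DecidableEq V] {G H : LabeledGraph V} {u v w : V}

open ExteriorAlgebra (contract)

variable (G H u v w) in
/-- The third move in terms of adjacency matrices. -/
structure ThirdMove : Prop where
  huv : u ≠ v
  huw : u ≠ w
  hvw : v ≠ w
  row_left : ∀ k, G.adjMatrix u k = (X v + X w : V → ZMod 2) k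
  diag_v : G.adjMatrix v v = 0
  diag_w : G.adjMatrix w w = 0
  row_right : ∀ k, H.adjMatrix u k = G.adjMatrix v k + G.adjMatrix w k
  adjMatrix_eq : ∀ k l, k ≠ u → l ≠ u → H.adjMatrix k l = G.adjMatrix k l
  sign_left : ∀ k, k = u ∨ k = v ∨ k = w → G.sign k = -1
  sign_u : H.sign u = -1
  sign_v : H.sign v = 1
  sign_w : H.sign w = 1
  sign_eq : ∀ k, k ≠ u → k ≠ v → k ≠ w → H.sign k = G.sign k

lemma Omega3.exists_thirdMove (h : G.Omega3 H) : ∃ u v w, ThirdMove G H u v w := by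
  obtain ⟨u, v, w, hvw, hlab, hu, hu', hadj, hf, hsv, hsw, hs⟩ := h
  have huv : u ≠ v := by
    rintro rfl
    exact G.graph.loopless.irrefl u ((hu u).2 (Or.inl rfl))
  have huw : u ≠ w := by
    rintro rfl
    exact G.graph.loopless.irrefl u ((hu u).2 (Or.inr rfl))
  have hrow : ∀ k, G.adjMatrix u k = (X v + X w : V → ZMod 2) k := by
    intro k
    rw [Pi.add_apply, X_apply, X_apply]
    by_cases hk : u = k
    · subst hk
      rw [adjMatrix_self, (hlab u (Or.inl rfl)).1, if_neg huv, if_neg huw, add_zero]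
    · rw [adjMatrix_of_ne _ hk]
      simp only [hu]
      by_cases h1 : k = v
      · subst h1
        simp [hvw]
      · simp [h1]
  refine ⟨u, v, w, huv, huw, hvw, hrow, ?_, ?_, fun k => ?_, fun k l hk hl => ?_,
    fun k hk => (hlab k hk).2, ?_, hsv, hsw, fun k _ hkv hkw => hs k hkv hkw⟩
  · rw [adjMatrix_self, (hlab v (Or.inr (Or.inl rfl))).1]
  · rw [adjMatrix_self, (hlab w (Or.inr (Or.inr rfl))).1]
  -- At `k = u` the framing `0` of `u` agrees with `a_vu + a_wu = 1 + 1`.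
  · by_cases hk : u = k
    · subst hk
      rw [adjMatrix_self, hf, (hlab u (Or.inl rfl)).1, G.adjMatrix_symm v, G.adjMatrix_symm w, hrow,
        hrow, Pi.add_apply, Pi.add_apply, X_apply, X_apply, X_apply, X_apply, if_pos rfl,
        if_pos rfl, if_neg hvw, if_neg hvw.symm]
      rfl
    · have hA : ∀ a, a = v ∨ a = w → ∀ [Decidable (G.graph.Adj a k)],
          G.adjMatrix a k = if G.graph.Adj a k then 1 else 0 := by
        intro a ha _
        by_cases hak : a = k
        · subst hak
          rw [adjMatrix_self, (hlab a (Or.inr ha)).1, if_neg (G.graph.loopless.irrefl a)]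
        · rw [adjMatrix_of_ne _ hak]
          congr
      classical
      rw [adjMatrix_of_ne _ hk, hA v (Or.inl rfl), hA w (Or.inr rfl)]
      by_cases h1 : G.graph.Adj v k <;> by_cases h2 : G.graph.Adj w k <;>
        simp [hu', h1, h2, Xor]
      rfl
  · by_cases hkl : k = l
    · subst hkl
      rw [adjMatrix_self, adjMatrix_self, hf]
    · exact adjMatrix_congr hkl hkl (hadj k l hk hl)
  · rw [hs u huv huw, (hlab u (Or.inl rfl)).2]

/-- The states of `G` containing `w` and the states of `H` not containing `v` correspond to each
other, with `v` and `u` in `G` in the roles of `u` and `w` in `H`. -/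
structure HalfCubeRel (u v w : V) (s t : Finset V) : Prop where
  rest : ∀ k, k ≠ u → k ≠ v → k ≠ w → (k ∈ s ↔ k ∈ t)
  w_mem : w ∈ s
  v_notMem : v ∉ t
  v_iff : v ∈ s ↔ u ∈ t
  u_iff : u ∈ s ↔ w ∉ t

/-- The coordinates of the functionals of `G` in terms of those of `H`. -/
noncomputable def halfCubeMap (H : LabeledGraph V) (u v w : V) :
    (V → ZMod 2) →ₗ[ZMod 2] (V → ZMod 2) :=
  LinearMap.id + (LinearMap.proj u).smulRight (X u + X v + X w) +
    (LinearMap.proj w ∘ₗ H.adjMatrix.mulVecLin).smulRight (X u)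

lemma halfCubeMap_eq (p : V → ZMod 2) : H.halfCubeMap u v w p =
    p + p u • (X u + X v + X w) + H.adjMatrix.mulVec p w • X u := rfl

namespace ThirdMove

/-- The second correspondence of half cubes is the first one for the move with `v` and `w`
exchanged. -/
lemma symm (M : ThirdMove G H u v w) : ThirdMove G H u w v where
  huv := M.huw
  huw := M.huv
  hvw := M.hvw.symm
  row_left k := by rw [M.row_left, add_comm]
  diag_v := M.diag_w
  diag_w := M.diag_v
  row_right k := by rw [M.row_right, add_comm]
  adjMatrix_eq := M.adjMatrix_eq
  sign_left k hk := M.sign_left k (by tauto)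
  sign_u := M.sign_u
  sign_v := M.sign_w
  sign_w := M.sign_v
  sign_eq k h1 h2 h3 := M.sign_eq k h1 h3 h2

variable (M : ThirdMove G H u v w)

include M

lemma col_left {k : V} (hv : k ≠ v) (hw : k ≠ w) : G.adjMatrix k u = 0 := by
  rw [G.adjMatrix_symm, M.row_left, Pi.add_apply, X_apply, X_apply, if_neg hv, if_neg hw, add_zero]

lemma adjMatrix_v_u : G.adjMatrix v u = 1 := by
  rw [G.adjMatrix_symm, M.row_left, Pi.add_apply, X_apply, X_apply, if_pos rfl, if_neg M.hvw,
    add_zero]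

lemma adjMatrix_w_u : G.adjMatrix w u = 1 := M.symm.adjMatrix_v_u

lemma mulVec_left_u (p : V → ZMod 2) : G.adjMatrix.mulVec p u = p v + p w := by
  simp [mulVec_eq_sum, M.row_left, add_mul, Finset.sum_add_distrib, X_apply]

lemma mulVec_right {k : V} (hk : k ≠ u) (p : V → ZMod 2) : H.adjMatrix.mulVec p k =
    G.adjMatrix.mulVec p k + p u * (G.adjMatrix k u + G.adjMatrix k v + G.adjMatrix k w) := by
  have h : ∀ l, H.adjMatrix k l =
      G.adjMatrix k l + X u l * (G.adjMatrix k u + G.adjMatrix k v + G.adjMatrix k w) := by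
    intro l
    by_cases hl : l = u
    · subst hl
      rw [X_apply, if_pos rfl, one_mul, H.adjMatrix_symm, M.row_right, G.adjMatrix_symm v,
        G.adjMatrix_symm w, add_assoc (G.adjMatrix k l), ← add_assoc (G.adjMatrix k l),
        CharTwo.add_self_eq_zero, zero_add]
    · rw [X_apply, if_neg hl, zero_mul, add_zero, M.adjMatrix_eq k l hk hl]
  simp only [mulVec_eq_sum, h, add_mul, Finset.sum_add_distrib, X_apply, ite_mul, one_mul,
    zero_mul, Finset.sum_ite_eq', Finset.mem_univ, if_true]
  ring

/-- Row `u` of `H` is the sum of rows `v` and `w` of `H` itself; at column `u` this uses that `v`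
and `w` have framing `0`. -/
lemma mulVec_right_u (p : V → ZMod 2) :
    H.adjMatrix.mulVec p u = H.adjMatrix.mulVec p v + H.adjMatrix.mulVec p w := by
  rw [M.mulVec_right M.huv.symm, M.mulVec_right M.huw.symm, M.adjMatrix_v_u, M.adjMatrix_w_u,
    M.diag_v, M.diag_w, G.adjMatrix_symm w v]
  simp only [mulVec_eq_sum, M.row_right, add_mul, Finset.sum_add_distrib]
  generalize ∑ j, G.adjMatrix v j * p j = a
  generalize ∑ j, G.adjMatrix w j * p j = b
  generalize p u = c
  generalize G.adjMatrix v w = d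
  revert a b c d
  decide

/-- The columns `u`, `v`, `w` of `H` add up to zero. This kernel vector is the functional that
cancels states of `H`. -/
lemma mulVec_kernel (k : V) : H.adjMatrix.mulVec (X u + X v + X w) k = 0 := by
  rw [Matrix.mulVec_add, Matrix.mulVec_add, Pi.add_apply, Pi.add_apply, mulVec_X, mulVec_X,
    mulVec_X]
  by_cases hk : k = u
  · subst hk
    rw [M.row_right, M.row_right, M.row_right, M.adjMatrix_v_u, M.adjMatrix_w_u, M.diag_v,
      M.diag_w, G.adjMatrix_symm w v]
    generalize G.adjMatrix v w = d
    revert d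
    decide
  · rw [M.adjMatrix_eq k v hk M.huv.symm, M.adjMatrix_eq k w hk M.huw.symm, H.adjMatrix_symm,
      M.row_right, G.adjMatrix_symm v, G.adjMatrix_symm w]
    generalize G.adjMatrix k v = a
    generalize G.adjMatrix k w = b
    revert a b
    decide

lemma halfCubeMap_of_ne {k : V} (hu : k ≠ u) (hv : k ≠ v) (hw : k ≠ w) (p : V → ZMod 2) :
    H.halfCubeMap u v w p k = p k := by
  simp [halfCubeMap_eq, X_apply, hu, hv, hw]

/-- For `p v = 0` the pair at `u` in `G` is the pair at `w` in `H` with its members exchanged, and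
the pair at `v` in `G` is the pair at `u` in `H`. At `w` in `G` the second member is zero, as it
must be for `w ∈ s`. -/
lemma halfCubeMap_u (p : V → ZMod 2) : H.halfCubeMap u v w p u = H.adjMatrix.mulVec p w := by
  simp [halfCubeMap_eq, X_apply, M.huv, M.huw, CharTwo.add_self_eq_zero]

lemma halfCubeMap_v (p : V → ZMod 2) : H.halfCubeMap u v w p v = p v + p u := by
  simp [halfCubeMap_eq, X_apply, M.huv.symm, M.hvw]

lemma halfCubeMap_w (p : V → ZMod 2) : H.halfCubeMap u v w p w = p w + p u := by
  simp [halfCubeMap_eq, X_apply, M.huw.symm, M.hvw.symm]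

lemma mulVec_halfCubeMap {k : V} (hk : k ≠ u) (p : V → ZMod 2) :
    G.adjMatrix.mulVec (H.halfCubeMap u v w p) k =
      H.adjMatrix.mulVec p k + H.adjMatrix.mulVec p w * G.adjMatrix k u := by
  rw [M.mulVec_right hk, halfCubeMap_eq]
  simp only [Matrix.mulVec_add, Matrix.mulVec_smul, Pi.add_apply, Pi.smul_apply, mulVec_X,
    smul_eq_mul]

lemma mulVec_halfCubeMap_of_ne {k : V} (hu : k ≠ u) (hv : k ≠ v) (hw : k ≠ w)
    (p : V → ZMod 2) :
    G.adjMatrix.mulVec (H.halfCubeMap u v w p) k = H.adjMatrix.mulVec p k := by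
  rw [M.mulVec_halfCubeMap hu, M.col_left hv hw, mul_zero, add_zero]

lemma mulVec_halfCubeMap_u (p : V → ZMod 2) :
    G.adjMatrix.mulVec (H.halfCubeMap u v w p) u = p v + p w := by
  rw [M.mulVec_left_u, M.halfCubeMap_v, M.halfCubeMap_w, add_comm (p w), ← add_assoc,
    add_add_cancel_zmod_two]

lemma mulVec_halfCubeMap_v (p : V → ZMod 2) :
    G.adjMatrix.mulVec (H.halfCubeMap u v w p) v = H.adjMatrix.mulVec p u := by
  rw [M.mulVec_halfCubeMap M.huv.symm, M.adjMatrix_v_u, mul_one, M.mulVec_right_u]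

lemma mulVec_halfCubeMap_w (p : V → ZMod 2) :
    G.adjMatrix.mulVec (H.halfCubeMap u v w p) w = 0 := by
  rw [M.mulVec_halfCubeMap M.huw.symm, M.adjMatrix_w_u, mul_one, CharTwo.add_self_eq_zero]

lemma val_halfCubeMap_of_ne {k : V} (hu : k ≠ u) (hv : k ≠ v) (hw : k ≠ w) (p : V → ZMod 2) :
    G.val k (H.halfCubeMap u v w p) = H.val k p := by
  rw [val_apply, val_apply, M.halfCubeMap_of_ne hu hv hw, M.mulVec_halfCubeMap_of_ne hu hv hw]

lemma val_halfCubeMap_v {p : V → ZMod 2} (hp : p v = 0) :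
    G.val v (H.halfCubeMap u v w p) = H.val u p := by
  rw [val_apply, val_apply, M.halfCubeMap_v, M.mulVec_halfCubeMap_v, hp, zero_add]

lemma val_halfCubeMap_u {p : V → ZMod 2} (hp : p v = 0) :
    G.val u (H.halfCubeMap u v w p) = H.val w p := by
  rw [val_apply, val_apply, M.halfCubeMap_u, M.mulVec_halfCubeMap_u, hp, zero_add, add_comm]

/-- The maps for the two half cubes differ at the vertex `u` only. -/
lemma halfCubeMap_symm (p : V → ZMod 2) : H.halfCubeMap u w v p =
    H.halfCubeMap u v w p + H.adjMatrix.mulVec p u • X u := by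
  rw [halfCubeMap_eq, halfCubeMap_eq, M.mulVec_right_u, add_right_comm (X u) (X w), add_smul]
  generalize p u • (X u + X v + X w : V → ZMod 2) = a
  funext k
  simp only [Pi.add_apply, Pi.smul_apply, smul_eq_mul]
  have h : ∀ b c d e : ZMod 2, d + e + b = d + e + c + (b + c) := by decide
  exact h _ _ _ _

lemma bijOn {s t : Finset V} (h : HalfCubeRel u v w s t) :
    Set.BijOn (H.halfCubeMap u v w) (H.dualCoords t) (G.dualCoords s) := by
  refine ⟨fun p hp => ⟨fun k hk => ?_, fun k hk => ?_⟩, fun p hp p' hp' h0 => ?_, fun q hq => ?_⟩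
  · by_cases hu : k = u
    · subst hu
      rw [M.halfCubeMap_u]
      exact hp.2 w (not_not.1 fun hw => hk (h.u_iff.2 hw))
    by_cases hv : k = v
    · subst hv
      rw [M.halfCubeMap_v, hp.1 k h.v_notMem, hp.1 u (mt h.v_iff.2 hk), add_zero]
    by_cases hw : k = w
    · subst hw
      exact absurd h.w_mem hk
    rw [M.halfCubeMap_of_ne hu hv hw]
    exact hp.1 k (mt (h.rest k hu hv hw).2 hk)
  · by_cases hu : k = u
    · subst hu
      rw [M.mulVec_halfCubeMap_u, hp.1 v h.v_notMem, hp.1 w (h.u_iff.1 hk), add_zero]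
    by_cases hv : k = v
    · subst hv
      rw [M.mulVec_halfCubeMap_v]
      exact hp.2 u (h.v_iff.1 hk)
    by_cases hw : k = w
    · subst hw
      exact M.mulVec_halfCubeMap_w p
    rw [M.mulVec_halfCubeMap_of_ne hu hv hw]
    exact hp.2 k ((h.rest k hu hv hw).1 hk)
  · have hv : p v = p' v := (hp.1 v h.v_notMem).trans (hp'.1 v h.v_notMem).symm
    have hu : p u = p' u := by
      have := congr_fun h0 v
      rwa [M.halfCubeMap_v, M.halfCubeMap_v, hv, add_right_inj] at this
    funext k
    by_cases hku : k = u
    · rwa [hku]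
    by_cases hkv : k = v
    · rwa [hkv]
    by_cases hkw : k = w
    · subst hkw
      have := congr_fun h0 k
      rwa [M.halfCubeMap_w, M.halfCubeMap_w, hu, add_left_inj] at this
    · have := congr_fun h0 k
      rwa [M.halfCubeMap_of_ne hku hkv hkw, M.halfCubeMap_of_ne hku hkv hkw] at this
  -- The inverse is forced: for `p v = 0`, the values of `halfCubeMap` at `v` and `u` give `p u = q
  -- v` and `(A_H p)_w = q u`.
  · set p : V → ZMod 2 := q + q u • X u + q v • (X u + X v + X w) with hp
    have pu : p u = q v := by
      simp [hp, X_apply, M.huv, M.huw, CharTwo.add_self_eq_zero]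
    have pv : p v = 0 := by
      simp [hp, X_apply, M.huv.symm, M.hvw, CharTwo.add_self_eq_zero]
    have pw : p w = q w + q v := by
      simp [hp, X_apply, M.huw.symm, M.hvw.symm]
    have pk : ∀ k, k ≠ u → k ≠ v → k ≠ w → p k = q k := fun k hu hv hw => by
      simp [hp, X_apply, hu, hv, hw]
    have hmul : ∀ k, k ≠ u →
        H.adjMatrix.mulVec p k = G.adjMatrix.mulVec q k + q u * G.adjMatrix k u := by
      intro k hk
      rw [M.mulVec_right hk, pu, hp]
      simp only [Matrix.mulVec_add, Matrix.mulVec_smul, Pi.add_apply, Pi.smul_apply, mulVec_X,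
        smul_eq_mul]
      exact add_add_cancel_zmod_two _ _
    have mw : H.adjMatrix.mulVec p w = q u := by
      rw [hmul w M.huw.symm, hq.2 w h.w_mem, M.adjMatrix_w_u, mul_one, zero_add]
    have mu : H.adjMatrix.mulVec p u = G.adjMatrix.mulVec q v := by
      rw [M.mulVec_right_u, mw, hmul v M.huv.symm, M.adjMatrix_v_u, mul_one,
        add_add_cancel_zmod_two]
    refine ⟨p, ⟨fun k hk => ?_, fun k hk => ?_⟩, ?_⟩
    · by_cases hku : k = u
      · subst hku
        rw [pu]
        exact hq.1 v (mt h.v_iff.1 hk)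
      by_cases hkv : k = v
      · rw [hkv, pv]
      by_cases hkw : k = w
      · subst hkw
        have := hq.2 u (h.u_iff.2 hk)
        rwa [M.mulVec_left_u, add_comm, ← pw] at this
      rw [pk k hku hkv hkw]
      exact hq.1 k (mt (h.rest k hku hkv hkw).1 hk)
    · by_cases hku : k = u
      · subst hku
        rw [mu]
        exact hq.2 v (h.v_iff.2 hk)
      by_cases hkv : k = v
      · subst hkv
        exact absurd hk h.v_notMem
      by_cases hkw : k = w
      · subst hkw
        rw [mw]
        exact hq.1 u fun hu => h.u_iff.1 hu hk
      rw [hmul k hku, M.col_left hkv hkw, mul_zero, add_zero]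
      exact hq.2 k ((h.rest k hku hkv hkw).2 hk)
    · funext k
      by_cases hku : k = u
      · rw [hku, M.halfCubeMap_u, mw]
      by_cases hkv : k = v
      · rw [hkv, M.halfCubeMap_v, pv, pu, zero_add]
      by_cases hkw : k = w
      · rw [hkw, M.halfCubeMap_w, pw, pu, add_add_cancel_zmod_two]
      · rw [M.halfCubeMap_of_ne hku hkv hkw, pk k hku hkv hkw]

lemma halfCubeMap_mem {s t : Finset V} (h : HalfCubeRel u v w s t) :
    ∀ p ∈ H.dualCoords t, H.halfCubeMap u v w p ∈ G.dualCoords s :=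
  fun _ hp => (M.bijOn h).mapsTo hp

omit M in
lemma _root_.LabeledGraph.HalfCubeRel.flip_rest {s t : Finset V} (h : HalfCubeRel u v w s t)
    {k : V} (hu : k ≠ u) (hv : k ≠ v) (hw : k ≠ w) :
    HalfCubeRel u v w (flip s k) (flip t k) := by
  obtain ⟨h1, h2, h3, h4, h5⟩ := h
  refine ⟨fun i hiu hiv hiw => ?_, ?_, ?_, ?_, ?_⟩
  · have := h1 i hiu hiv hiw
    rw [mem_flip, mem_flip, this]
  all_goals
    simp only [mem_flip]
    grind

lemma flip_v_u {s t : Finset V} (h : HalfCubeRel u v w s t) :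
    HalfCubeRel u v w (flip s v) (flip t u) := by
  obtain ⟨h1, h2, h3, h4, h5⟩ := h
  have := M.huv
  have := M.huw
  have := M.hvw
  refine ⟨fun i hiu hiv hiw => ?_, ?_, ?_, ?_, ?_⟩
  · have := h1 i hiu hiv hiw
    simp only [mem_flip]
    tauto
  all_goals
    simp only [mem_flip]
    grind

lemma flip_u_w {s t : Finset V} (h : HalfCubeRel u v w s t) :
    HalfCubeRel u v w (flip s u) (flip t w) := by
  obtain ⟨h1, h2, h3, h4, h5⟩ := h
  have := M.huv
  have := M.huw
  have := M.hvw
  refine ⟨fun i hiu hiv hiw => ?_, ?_, ?_, ?_, ?_⟩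
  · have := h1 i hiu hiv hiw
    simp only [mem_flip]
    tauto
  all_goals
    simp only [mem_flip]
    grind

lemma map_transfer_edge {s t s' t' : Finset V} {k k' : V} (h : HalfCubeRel u v w s t)
    (h' : HalfCubeRel u v w s' t') (hs : flip s' k = s) (ht : flip t' k' = t)
    (hk : ∀ p : V → ZMod 2, p v = 0 → G.val k (H.halfCubeMap u v w p) = H.val k' p)
    (z : G.StateAlgebra s') :
    ExteriorAlgebra.map (transfer s t _ (M.halfCubeMap_mem h)) (G.edge s' s k z) =
      H.edge t' t k' (ExteriorAlgebra.map (transfer s' t' _ (M.halfCubeMap_mem h')) z) :=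
  LabeledGraph.map_transfer_edge _ hs ht _ _ (M.bijOn h').surjOn
    (fun p hp => hk p (hp.1 v h'.v_notMem)) (fun p hp => hk p (hp.1 v h.v_notMem)) z

end ThirdMove

end ThirdMove
end LabeledGraph

namespace LabeledGraph

/-! ### The move `Ω₃`: cancellation and matching of differentials. -/

section ThirdMoveChain

variable {V : Type u} [Fintype V] [DecidableEq V] {G H : LabeledGraph V} {u v w : V}

open ExteriorAlgebra (contract)

lemma agreeOn_triple {s a : Finset V} : AgreeOn {u, v, w} s a ↔
    (u ∈ s ↔ u ∈ a) ∧ (v ∈ s ↔ v ∈ a) ∧ (w ∈ s ↔ w ∈ a) := by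
  simp only [AgreeOn, Finset.mem_insert, Finset.mem_singleton, forall_eq_or_imp, forall_eq]

namespace HalfCubeRel

lemma exists_left (huv : u ≠ v) (huw : u ≠ w) (hvw : v ≠ w) {t : Finset V} (ht : v ∉ t) :
    ∃ s, HalfCubeRel u v w s t := by
  refine ⟨Finset.univ.filter fun k =>
      (k = u ∧ w ∉ t) ∨ (k = v ∧ u ∈ t) ∨ k = w ∨ (k ≠ u ∧ k ≠ v ∧ k ∈ t),
    fun k h1 h2 h3 => ?_, ?_, ht, ?_, ?_⟩ <;>
    simp only [Finset.mem_filter, Finset.mem_univ, true_and] <;> grind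

lemma exists_right (huv : u ≠ v) (huw : u ≠ w) (hvw : v ≠ w) {s : Finset V} (hs : w ∈ s) :
    ∃ t, HalfCubeRel u v w s t := by
  refine ⟨Finset.univ.filter fun k =>
      (k = u ∧ v ∈ s) ∨ (k = w ∧ u ∉ s) ∨ (k ≠ u ∧ k ≠ v ∧ k ≠ w ∧ k ∈ s),
    fun k h1 h2 h3 => ?_, hs, ?_, ?_, ?_⟩ <;>
    simp only [Finset.mem_filter, Finset.mem_univ, true_and] <;> grind

lemma right_unique {s t t' : Finset V} (h : HalfCubeRel u v w s t)
    (h' : HalfCubeRel u v w s t') : t = t' := by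
  ext k
  by_cases hu : k = u
  · subst hu
    rw [← h.v_iff, h'.v_iff]
  by_cases hv : k = v
  · subst hv
    exact iff_of_false h.v_notMem h'.v_notMem
  by_cases hw : k = w
  · subst hw
    rw [← not_iff_not, ← h.u_iff, h'.u_iff]
  · rw [← h.rest k hu hv hw, h'.rest k hu hv hw]

lemma left_unique {s s' t : Finset V} (h : HalfCubeRel u v w s t)
    (h' : HalfCubeRel u v w s' t) : s = s' := by
  ext k
  by_cases hu : k = u
  · subst hu
    rw [h.u_iff, h'.u_iff]
  by_cases hv : k = v
  · subst hv
    rw [h.v_iff, h'.v_iff]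
  by_cases hw : k = w
  · subst hw
    exact iff_of_true h.w_mem h'.w_mem
  · rw [h.rest k hu hv hw, h'.rest k hu hv hw]

end HalfCubeRel

lemma transfer_congr {s t : Finset V} {Φ Ψ : (V → ZMod 2) →ₗ[ZMod 2] (V → ZMod 2)}
    (hΦ : ∀ p ∈ H.dualCoords t, Φ p ∈ G.dualCoords s)
    (hΨ : ∀ p ∈ H.dualCoords t, Ψ p ∈ G.dualCoords s)
    (h : ∀ p ∈ H.dualCoords t, Φ p = Ψ p) : transfer s t Φ hΦ = transfer s t Ψ hΨ :=
  linearMap_ext_functional fun p hp => by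
    rw [functional_comp_transfer hp, functional_comp_transfer hp, h p hp]

lemma sum_incoming_triple (huv : u ≠ v) (huw : u ≠ w) (hvw : v ≠ w) {A : Type*}
    [AddCommMonoid A] (t : Finset V) (f : V → A) :
    ∑ k with ¬ G.IsOutgoing t k, f k =
      ((if G.IsOutgoing t u then 0 else f u) + ((if G.IsOutgoing t v then 0 else f v) +
        if G.IsOutgoing t w then 0 else f w)) +
      ∑ k ∈ ({u, v, w} : Finset V)ᶜ, if G.IsOutgoing t k then 0 else f k := by
  rw [Finset.sum_filter, ← Finset.sum_add_sum_compl ({u, v, w} : Finset V),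
    Finset.sum_insert (by simp [huv, huw]), Finset.sum_pair hvw]
  simp only [ite_not]

namespace ThirdMove

variable (M : ThirdMove G H u v w)

include M

/-- As `u` is adjacent to `v` and `w` only, `X u` is a functional at every state that contains `u`
and neither `v` nor `w`. All three signs are `-1`, so the path is `∅`, `{u}`, `{u, v}` in the cube
of `u`, `v`, `w`. -/
lemma cancellation_left : G.Cancellation {u, v, w} ∅ u v (X u) := by
  have hval : ∀ k, G.val k (X u) = (if k = u then 1 else 0) + G.adjMatrix k u := fun k => by
    rw [val_apply, mulVec_X, X_apply]
  have huu : G.adjMatrix u u = 0 := by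
    rw [M.row_left, Pi.add_apply, X_apply, X_apply, if_neg M.huv, if_neg M.huw, add_zero]
  refine ⟨by simp, by simp, M.huv, fun i hi => ?_, fun s hs => ⟨fun k hk => ?_, fun k hk => ?_⟩,
    ?_, ?_, fun i hi => ?_⟩
  · refine Or.inl ⟨M.sign_left i ?_, Finset.notMem_empty i⟩
    simpa using hi
  · have h := (agreeOn_triple.1 hs).1
    rw [X_apply, if_neg]
    rintro rfl
    simp [mem_flip] at h
    exact hk h
  · have h := agreeOn_triple.1 hs
    have h1 := M.huv.symm
    have h2 := M.huw.symm
    simp [mem_flip, h1, h2] at h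
    rw [mulVec_X]
    refine M.col_left ?_ ?_ <;> rintro rfl <;> tauto
  · rw [hval, if_pos rfl, huu, add_zero]
  · rw [hval, if_neg M.huv.symm, M.adjMatrix_v_u, zero_add]
  · simp only [Finset.mem_insert, Finset.mem_singleton, not_or] at hi
    rw [hval, if_neg hi.1, M.col_left hi.2.1 hi.2.2, add_zero]

/-- The kernel vector is a functional at every state containing `u`, `v` and `w`. Arrows insert `u`
and remove `v` and `w`, so the path is `{v, w}`, `{u, v, w}`, `{u, w}`. -/
lemma cancellation_right : H.Cancellation {u, v, w} {v, w} u v (X u + X v + X w) := by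
  have h1 := M.huv
  have h2 := M.huw
  have h3 := M.hvw
  have hval : ∀ k, H.val k (X u + X v + X w) = (X u + X v + X w : V → ZMod 2) k := fun k => by
    rw [val_apply, M.mulVec_kernel, add_zero]
  refine ⟨by simp, by simp, M.huv, fun i hi => ?_,
    fun s hs => ⟨fun k hk => ?_, fun k _ => M.mulVec_kernel k⟩, ?_, ?_, fun i hi => ?_⟩
  · simp only [Finset.mem_insert, Finset.mem_singleton] at hi
    rcases hi with rfl | rfl | rfl
    · exact Or.inl ⟨M.sign_u, by simp [h1, h2]⟩
    · exact Or.inr ⟨M.sign_v, by simp⟩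
    · exact Or.inr ⟨M.sign_w, by simp⟩
  · have h := agreeOn_triple.1 hs
    simp [mem_flip, h1, h2, h1.symm, h2.symm] at h
    have hu : k ≠ u := by rintro rfl; tauto
    have hv : k ≠ v := by rintro rfl; tauto
    have hw : k ≠ w := by rintro rfl; tauto
    simp [X_apply, hu, hv, hw]
  · simp [hval, X_apply, h1, h2]
  · simp [hval, X_apply, h1.symm, h3]
  · simp only [Finset.mem_insert, Finset.mem_singleton, not_or] at hi
    simp [hval, X_apply, hi]

/-- The components of two chains at corresponding states correspond to each other. -/
def Matches (c : G.Chain) (c' : H.Chain) {s t : Finset V} (h : HalfCubeRel u v w s t) : Prop :=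
  c' t = ExteriorAlgebra.map (transfer s t _ (M.halfCubeMap_mem h)) (c s)

lemma isOutgoing_left {k : V} (hk : k = u ∨ k = v ∨ k = w) (s : Finset V) :
    G.IsOutgoing s k ↔ k ∉ s := by
  unfold IsOutgoing
  rw [M.sign_left k hk]
  simp

lemma isOutgoing_right_u (t : Finset V) : H.IsOutgoing t u ↔ u ∉ t := by
  unfold IsOutgoing
  rw [M.sign_u]
  simp

lemma isOutgoing_right_v (t : Finset V) : H.IsOutgoing t v ↔ v ∈ t := by
  unfold IsOutgoing
  rw [M.sign_v]
  simp

lemma isOutgoing_right_w (t : Finset V) : H.IsOutgoing t w ↔ w ∈ t := M.symm.isOutgoing_right_v t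

/-- Differentials match if their contributions at the three vertices do. -/
lemma matches_differential {c : G.Chain} {c' : H.Chain} {s t : Finset V}
    (h : HalfCubeRel u v w s t)
    (hrest : ∀ k (hu : k ≠ u) (hv : k ≠ v) (hw : k ≠ w), M.Matches c c' (h.flip_rest hu hv hw))
    (hT : ((if u ∈ t then H.edge (flip t u) t u (c' (flip t u)) else 0) +
        ((if v ∈ t then 0 else H.edge (flip t v) t v (c' (flip t v))) +
          if w ∈ t then 0 else H.edge (flip t w) t w (c' (flip t w)))) =
      ExteriorAlgebra.map (transfer s t _ (M.halfCubeMap_mem h))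
        ((if u ∈ s then G.edge (flip s u) s u (c (flip s u)) else 0) +
          ((if v ∈ s then G.edge (flip s v) s v (c (flip s v)) else 0) +
            if w ∈ s then G.edge (flip s w) s w (c (flip s w)) else 0))) :
    M.Matches (G.differential c) (H.differential c') h := by
  rw [Matches, differential_apply, differential_apply, sum_incoming_triple M.huv M.huw M.hvw,
    sum_incoming_triple M.huv M.huw M.hvw, map_add]
  simp only [M.isOutgoing_right_u, M.isOutgoing_right_v, M.isOutgoing_right_w,
    M.isOutgoing_left (Or.inl rfl), M.isOutgoing_left (Or.inr (Or.inl rfl)),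
    M.isOutgoing_left (Or.inr (Or.inr rfl)), ite_not]
  rw [hT, map_sum]
  congr 1
  refine Finset.sum_congr rfl fun k hk => ?_
  simp only [Finset.mem_compl, Finset.mem_insert, Finset.mem_singleton, not_or] at hk
  obtain ⟨hu, hv, hw⟩ := hk
  have hout : H.IsOutgoing t k ↔ G.IsOutgoing s k := by
    unfold IsOutgoing
    rw [M.sign_eq k hu hv hw, h.rest k hu hv hw]
  by_cases hk : G.IsOutgoing s k
  · rw [if_pos hk, if_pos (hout.2 hk), map_zero]
  · rw [if_neg hk, if_neg (mt hout.1 hk), M.map_transfer_edge h (h.flip_rest hu hv hw)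
      (flip_flip s k) (flip_flip t k) fun p _ => M.val_halfCubeMap_of_ne hu hv hw p]
    exact congr_arg _ (hrest k hu hv hw)

lemma map_edge_u {c : G.Chain} {c' : H.Chain} {s t : Finset V} (h : HalfCubeRel u v w s t)
    (hm : M.Matches c c' (M.flip_u_w h)) :
    ExteriorAlgebra.map (transfer s t _ (M.halfCubeMap_mem h))
      (G.edge (flip s u) s u (c (flip s u))) = H.edge (flip t w) t w (c' (flip t w)) := by
  rw [M.map_transfer_edge h (M.flip_u_w h) (flip_flip s u) (flip_flip t w) fun p hp =>
    M.val_halfCubeMap_u hp]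
  exact congr_arg _ hm.symm

lemma map_edge_v {c : G.Chain} {c' : H.Chain} {s t : Finset V} (h : HalfCubeRel u v w s t)
    (hm : M.Matches c c' (M.flip_v_u h)) :
    ExteriorAlgebra.map (transfer s t _ (M.halfCubeMap_mem h))
      (G.edge (flip s v) s v (c (flip s v))) = H.edge (flip t u) t u (c' (flip t u)) := by
  rw [M.map_transfer_edge h (M.flip_v_u h) (flip_flip s v) (flip_flip t u) fun p hp =>
    M.val_halfCubeMap_v hp]
  exact congr_arg _ hm.symm

/-- The zigzag through the cancelled states of `G`. -/
lemma map_edge_w {c : G.Chain} {c' : H.Chain}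
    (hc : c ∈ G.cancelCore {u, v, w} ∅ u v (X u)) {s t : Finset V}
    (h : HalfCubeRel u v w s t) (hu : u ∉ t) (hw : w ∉ t)
    (hm : ∀ s' (h' : HalfCubeRel u w v s' (flip t v)), M.symm.Matches c c' h') :
    ExteriorAlgebra.map (transfer s t _ (M.halfCubeMap_mem h))
      (G.edge (flip s w) s w (c (flip s w))) = H.edge (flip t v) t v (c' (flip t v)) := by
  have C := M.cancellation_left
  have d1 := M.huv
  have d2 := M.huw
  have d3 := M.hvw
  have hus : u ∈ s := h.u_iff.2 hw
  have hvs : v ∉ s := mt h.v_iff.1 hu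
  have hws := h.w_mem
  have hvt := h.v_notMem
  have hmid : AgreeOn {u, v, w} (flip s w) (flip ∅ u) := by
    rw [agreeOn_triple]
    simp only [mem_flip, Finset.notMem_empty]
    grind
  have hsink := hmid.flip v
  -- The sink `{u, v}` of `G` is cancelled, but the second correspondence still identifies its space
  -- with that of `t`.
  have h2 : HalfCubeRel u w v (flip (flip s w) v) t := by
    refine ⟨fun k h1 h2 h3 => ?_, ?_, hw, ?_, ?_⟩
    · have := h.rest k h1 h3 h2
      simp only [mem_flip]
      tauto
    all_goals
      simp only [mem_flip]
      grind
  have hp := C.mem_dualCoords _ hmid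
  have hvw : G.val w (X u) = 1 := by
    rw [val_apply, mulVec_X, X_apply, if_neg d2.symm, M.adjMatrix_w_u, zero_add]
  have hgen := gen_ne_zero_of_val hp hvw
  have hle := G.dualCoords_flip_le_of_gen_ne_zero hgen
  rw [flip_flip] at hle
  -- The middle component is the lift of its image at the sink, and `edge_middle` equates that image
  -- with the contribution of the corner `{v}`.
  rw [← M.symm.map_edge_u h2 (hm _ _), ← C.edge_middle hc hsink,
    edge_congr v (flip_flip (flip s w) v), edge_of_gen_ne_zero (flip_flip s w) hgen hle]
  conv_lhs => rw [eq_map_transfer_edge hp C.val_y (hc.2.1 _ hmid)]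
  rw [ExteriorAlgebra.map_map_apply, ExteriorAlgebra.map_map_apply]
  congr 2
  -- On functionals the lift is `q ↦ q + q(x_v) X u`. For `q = halfCubeMap p` one has `q(x_v) = (A_H
  -- p)_u`, so the added term is the difference of the two half-cube maps.
  refine linearMap_ext_functional fun p hpt => ?_
  have hpu : p u = 0 := hpt.1 u hu
  have hpv : p v = 0 := hpt.1 v hvt
  have hq := (M.bijOn h).mapsTo hpt
  rw [← LinearMap.comp_assoc, ← LinearMap.comp_assoc, functional_comp_transfer hpt,
    functional_comp_quot hle hq, functional_comp_transfer (hle hq), functional_comp_transfer hpt,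
    LinearMap.add_apply, LinearMap.id_apply, LinearMap.smulRight_apply, M.val_halfCubeMap_v hpv,
    val_apply, hpu, zero_add, ← M.halfCubeMap_symm]

/-- The zigzag through the cancelled states of `H`. -/
lemma map_edge_w_symm {c : G.Chain} {c' : H.Chain}
    (hc' : c' ∈ H.cancelCore {u, v, w} {v, w} u v (X u + X v + X w)) {s t : Finset V}
    (h : HalfCubeRel u w v s t) (hu : u ∈ t) (hv : v ∈ t)
    (hm : ∀ t' (h' : HalfCubeRel u v w (flip s v) t'), M.Matches c c' h') :
    ExteriorAlgebra.map (transfer s t _ (M.symm.halfCubeMap_mem h))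
      (G.edge (flip s v) s v (c (flip s v))) = H.edge (flip t w) t w (c' (flip t w)) := by
  have C := M.cancellation_right
  have d1 := M.huv
  have d2 := M.huw
  have d3 := M.hvw
  have hus : u ∉ s := fun h0 => h.u_iff.1 h0 hv
  have hws : w ∈ s := h.v_iff.2 hu
  have hvs := h.w_mem
  have hwt := h.v_notMem
  have hmid : AgreeOn {u, v, w} (flip t w) (flip {v, w} u) := by
    rw [agreeOn_triple]
    simp only [mem_flip, Finset.mem_insert, Finset.mem_singleton]
    grind
  have hsink := hmid.flip v
  -- The cancelled sink `{u, w}` of `H` corresponds to the corner `{v, w}` of `G` under the first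
  -- correspondence.
  have h2 : HalfCubeRel u v w s (flip (flip t w) v) := by
    refine ⟨fun k h1 h2 h3 => ?_, hws, ?_, ?_, ?_⟩
    · have := h.rest k h1 h3 h2
      simp only [mem_flip]
      tauto
    all_goals
      simp only [mem_flip]
      grind
  have h3 : HalfCubeRel u v w (flip s v) (flip (flip (flip t w) v) u) := M.flip_v_u h2
  have hp := C.mem_dualCoords _ hmid
  have hvalw : H.val w (X u + X v + X w) = 1 := by
    rw [val_apply, M.mulVec_kernel, add_zero]
    simp [X_apply, d2.symm, d3.symm]
  have hgen := gen_ne_zero_of_val hp hvalw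
  have hle := H.dualCoords_flip_le_of_gen_ne_zero hgen
  rw [flip_flip] at hle
  have hedge := C.edge_middle hc' hsink
  rw [edge_congr v (flip_flip (flip t w) v), ← M.map_edge_v h2 (hm _ _)] at hedge
  rw [edge_of_gen_ne_zero (flip_flip t w) hgen hle,
    eq_map_transfer_edge hp C.val_y (hc'.2.1 _ hmid), hedge, ExteriorAlgebra.map_map_apply,
    ExteriorAlgebra.map_map_apply]
  congr 2
  refine linearMap_ext_functional fun p hpt => ?_
  have hmu : H.adjMatrix.mulVec p u = 0 := hpt.2 u hu
  have hq := mem_dualCoords_flip_add hp C.val_y p (hle hpt)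
  -- Here the lift from the sink adds a multiple of the kernel vector, and the half-cube map does
  -- not see it.
  have hker : H.halfCubeMap u v w (X u + X v + X w) = 0 := by
    have hone : (X u + X v + X w : V → ZMod 2) u = 1 := by simp [X_apply, d1, d2]
    rw [halfCubeMap_eq, M.mulVec_kernel, zero_smul, add_zero, hone, one_smul]
    funext k
    exact CharTwo.add_self_eq_zero ((X u + X v + X w : V → ZMod 2) k)
  rw [← LinearMap.comp_assoc, ← LinearMap.comp_assoc, functional_comp_quot hle hpt,
    functional_comp_transfer (hle hpt), functional_comp_transfer hq,
    functional_comp_transfer hpt, LinearMap.add_apply, LinearMap.id_apply,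
    LinearMap.smulRight_apply, map_add, map_smul, hker, smul_zero, add_zero, M.halfCubeMap_symm,
    hmu, zero_smul, add_zero]

/-- The correspondences agree where both are defined. -/
lemma transfer_symm {s t : Finset V} (h : HalfCubeRel u v w s t) (h' : HalfCubeRel u w v s t)
    (hu : u ∈ t) : transfer s t _ (M.halfCubeMap_mem h) =
      transfer s t _ (M.symm.halfCubeMap_mem h') := by
  refine transfer_congr _ _ fun p hp => ?_
  have hp' : H.adjMatrix.mulVec p u = 0 := hp.2 u hu
  rw [M.halfCubeMap_symm, hp', zero_smul, add_zero]

lemma matches_differential_left {c : G.Chain} {c' : H.Chain}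
    (hc : c ∈ G.cancelCore {u, v, w} ∅ u v (X u))
    (hc' : c' ∈ H.cancelCore {u, v, w} {v, w} u v (X u + X v + X w))
    (hα : ∀ s t (h : HalfCubeRel u v w s t), ¬ (u ∈ t ∧ w ∈ t) → M.Matches c c' h)
    (hβ : ∀ s t (h : HalfCubeRel u w v s t), v ∈ t → M.symm.Matches c c' h)
    {s t : Finset V} (h : HalfCubeRel u v w s t) (ht : ¬ (u ∈ t ∧ w ∈ t)) :
    M.Matches (G.differential c) (H.differential c') h := by
  have d1 := M.huv
  have d2 := M.huw
  have d3 := M.hvw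
  have hvt := h.v_notMem
  have hws := h.w_mem
  refine M.matches_differential h (fun k hu hv hw => hα _ _ _ ?_) ?_
  · simp only [mem_flip]
    grind
  by_cases hwt : w ∈ t
  -- Corner `{w}` on both sides: the incoming edges at the three vertices start at the cancelled
  -- sources.
  · have hut : u ∉ t := fun hu => ht ⟨hu, hwt⟩
    have hus : u ∉ s := fun h0 => h.u_iff.1 h0 hwt
    have hvs : v ∉ s := mt h.v_iff.1 hut
    have e1 : c' (flip t v) = 0 := hc'.1 _ (agreeOn_triple.2 (by
      simp [mem_flip, d1, d2, d3, d3.symm, hut, hvt, hwt]))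
    have e2 : c (flip s w) = 0 := hc.1 _ (agreeOn_triple.2 (by
      simp [mem_flip, d2, d3, hus, hvs, hws]))
    rw [if_neg hut, if_neg hvt, if_pos hwt, if_neg hus, if_neg hvs, if_pos hws, e1, e2]
    simp only [map_zero, add_zero]
  have hus : u ∈ s := h.u_iff.2 hwt
  by_cases hut : u ∈ t
  -- Corner `{u, v, w}` of `G` and `{u}` of `H`: one incoming edge on each side starts at a
  -- cancelled sink. The other two are matched by one correspondence each, which is consistent by
  -- `transfer_symm`.
  · have hvs : v ∈ s := h.v_iff.2 hut
    have e1 : c' (flip t w) = 0 := (hc'.2.2 _ (agreeOn_triple.2 (by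
      simp [mem_flip, d1, d2, d3, d1.symm, d2.symm, d3.symm, hut, hvt, hwt]))).1
    have e2 : c (flip s w) = 0 := (hc.2.2 _ (agreeOn_triple.2 (by
      simp [mem_flip, d1, d2, d3, d1.symm, d2.symm, d3.symm, hus, hvs, hws]))).1
    have h' : HalfCubeRel u w v s t :=
      ⟨fun k h1 h2 h3 => h.rest k h1 h3 h2, hvs, hwt, iff_of_true hws hut, iff_of_true hus hvt⟩
    have e3 := M.symm.map_edge_u h' (hβ _ _ _ (mem_flip.2 (Or.inr ⟨rfl, hvt⟩)))
    rw [← M.transfer_symm h h' hut] at e3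
    have e4 := M.map_edge_v h (hα _ _ _ (by simp only [mem_flip]; grind))
    rw [if_pos hut, if_neg hvt, if_neg hwt, if_pos hus, if_pos hvs, if_pos hws, e1, e2, map_zero,
      map_zero, add_zero, add_zero, map_add, e3, e4, add_comm]
  -- Corner `{u, w}` of `G` and `∅` of `H`: the edge from `{v}` in `H` is matched by the zigzag in
  -- `G`.
  · have hvs : v ∉ s := mt h.v_iff.1 hut
    rw [if_neg hut, if_neg hvt, if_neg hwt, if_pos hus, if_neg hvs, if_pos hws, zero_add,
      zero_add, map_add, M.map_edge_u h, M.map_edge_w hc h hut hwt, add_comm]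
    · exact fun s' h' => hβ _ _ _ (mem_flip.2 (Or.inr ⟨rfl, hvt⟩))
    · refine hα _ _ _ ?_
      simp only [mem_flip]
      grind

lemma matches_differential_right {c : G.Chain} {c' : H.Chain}
    (hc : c ∈ G.cancelCore {u, v, w} ∅ u v (X u))
    (hc' : c' ∈ H.cancelCore {u, v, w} {v, w} u v (X u + X v + X w))
    (hα : ∀ s t (h : HalfCubeRel u v w s t), ¬ (u ∈ t ∧ w ∈ t) → M.Matches c c' h)
    (hβ : ∀ s t (h : HalfCubeRel u w v s t), v ∈ t → M.symm.Matches c c' h)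
    {s t : Finset V} (h : HalfCubeRel u w v s t) (hv : v ∈ t) :
    M.symm.Matches (G.differential c) (H.differential c') h := by
  have d1 := M.huv
  have d2 := M.huw
  have d3 := M.hvw
  have hwt := h.v_notMem
  have hvs := h.w_mem
  have hus : u ∉ s := fun h0 => h.u_iff.1 h0 hv
  refine M.symm.matches_differential h (fun k hu hw hv' => hβ _ _ _ ?_) ?_
  · exact mem_flip.2 (Or.inl ⟨hv, Ne.symm hv'⟩)
  by_cases hut : u ∈ t
  -- Corner `{v, w}` of `G` and `{u, v}` of `H`: the edge from `{w}` in `G` is matched by the zigzag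
  -- in `H`.
  · have hws : w ∈ s := h.v_iff.2 hut
    rw [if_pos hut, if_neg hwt, if_pos hv, if_neg hus, if_pos hws, if_pos hvs, zero_add,
      add_zero, map_add, M.symm.map_edge_v h, M.map_edge_w_symm hc' h hut hv]
    · refine fun t' h' => hα _ _ _ fun h0 => ?_
      have := h'.v_iff.2 h0.1
      rw [mem_flip] at this
      tauto
    · exact hβ _ _ _ (mem_flip.2 (Or.inl ⟨hv, d1.symm⟩))
  -- Corner `{v}` on both sides: the incoming edges at the three vertices start at the cancelled
  -- sources.
  · have hws : w ∉ s := mt h.v_iff.1 hut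
    have e1 : c' (flip t w) = 0 := hc'.1 _ (agreeOn_triple.2 (by
      simp only [mem_flip, Finset.mem_insert, Finset.mem_singleton]
      grind))
    have e2 : c (flip s v) = 0 := hc.1 _ (agreeOn_triple.2 (by
      simp only [mem_flip, Finset.notMem_empty]
      grind))
    rw [if_neg hut, if_neg hwt, if_pos hv, if_neg hus, if_neg hws, if_pos hvs, e1, e2]
    simp only [map_zero, add_zero]

/-- The two alternatives separate the five surviving corners by the correspondence that is used
there: `{w}`, `{u, w}`, `{u, v, w}` for the first, `{v}`, `{v, w}` for the second. -/
lemma rest_left_iff (s : Finset V) : s ∈ {s | ¬ AgreeOn {u, v, w} s ∅ ∧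
    ¬ AgreeOn {u, v, w} s (flip ∅ u) ∧ ¬ AgreeOn {u, v, w} s (flip (flip ∅ u) v)} ↔
    (w ∈ s ∧ (v ∈ s → u ∈ s)) ∨ (v ∈ s ∧ u ∉ s) := by
  have d1 := M.huv
  have d2 := M.huw
  have d3 := M.hvw
  simp only [agreeOn_triple, Set.mem_ofPred_eq, mem_flip, Finset.notMem_empty]
  by_cases h1 : u ∈ s <;> by_cases h2 : v ∈ s <;> by_cases h3 : w ∈ s <;>
    simp [h1, h2, h3, d1, d1.symm, d2.symm, d3.symm]

lemma rest_right_iff (t : Finset V) : t ∈ {s | ¬ AgreeOn {u, v, w} s {v, w} ∧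
    ¬ AgreeOn {u, v, w} s (flip {v, w} u) ∧ ¬ AgreeOn {u, v, w} s (flip (flip {v, w} u) v)} ↔
    (v ∉ t ∧ ¬ (u ∈ t ∧ w ∈ t)) ∨ (v ∈ t ∧ w ∉ t) := by
  have d1 := M.huv
  have d2 := M.huw
  have d3 := M.hvw
  simp only [agreeOn_triple, Set.mem_ofPred_eq, mem_flip, Finset.mem_insert,
    Finset.mem_singleton]
  by_cases h1 : u ∈ t <;> by_cases h2 : v ∈ t <;> by_cases h3 : w ∈ t <;>
    simp [h1, h2, h3, d1, d2, d3, d1.symm, d2.symm, d3.symm]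

theorem nonempty_Kh_equiv : Nonempty (G.Kh ≃ₗ[ZMod 2] H.Kh) := by
  let Φ : Finset V → Finset V → (V → ZMod 2) →ₗ[ZMod 2] (V → ZMod 2) := fun _ t =>
    if v ∈ t then H.halfCubeMap u w v else H.halfCubeMap u v w
  have hΦ₁ : ∀ s t, v ∉ t → Φ s t = H.halfCubeMap u v w := fun s t ht => if_neg ht
  have hΦ₂ : ∀ s t, v ∈ t → Φ s t = H.halfCubeMap u w v := fun s t ht => if_pos ht
  refine nonempty_Kh_equiv_of_isCore M.cancellation_left.isCore M.cancellation_right.isCore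
    -- The first correspondence omits the pair `{v, w}`, `{u, w}`, whose second member is cancelled
    -- in `H`; the second one pairs `{v, w}` with `{u, v}` instead. Requiring `v ∈ t` in the second
    -- makes the alternatives disjoint.
    (fun s t => (HalfCubeRel u v w s t ∧ ¬ (u ∈ t ∧ w ∈ t)) ∨ (HalfCubeRel u w v s t ∧ v ∈ t)) Φ
    ?_ ?_ ?_ ?_ ?_ ?_ ?_
  · intro s t h
    rw [M.rest_left_iff, M.rest_right_iff]
    rcases h with ⟨⟨-, h1, h2, h3, h4⟩, h5⟩ | ⟨⟨-, h1, h2, h3, h4⟩, h5⟩ <;> tauto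
  · intro s hs
    rw [M.rest_left_iff] at hs
    rcases hs with ⟨h1, h2⟩ | ⟨h1, h2⟩
    · obtain ⟨t, ht⟩ := HalfCubeRel.exists_right M.huv M.huw M.hvw h1
      exact ⟨t, Or.inl ⟨ht, fun h => ht.u_iff.1 (h2 (ht.v_iff.2 h.1)) h.2⟩⟩
    · obtain ⟨t, ht⟩ := HalfCubeRel.exists_right M.huw M.huv M.hvw.symm h1
      exact ⟨t, Or.inr ⟨ht, not_not.1 (mt ht.u_iff.2 h2)⟩⟩
  · intro t ht
    rw [M.rest_right_iff] at ht
    rcases ht with ⟨h1, h2⟩ | ⟨h1, h2⟩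
    · obtain ⟨s, hs⟩ := HalfCubeRel.exists_left M.huv M.huw M.hvw h1
      exact ⟨s, Or.inl ⟨hs, h2⟩⟩
    · obtain ⟨s, hs⟩ := HalfCubeRel.exists_left M.huw M.huv M.hvw.symm h2
      exact ⟨s, Or.inr ⟨hs, h1⟩⟩
  · have key : ∀ s t t', HalfCubeRel u v w s t → ¬ (u ∈ t ∧ w ∈ t) → HalfCubeRel u w v s t' →
        v ∈ t' → False := by
      rintro s t t' ⟨-, h1, h2, h3, h4⟩ h5 ⟨-, h6, h7, h8, h9⟩ h10
      tauto
    rintro s t t' (⟨h, h1⟩ | ⟨h, h1⟩) (⟨h', h2⟩ | ⟨h', h2⟩)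
    · exact h.right_unique h'
    · exact (key s t t' h h1 h' h2).elim
    · exact (key s t' t h' h2 h h1).elim
    · exact h.right_unique h'
  · rintro s s' t (⟨h, h1⟩ | ⟨h, h1⟩) (⟨h', h2⟩ | ⟨h', h2⟩)
    · exact h.left_unique h'
    · exact absurd h2 h.v_notMem
    · exact absurd h1 h'.v_notMem
    · exact h.left_unique h'
  · rintro s t (⟨h, h1⟩ | ⟨h, h1⟩)
    · rw [hΦ₁ s t h.v_notMem]
      exact M.bijOn h
    · rw [hΦ₂ s t h1]
      exact M.symm.bijOn h
  · intro c hc c' hc' hm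
    have hα : ∀ s t (h : HalfCubeRel u v w s t), ¬ (u ∈ t ∧ w ∈ t) → M.Matches c c' h := by
      intro s t h ht
      refine (hm s t (Or.inl ⟨h, ht⟩)).trans ?_
      congr 2
      exact transfer_congr _ _ fun p _ => by rw [hΦ₁ s t h.v_notMem]
    have hβ : ∀ s t (h : HalfCubeRel u w v s t), v ∈ t → M.symm.Matches c c' h := by
      intro s t h ht
      refine (hm s t (Or.inr ⟨h, ht⟩)).trans ?_
      congr 2
      exact transfer_congr _ _ fun p _ => by rw [hΦ₂ s t ht]
    rintro s t (⟨h, ht⟩ | ⟨h, ht⟩)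
    · refine (M.matches_differential_left hc hc' hα hβ h ht).trans ?_
      congr 2
      exact transfer_congr _ _ fun p _ => by rw [hΦ₁ s t h.v_notMem]
    · refine (M.matches_differential_right hc hc' hα hβ h ht).trans ?_
      congr 2
      exact transfer_congr _ _ fun p _ => by rw [hΦ₂ s t ht]

end ThirdMove

theorem Omega3.nonempty_Kh_equiv (h : G.Omega3 H) : Nonempty (G.Kh ≃ₗ[ZMod 2] H.Kh) := by
  obtain ⟨u, v, w, M⟩ := h.exists_thirdMove
  exact M.nonempty_Kh_equiv

end ThirdMoveChain
end LabeledGraph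

/-! ### Invariance on graph-links. -/

namespace FinLabeledGraph

lemma Move.nonempty_Kh_equiv {G H : FinLabeledGraph.{u}} (h : Move G H) :
    Nonempty (G.Kh ≃ₗ[ZMod 2] H.Kh) := by
  cases h with
  | iso _ _ h => exact h.nonempty_Kh_equiv
  | omega1 _ _ h => exact h.nonempty_Kh_equiv
  | omega2 _ _ h => exact h.nonempty_Kh_equiv
  | omega3 _ _ _ h => exact h.nonempty_Kh_equiv
  | omega4 _ _ _ h => exact h.nonempty_Kh_equiv
  | omega4' _ _ _ h => exact h.nonempty_Kh_equiv

lemma nonempty_Kh_equiv_of_link_eq {G H : FinLabeledGraph.{u}} (h : G.link = H.link) :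
    Nonempty (G.Kh ≃ₗ[ZMod 2] H.Kh) := by
  have h' : Relation.EqvGen Move G H := Quotient.exact h
  clear h
  induction h' with
  | rel _ _ h => exact h.nonempty_Kh_equiv
  | refl _ => exact ⟨LinearEquiv.refl _ _⟩
  | symm _ _ _ ih => exact ih.map LinearEquiv.symm
  | trans _ _ _ _ _ ih ih' => exact ih.elim fun e => ih'.map e.trans

end FinLabeledGraph

theorem mainTheorem1 :
    (∀ (V : Type u) (W : Type v) [Fintype V] [DecidableEq V] [Fintype W] [DecidableEq W]
      (G : LabeledGraph V) (H : LabeledGraph W),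
      G.Omega1 H → Nonempty (G.Kh ≃ₗ[ZMod 2] H.Kh)) ∧
    (∀ (V : Type u) (W : Type v) [Fintype V] [DecidableEq V] [Fintype W] [DecidableEq W]
      (G : LabeledGraph V) (H : LabeledGraph W),
      G.Omega2 H → Nonempty (G.Kh ≃ₗ[ZMod 2] H.Kh)) ∧
    (∀ (V : Type u) [Fintype V] [DecidableEq V] (G H : LabeledGraph V),
      G.Omega3 H → Nonempty (G.Kh ≃ₗ[ZMod 2] H.Kh)) ∧
    (∀ (V : Type u) [Fintype V] [DecidableEq V] (G H : LabeledGraph V),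
      G.Omega4 H → Nonempty (G.Kh ≃ₗ[ZMod 2] H.Kh)) ∧
    (∀ (V : Type u) [Fintype V] [DecidableEq V] (G H : LabeledGraph V),
      G.Omega4' H → Nonempty (G.Kh ≃ₗ[ZMod 2] H.Kh)) ∧
    (∀ G H : FinLabeledGraph.{u},
      G.link = H.link → Nonempty (G.Kh ≃ₗ[ZMod 2] H.Kh)) := by
  exact ⟨fun _ _ _ _ _ _ _ _ h => h.nonempty_Kh_equiv, fun _ _ _ _ _ _ _ _ h => h.nonempty_Kh_equiv,
    fun _ _ _ _ _ h => h.nonempty_Kh_equiv, fun _ _ _ _ _ h => h.nonempty_Kh_equiv,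
    fun _ _ _ _ _ h => h.nonempty_Kh_equiv,
    fun _ _ h => FinLabeledGraph.nonempty_Kh_equiv_of_link_eq h⟩
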